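/- **Setting.** Let $(\Omega,\mathcal F)$ be a measurable space and $\mathcal H$ a set of real random variables on it with $I_A\in\mathcal H$ for $A\in\mathcal F$, and $\varphi(Y_1,\dots,Y_n)\in\mathcal H$ whenever $Y_1,\dots,Y_n\in\mathcal H$ and $\varphi:\mathbb R^n\to\mathbb R$ satisfies $|\varphi(x)-\varphi(y)|\le C(1+|x|^m+|y|^m)|x-y|$ for some $C>0$, $m\in\mathbb N$. Let $\mathbb E:\mathcal H\to[-\infty,\infty]$ be a sublinear expectation: monotone, $\mathbb E[c]=c$, $\mathbb E[\lambda Y]=\lambda\mathbb E[Y]$ for $\lambda\ge0$, and $\mathbb E[Y+Z]\le\mathbb E[Y]+\mathbb E[Z]$ whenever the right side is not of the form $\infty-\infty$. Assume that it is countably sub-additive: $\mathbb E[Y]\le\sum_n\mathbb E[Y_n]$ whenever $0\le Y\le\sum_n Y_n$, $Y_n\ge0$. Put $\mathbb V(A)=\mathbb E[I_A]$ and $C_{\mathbb V}(Y)=\int_0^\infty\mathbb V(Y>x)\,dx+\int_{-\infty}^0(\mathbb V(Y>x)-1)\,dx$. A random vector $Z$ is *independent of* $Y$ if $\mathbb E[\psi(Y,Z)]=\mathbb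 E\big[\mathbb E[\psi(y,Z)]|_{y=Y}\big]$ for every Borel $\psi$ such that the random variables involved lie in $\mathcal H$, $\bar\psi(y):=\mathbb E|\psi(y,Z)|<\infty$ for all $y$, and $\mathbb E[\bar\psi(Y)]<\infty$. The sequence $(X_n)_{n\ge0}$ is *independent* if $X_{n+1}$ is independent of $(X_0,\dots,X_n)$ for every $n\ge 0$. $Y,Z$ are *identically distributed* if $\mathbb E[\psi(Y)]=\mathbb E[\psi(Z)]$ for every Borel $\psi$ with $\psi(Y),\psi(Z)\in\mathcal H$, whenever these expectations are finite. For triangular arrays, $a_{ni}\approx b_{ni}$ means that for some $C>0$ one has $a_{ni}\le Cb_{ni}$ and $b_{ni}\le Ca_{ni}$ for all sufficiently large $n$ and all admissible $i$. **Statement.** Let $(X_n)_{n\ge 0}$ be independent random variables in $\mathcal H$, each identically distributed as $X\in\mathcal H$. Let $p>0$, $r>1$, $q>\frac12$, $\beta>-q$; if $\frac12<q\le1$, suppose that $\mathbb E[X]=-\mathbb E[-X]=0$. Let $(a_{ni})_{0\le i\le n-1,\,n\ge1}$ be a triangular array of real numbers with $a_{ni}\approx\left(\frac{n-i}{n}\right)^{\beta}\frac1{n^q}$.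 For $n\ge1$ and $\epsilon>0$ put $M_{n,\epsilon}=\Big(\max_{0\le k\le n-1}\big|\sum_{i=0}^k a_{ni}X_i\big|^p-\epsilon\Big)^+$, and consider $$(\mathrm C)\quad\sum_{n=1}^\infty n^{r-2}C_{\mathbb V}(M_{n,\epsilon})<\infty\ \ \forall\epsilon>0,\qquad\qquad(\mathrm E)\quad\sum_{n=1}^\infty n^{r-2}\,\mathbb E[M_{n,\epsilon}]<\infty\ \ \forall\epsilon>0 .$$ Define the exponent $s$ and the condition $(\mathrm M)$ as follows. (i) If $\beta>-q/r$: $s=r/q$, and $(\mathrm M)$ is: $C_{\mathbb V}(|X|^p)<\infty$ when $p>s$; $C_{\mathbb V}(|X|^{s}\ln|X|)<\infty$ when $p=s$; $C_{\mathbb V}(|X|^{s})<\infty$ when $p<s$. (ii) If $\beta=-q/r$: $s=r/q$, and $(\mathrm M)$ is: $C_{\mathbb V}(|X|^p)<\infty$ when $p>s$; $C_{\mathbb V}(|X|^{s}\ln^2|X|)<\infty$ when $p=s$; $C_{\mathbb V}(|X|^{s}\ln|X|)<\infty$ when $p<s$. (iii) If $-q<\beta<-q/r$: $s=(r-1)/(q+\beta)$,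 and $(\mathrm M)$ is: $C_{\mathbb V}(|X|^p)<\infty$ when $p>s$; $C_{\mathbb V}(|X|^{s}\ln|X|)<\infty$ when $p=s$; $C_{\mathbb V}(|X|^{s})<\infty$ when $p<s$. Then in each of the three cases $(\mathrm M)$ is equivalent to $(\mathrm C)$. Moreover, in each case $(\mathrm M)$ implies $(\mathrm E)$, and if $p<s$ then $(\mathrm E)$ implies $(\mathrm M)$. (Here $0^s\ln 0=0^s\ln^2 0=0$.) -/

import Mathlib

open MeasureTheory Set
open scoped ENNReal

noncomputable section

/-- `φ : ℝⁿ → ℝ` belongs to `C_{l,Lip}(ℝⁿ)`. The norm on `Fin n → ℝ` is the sup norm; any other norm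
on `ℝⁿ` gives the same class of functions (only `C` changes). -/
def IsLocalLip {n : ℕ} (φ : (Fin n → ℝ) → ℝ) : Prop :=
  ∃ C : ℝ, 0 < C ∧ ∃ m : ℕ, ∀ x y : Fin n → ℝ,
    |φ x - φ y| ≤ C * (1 + ‖x‖ ^ m + ‖y‖ ^ m) * ‖x - y‖

/-- A sublinear expectation space `(Ω, H, E)` over a measurable space `Ω`, with `E` countably
sub-additive. Only the values of `E` on `H` are meaningful, and all axioms concern `H` only. -/
structure SublinearExpectationSpace (Ω : Type*) [MeasurableSpace Ω] where
  /-- the random variables on which the expectation is defined -/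
  H : Set (Ω → ℝ)
  measurable_of_mem : ∀ X ∈ H, Measurable X
  indicator_mem : ∀ A : Set Ω, MeasurableSet A → A.indicator (fun _ => (1 : ℝ)) ∈ H
  comp_mem : ∀ (n : ℕ) (X : Fin n → Ω → ℝ), (∀ i, X i ∈ H) →
    ∀ φ : (Fin n → ℝ) → ℝ, IsLocalLip φ → (fun ω => φ (fun i => X i ω)) ∈ H
  /-- the sublinear expectation -/
  E : (Ω → ℝ) → EReal
  mono : ∀ X ∈ H, ∀ Y ∈ H, (∀ ω, Y ω ≤ X ω) → E Y ≤ E X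
  const : ∀ c : ℝ, E (fun _ => c) = (c : EReal)
  pos_homogeneous : ∀ X ∈ H, ∀ l : ℝ, 0 ≤ l → E (fun ω => l * X ω) = (l : EReal) * E X
  subadditive : ∀ X ∈ H, ∀ Y ∈ H,
    ¬ (E X = ⊤ ∧ E Y = ⊥) → ¬ (E X = ⊥ ∧ E Y = ⊤) → E (fun ω => X ω + Y ω) ≤ E X + E Y
  /-- If `0 ≤ X ≤ ∑ Xₙ` with all `Xₙ ≥ 0` then `E X ≤ ∑ E Xₙ`. The series are taken in `[0,∞]`;
  nothing is lost, since `E` is nonnegative on nonnegative elements of `H`. -/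
  countably_subadditive : ∀ X ∈ H, ∀ Z : ℕ → Ω → ℝ, (∀ n, Z n ∈ H) →
    (∀ ω, 0 ≤ X ω) → (∀ n ω, 0 ≤ Z n ω) →
    (∀ ω, ENNReal.ofReal (X ω) ≤ ∑' n, ENNReal.ofReal (Z n ω)) →
    (E X).toENNReal ≤ ∑' n, (E (Z n)).toENNReal

namespace SublinearExpectationSpace

variable {Ω : Type*} [MeasurableSpace Ω] (S : SublinearExpectationSpace Ω)

/-- The capacity `V(A) = E[I_A]` of a measurable set (a number in `[0,1]`). -/
def cap (A : Set Ω) : ℝ≥0∞ := (S.E (A.indicator (fun _ => (1 : ℝ)))).toENNReal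

/-- The Choquet expectation
`C_V(Y) = ∫_0^∞ V(Y > x) dx + ∫_{-∞}^0 (V(Y > x) - 1) dx`, with values in `[-∞,∞]`. -/
def choquet (Y : Ω → ℝ) : EReal :=
  ((∫⁻ x in Ioi (0 : ℝ), S.cap {ω | x < Y ω} : ℝ≥0∞) : EReal)
    - ((∫⁻ x in Iio (0 : ℝ), (1 - S.cap {ω | x < Y ω}) : ℝ≥0∞) : EReal)

/-- The random vector `Y` is independent of the random vector `X`: for Borel `ψ`,
`E[ψ(X,Y)] = E[ E[ψ(x,Y)] |_{x = X} ]`, whenever the random variables whose expectation is taken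
belong to `H`, `E|ψ(x,Y)| < ∞` for each `x`, and `E[ E|ψ(x,Y)| |_{x = X} ] < ∞`.
(The inner expectations are then finite, so that `toReal` is harmless.) -/
def IndepOf {m n : ℕ} (Y : Fin n → Ω → ℝ) (X : Fin m → Ω → ℝ) : Prop :=
  ∀ ψ : (Fin m → ℝ) × (Fin n → ℝ) → ℝ, Measurable ψ →
    (fun ω => ψ (fun i => X i ω, fun j => Y j ω)) ∈ S.H →
    (∀ x, (fun ω => ψ (x, fun j => Y j ω)) ∈ S.H) →
    (∀ x, S.E (fun ω => |ψ (x, fun j => Y j ω)|) < ⊤) →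
    (fun ω => (S.E (fun ω' => |ψ (fun i => X i ω, fun j => Y j ω')|)).toReal) ∈ S.H →
    S.E (fun ω => (S.E (fun ω' => |ψ (fun i => X i ω, fun j => Y j ω')|)).toReal) < ⊤ →
    (fun ω => (S.E (fun ω' => ψ (fun i => X i ω, fun j => Y j ω'))).toReal) ∈ S.H →
    S.E (fun ω => ψ (fun i => X i ω, fun j => Y j ω)) =
      S.E (fun ω => (S.E (fun ω' => ψ (fun i => X i ω, fun j => Y j ω'))).toReal)

/-- `X₀, X₁, …` is a sequence of independent random variables: `Xₙ₊₁` is independent of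
`(X₀, …, Xₙ)` for every `n`. -/
def IndepSeq (X : ℕ → Ω → ℝ) : Prop :=
  ∀ n : ℕ, S.IndepOf (fun _ : Fin 1 => X (n + 1)) (fun i : Fin (n + 1) => X i)

/-- `X` and `Y` are identically distributed: `E[ψ(X)] = E[ψ(Y)]` for every Borel `ψ` with
`ψ(X), ψ(Y) ∈ H`, whenever these expectations are finite. -/
def IdentDistr (X Y : Ω → ℝ) : Prop :=
  ∀ ψ : ℝ → ℝ, Measurable ψ → (fun ω => ψ (X ω)) ∈ S.H → (fun ω => ψ (Y ω)) ∈ S.H →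
    S.E (fun ω => ψ (X ω)) ≠ ⊤ → S.E (fun ω => ψ (X ω)) ≠ ⊥ →
    S.E (fun ω => ψ (Y ω)) ≠ ⊤ → S.E (fun ω => ψ (Y ω)) ≠ ⊥ →
    S.E (fun ω => ψ (X ω)) = S.E (fun ω => ψ (Y ω))

/-- `C_V(|X|^p) < ∞` if `p > s`, `C_V(|X|^s ln|X|) < ∞` if `p = s`, and
`C_V(|X|^s) < ∞` if `p < s`. -/
def MomentCond (X : Ω → ℝ) (p s : ℝ) : Prop :=
  (s < p → S.choquet (fun ω => |X ω| ^ p) < ⊤) ∧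
  (p = s → S.choquet (fun ω => |X ω| ^ s * Real.log |X ω|) < ⊤) ∧
  (p < s → S.choquet (fun ω => |X ω| ^ s) < ⊤)

/-- `C_V(|X|^p) < ∞` if `p > s`, `C_V(|X|^s ln²|X|) < ∞` if `p = s`, and
`C_V(|X|^s ln|X|) < ∞` if `p < s`. -/
def LogMomentCond (X : Ω → ℝ) (p s : ℝ) : Prop :=
  (s < p → S.choquet (fun ω => |X ω| ^ p) < ⊤) ∧
  (p = s → S.choquet (fun ω => |X ω| ^ s * Real.log |X ω| ^ 2) < ⊤) ∧
  (p < s → S.choquet (fun ω => |X ω| ^ s * Real.log |X ω|) < ⊤)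

end SublinearExpectationSpace

/-- `a_{ni} ≪ b_{ni}` for triangular arrays indexed by `0 ≤ i ≤ n - 1`, `n ≥ 1`: for some `C > 0`,
`a_{ni} ≤ C b_{ni}` for all large `n` and all such `i`. -/
def ArrayLL (a b : ℕ → ℕ → ℝ) : Prop :=
  ∃ C : ℝ, 0 < C ∧ ∃ N : ℕ, ∀ n, N ≤ n → ∀ i, i < n → a n i ≤ C * b n i

/-- `a_{ni} ≈ b_{ni}`, that is `a_{ni} ≪ b_{ni}` and `b_{ni} ≪ a_{ni}`. -/
def ArrayApprox (a b : ℕ → ℕ → ℝ) : Prop := ArrayLL a b ∧ ArrayLL b a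

/-- The reversed weights `((n - i)/n)^β (1/n^q)`. -/
def reversedWeight (β q : ℝ) (n i : ℕ) : ℝ :=
  (((n : ℝ) - (i : ℝ)) / (n : ℝ)) ^ β * (1 / (n : ℝ) ^ q)

/-- The positive part `(max_{0 ≤ k ≤ n-1} |∑_{i=0}^k a_{ni} X_i|^p - ε)^+`, for `n ≥ 1`. -/
def excess {Ω : Type*} (a : ℕ → ℕ → ℝ) (X : ℕ → Ω → ℝ) (p ε : ℝ) (n : ℕ) (ω : Ω) : ℝ :=
  max ((⨆ k : Fin n, |∑ i ∈ Finset.range ((k : ℕ) + 1), a n i * X i ω| ^ p) - ε) 0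

namespace SublinearExpectationSpace

variable {Ω : Type*} [MeasurableSpace Ω] (S : SublinearExpectationSpace Ω)

/-- Complete `p`-th moment convergence in the Choquet sense: for all `ε > 0`,
`∑_{n ≥ 1} n^{r-2} C_V((max_{0 ≤ k ≤ n-1} |∑_{i=0}^k a_{ni} X_i|^p - ε)^+) < ∞`. -/
def ChoquetMomentConv (a : ℕ → ℕ → ℝ) (X : ℕ → Ω → ℝ) (p r : ℝ) : Prop :=
  ∀ ε : ℝ, 0 < ε →
    ∑' n : ℕ, ENNReal.ofReal (((n + 1 : ℕ) : ℝ) ^ (r - 2)) *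
      (S.choquet (excess a X p ε (n + 1))).toENNReal < ⊤

/-- Complete `p`-th moment convergence in the sense of `E`: for all `ε > 0`,
`∑_{n ≥ 1} n^{r-2} E((max_{0 ≤ k ≤ n-1} |∑_{i=0}^k a_{ni} X_i|^p - ε)^+) < ∞`. -/
def ExpectationMomentConv (a : ℕ → ℕ → ℝ) (X : ℕ → Ω → ℝ) (p r : ℝ) : Prop :=
  ∀ ε : ℝ, 0 < ε →
    ∑' n : ℕ, ENNReal.ofReal (((n + 1 : ℕ) : ℝ) ^ (r - 2)) *
      (S.E (excess a X p ε (n + 1))).toENNReal < ⊤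

end SublinearExpectationSpace

end

/-! ### Integrals over half-lines and series -/

/-! Put G(x) = V(|X| > x) and count each row from its end, so that the weights become comparable to
1/z_{nj} with z_{nj} = n^{q+β} j^{-β}, 1 ≤ j ≤ n. The maximal weighted sum exceeds a level y
essentially when a single summand does, so the capacity of that event behaves like the row sum ∑_j
G(y z_{nj}), up to constants inside G and a summable error. The theorem then reduces to real
analysis of the series ∑_n n^{r-2} ∑_j G(x^{1/p} z_{nj}), integrated over levels x > ε for the
Choquet version and taken at a fixed level for E.

Upper comparison (`cap_exists_lt_abs_sum_le`): if no summand exceeds y/t, then clamping the summands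
at y/t changes nothing. The exponentials of the clamped sums, suitably compensated, form a
nonnegative supermartingale, and Ville's inequality with an optimised parameter gives a bound of
order D^{t/2}, where D is a sum of v-th moments. Here v is chosen with qv > 1, so D decays like a
negative power of n, and a large t makes the error summable and integrable.

Lower comparison (`min_one_rowSum_le_exceedCap`): a summand larger than 2y forces one of two
consecutive partial sums above y, and for independent events min(1, ∑ V(A_i)) ≤ 2 V(⋃ A_i). The
minimum with 1 is removed by `exists_forall_rowSum_lt_one`: one large row would make the following
block of rows large after a dilation, and since r > 1 the series could not converge.

Analysis: the weighted number of lattice points with z_{nj} < u is of order u^s (1 + ln u)^l, with s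
as in the statement and l = 1 exactly when β = -q/r. Hence the double series is finite together with
∫ G(u) u^{s-1} (1 + ln u)^l du, up to dilations of G. Integrating over the level x and exchanging
integrals produces ∫_1^w u^{s-p-1} (1 + ln u)^l du, which grows like w^{s-p} times the old
logarithm, gains one logarithm, or stays bounded, according as p < s, p = s or p > s. This is the
source of the moment conditions.

For E, countable subadditivity gives E ≤ C_V on nonnegative variables. Conversely, Markov's
inequality recovers the series at a fixed level, which is all that is needed when p < s. -/

theorem lintegral_Ioi_comp_of_deriv_pos {φ φ' : ℝ → ℝ} {m : ℝ} (hcont : ContinuousOn φ (Ici m))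
    (hd : ∀ u ∈ Ioi m, HasDerivAt φ (φ' u) u) (hpos : ∀ u ∈ Ioi m, 0 < φ' u)
    (htop : Filter.Tendsto φ Filter.atTop Filter.atTop) (f : ℝ → ℝ≥0∞) :
    ∫⁻ x in Ioi (φ m), f x = ∫⁻ u in Ioi m, ENNReal.ofReal (φ' u) * f (φ u) := by
  have hmono : StrictMonoOn φ (Ici m) := by
    refine strictMonoOn_of_deriv_pos (convex_Ici m) hcont fun x hx => ?_
    rw [interior_Ici] at hx
    rw [(hd x hx).deriv]
    exact hpos x hx
  have himg : φ '' Ioi m = Ioi (φ m) := by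
    apply Subset.antisymm
    · rintro _ ⟨x, hx, rfl⟩
      exact hmono self_mem_Ici (Ioi_subset_Ici_self hx) hx
    · intro y hy
      obtain ⟨b, hb, hmb⟩ := ((htop.eventually_gt_atTop y).and (Filter.eventually_gt_atTop m)).exists
      obtain ⟨x, hx, rfl⟩ := intermediate_value_Ioo hmb.le
        (hcont.mono fun z hz => hz.1) ⟨hy, hb⟩
      exact ⟨x, hx.1, rfl⟩
  rw [← himg, lintegral_image_eq_lintegral_deriv_mul_of_monotoneOn measurableSet_Ioi
    (fun x hx => (hd x hx).hasDerivWithinAt) (hmono.monotoneOn.mono Ioi_subset_Ici_self)]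

/-- The substitution u = c x^a turns u^{b/a-1} du into a c^{b/a} x^{b-1} dx. The parameters are
chosen so that powers of n on the lattice side match powers of u on the integral side. -/
theorem lintegral_Ioi_comp_mul_rpow {a b c m : ℝ} (ha : 0 < a) (hc : 0 < c) (hm : 0 ≤ m)
    (G : ℝ → ℝ≥0∞) :
    ∫⁻ u in Ioi (c * m ^ a), G u * ENNReal.ofReal (u ^ (b / a - 1)) =
      ENNReal.ofReal (a * c ^ (b / a)) *
        ∫⁻ x in Ioi m, G (c * x ^ a) * ENNReal.ofReal (x ^ (b - 1)) := by
  have h := lintegral_Ioi_comp_of_deriv_pos (φ := fun x => c * x ^ a)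
    (φ' := fun x => c * (a * x ^ (a - 1))) (m := m)
    (continuousOn_const.mul (fun x _ => (Real.continuousAt_rpow_const x a
      (Or.inr ha.le)).continuousWithinAt))
    (fun u hu => (Real.hasDerivAt_rpow_const (Or.inl (hm.trans_lt hu).ne')).const_mul c)
    (fun u hu => by have := hm.trans_lt hu; positivity)
    ((tendsto_rpow_atTop ha).const_mul_atTop hc)
    (fun u => G u * ENNReal.ofReal (u ^ (b / a - 1)))
  rw [h, ← lintegral_const_mul' _ _ ENNReal.ofReal_ne_top]
  refine setLIntegral_congr_fun measurableSet_Ioi fun x hx => ?_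
  have hx0 : 0 < x := hm.trans_lt hx
  rw [mul_left_comm, mul_left_comm _ (G _), ← ENNReal.ofReal_mul (by positivity),
    ← ENNReal.ofReal_mul (by positivity)]
  congr 2
  rw [Real.mul_rpow hc.le (by positivity), ← Real.rpow_mul hx0.le, Real.rpow_sub hc, Real.rpow_one]
  have : x ^ (b - 1) = x ^ (a * (b / a - 1)) * x ^ (a - 1) := by
    rw [← Real.rpow_add hx0]
    congr 1
    field_simp
    ring
  rw [this]
  field_simp

theorem lintegral_Ioi_natCast_eq_tsum (k : ℕ) (h : ℝ → ℝ≥0∞) :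
    ∫⁻ x in Ioi (k : ℝ), h x = ∑' n : ℕ, ∫⁻ x in Ioc ((k + n : ℕ) : ℝ) ((k + n + 1 : ℕ) : ℝ), h x := by
  have hU : Ioi (k : ℝ) = ⋃ n : ℕ, Ioc ((k + n : ℕ) : ℝ) ((k + n + 1 : ℕ) : ℝ) := by
    ext x
    simp only [mem_Ioi, mem_iUnion, mem_Ioc]
    constructor
    · intro hx
      have h0 : 0 ≤ x := (Nat.cast_nonneg k).trans hx.le
      have h1 : k < ⌈x⌉₊ := Nat.lt_ceil.2 hx
      refine ⟨⌈x⌉₊ - 1 - k, ?_, ?_⟩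
      · rw [show k + (⌈x⌉₊ - 1 - k) = ⌈x⌉₊ - 1 by omega]
        exact Nat.lt_ceil.1 (by omega)
      · rw [show k + (⌈x⌉₊ - 1 - k) + 1 = ⌈x⌉₊ by omega]
        exact Nat.le_ceil x
    · rintro ⟨n, hn, -⟩
      refine lt_of_le_of_lt ?_ hn
      exact_mod_cast Nat.le_add_right k n
  rw [hU, lintegral_iUnion (fun _ => measurableSet_Ioc)]
  have hm : Monotone fun n : ℕ => ((k + n : ℕ) : ℝ) := fun i j hij => by
    simpa using hij
  exact hm.pairwise_disjoint_on_Ioc_succ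

theorem tsum_le_lintegral_Ioi (k : ℕ) {f : ℕ → ℝ≥0∞} {h : ℝ → ℝ≥0∞}
    (hfh : ∀ n : ℕ, ∀ x ∈ Ioc ((k + n : ℕ) : ℝ) ((k + n + 1 : ℕ) : ℝ), f n ≤ h x) :
    ∑' n, f n ≤ ∫⁻ x in Ioi (k : ℝ), h x := by
  rw [lintegral_Ioi_natCast_eq_tsum]
  refine ENNReal.tsum_le_tsum fun n => ?_
  calc f n = ∫⁻ _ in Ioc ((k + n : ℕ) : ℝ) ((k + n + 1 : ℕ) : ℝ), f n := by simp
    _ ≤ _ := setLIntegral_mono' measurableSet_Ioc (hfh n)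

theorem lintegral_Ioi_le_tsum (k : ℕ) {f : ℕ → ℝ≥0∞} {h : ℝ → ℝ≥0∞}
    (hfh : ∀ n : ℕ, ∀ x ∈ Ioc ((k + n : ℕ) : ℝ) ((k + n + 1 : ℕ) : ℝ), h x ≤ f n) :
    ∫⁻ x in Ioi (k : ℝ), h x ≤ ∑' n, f n := by
  rw [lintegral_Ioi_natCast_eq_tsum]
  refine ENNReal.tsum_le_tsum fun n => ?_
  calc _ ≤ ∫⁻ _ in Ioc ((k + n : ℕ) : ℝ) ((k + n + 1 : ℕ) : ℝ), f n :=
        setLIntegral_mono' measurableSet_Ioc (hfh n)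
    _ = f n := by simp

/-! ### Power sums -/

/-- For b ≥ 1 the right side is t; for b ≤ 1 this is Bernoulli's inequality. Treating both ranges at
once avoids splitting on the sign of the exponent in the power sums. -/
theorem rpow_le_one_sub_min_mul {b t : ℝ} (ht0 : 0 ≤ t) (ht1 : t ≤ 1) (hb : 0 < b) :
    t ^ b ≤ 1 - min 1 b * (1 - t) := by
  rcases le_total 1 b with h | h
  · rw [min_eq_left h]
    have := Real.rpow_le_rpow_of_exponent_ge' ht0 ht1 zero_le_one h
    rw [Real.rpow_one] at this
    linarith
  · rw [min_eq_right h]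
    have := rpow_one_add_le_one_add_mul_self (s := t - 1) (by linarith) hb.le h
    rw [add_sub_cancel] at this
    linarith

/-- Telescoping: the previous inequality at t = N/(N+1) bounds N^{a+1} by (N+1)^{a+1} minus min(1,
a+1) (N+1)^a. -/
theorem sum_range_rpow_le {a : ℝ} (ha : -1 < a) (N : ℕ) :
    ∑ j ∈ Finset.range N, ((j + 1 : ℕ) : ℝ) ^ a ≤ (min 1 (a + 1))⁻¹ * (N : ℝ) ^ (a + 1) := by
  have hb : 0 < a + 1 := by linarith
  have hmin : 0 < min 1 (a + 1) := lt_min one_pos hb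
  induction N with
  | zero => simp [Real.zero_rpow hb.ne']
  | succ N ih =>
    rw [Finset.sum_range_succ]
    have hN : (0 : ℝ) < ((N + 1 : ℕ) : ℝ) := by positivity
    have h1 := rpow_le_one_sub_min_mul (t := (N : ℝ) / ((N + 1 : ℕ) : ℝ)) (by positivity)
      (by rw [div_le_one hN]; push_cast; linarith) hb
    rw [Real.div_rpow (by positivity) hN.le, div_le_iff₀ (by positivity)] at h1
    have h2 : ((N + 1 : ℕ) : ℝ) ^ (a + 1) = ((N + 1 : ℕ) : ℝ) ^ a * ((N + 1 : ℕ) : ℝ) := by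
      rw [Real.rpow_add hN, Real.rpow_one]
    have h3 : (1 - (N : ℝ) / ((N + 1 : ℕ) : ℝ)) * ((N + 1 : ℕ) : ℝ) = 1 := by
      field_simp
      push_cast
      ring
    have h4 : (N : ℝ) ^ (a + 1) ≤ ((N + 1 : ℕ) : ℝ) ^ (a + 1)
        - min 1 (a + 1) * ((N + 1 : ℕ) : ℝ) ^ a := by
      have : (1 - min 1 (a + 1) * (1 - (N : ℝ) / ((N + 1 : ℕ) : ℝ))) * ((N + 1 : ℕ) : ℝ) ^ (a + 1)
          = ((N + 1 : ℕ) : ℝ) ^ (a + 1) - min 1 (a + 1) * ((N + 1 : ℕ) : ℝ) ^ a *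
            ((1 - (N : ℝ) / ((N + 1 : ℕ) : ℝ)) * ((N + 1 : ℕ) : ℝ)) := by
        rw [h2]; ring
      rw [this, h3] at h1
      linarith
    calc _ ≤ (min 1 (a + 1))⁻¹ * (((N + 1 : ℕ) : ℝ) ^ (a + 1)
          - min 1 (a + 1) * ((N + 1 : ℕ) : ℝ) ^ a) + ((N + 1 : ℕ) : ℝ) ^ a := by gcongr; exact ih.trans (by gcongr)
      _ = _ := by field_simp; ring

theorem ENNReal.ofReal_sum_range_rpow_le {a : ℝ} (ha : -1 < a) (N : ℕ) :
    ∑ j ∈ Finset.range N, ENNReal.ofReal (((j + 1 : ℕ) : ℝ) ^ a) ≤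
      ENNReal.ofReal ((min 1 (a + 1))⁻¹ * (N : ℝ) ^ (a + 1)) := by
  rw [← ENNReal.ofReal_sum_of_nonneg fun _ _ => by positivity]
  exact ENNReal.ofReal_le_ofReal (sum_range_rpow_le ha N)

/-- A series over the `n` with `n + 1 ≤ Y` is a finite sum. -/
theorem tsum_ite_le_eq_sum_range (f : ℕ → ℝ≥0∞) (Y : ℝ) :
    ∑' n : ℕ, (if ((n + 1 : ℕ) : ℝ) ≤ Y then f n else 0) = ∑ n ∈ Finset.range ⌊Y⌋₊, f n := by
  rw [tsum_eq_sum (s := Finset.range ⌊Y⌋₊)]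
  · refine Finset.sum_congr rfl fun n hn => if_pos ?_
    exact (Nat.le_floor_iff' n.succ_ne_zero).1 (Finset.mem_range.1 hn)
  · intro n hn
    refine if_neg fun h => hn ?_
    exact Finset.mem_range.2 ((Nat.le_floor_iff' n.succ_ne_zero).2 h)

theorem tsum_ite_le_rpow_le {a Y : ℝ} (ha : -1 < a) (hY : 0 ≤ Y) :
    ∑' n : ℕ, (if ((n + 1 : ℕ) : ℝ) ≤ Y then ENNReal.ofReal (((n + 1 : ℕ) : ℝ) ^ a) else 0) ≤
      ENNReal.ofReal ((min 1 (a + 1))⁻¹ * Y ^ (a + 1)) := by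
  rw [tsum_ite_le_eq_sum_range]
  refine (ENNReal.ofReal_sum_range_rpow_le ha _).trans (ENNReal.ofReal_le_ofReal ?_)
  have hmin : 0 < min 1 (a + 1) := lt_min one_pos (by linarith)
  have := Nat.floor_le hY
  gcongr
  linarith

theorem lintegral_Ioi_rpow_neg {b U : ℝ} (hb : 1 < b) (hU : 0 < U) :
    ∫⁻ x in Ioi U, ENNReal.ofReal (x ^ (-b)) = ENNReal.ofReal (U ^ (1 - b) / (b - 1)) := by
  rw [← ofReal_integral_eq_lintegral_ofReal (integrableOn_Ioi_rpow_of_lt (by linarith) hU)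
    ((ae_restrict_mem measurableSet_Ioi).mono fun x hx => by
      have := hU.trans hx
      simp only [Pi.zero_apply]
      positivity),
    integral_Ioi_rpow_of_lt (by linarith) hU, ← neg_div_neg_eq]
  congr 2
  · rw [neg_neg]; congr 1; ring
  · ring

/-- The term with index n + 1 is compared with the integrand on (n+1, n+2], where x ≤ 2(n+1); this
costs the factor 2^b. -/
theorem tsum_ite_lt_rpow_neg_le {b U : ℝ} (hb : 1 < b) (hU : 1 ≤ U) :
    ∑' n : ℕ, (if U < ((n + 1 : ℕ) : ℝ) then ENNReal.ofReal (((n + 1 : ℕ) : ℝ) ^ (-b)) else 0) ≤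
      ENNReal.ofReal (2 ^ b / (b - 1) * U ^ (1 - b)) := by
  calc _ ≤ ∫⁻ x in Ioi ((1 : ℕ) : ℝ), (Ioi U).indicator
          (fun x => ENNReal.ofReal (2 ^ b) * ENNReal.ofReal (x ^ (-b))) x := by
        refine tsum_le_lintegral_Ioi 1 fun n x hx => ?_
        split_ifs with h
        · rw [show 1 + n = n + 1 by ring] at hx
          have hx1 : U < x := h.trans hx.1
          have hn : (0 : ℝ) < ((n + 1 : ℕ) : ℝ) := by positivity
          have hx2 : x ≤ 2 * ((n + 1 : ℕ) : ℝ) := by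
            refine hx.2.trans ?_
            push_cast
            have : (0 : ℝ) ≤ n := n.cast_nonneg
            linarith
          have hx0 : 0 < x := hn.trans hx.1
          rw [indicator_of_mem (show x ∈ Ioi U from hx1), ← ENNReal.ofReal_mul (by positivity)]
          refine ENNReal.ofReal_le_ofReal ?_
          rw [Real.rpow_neg hn.le, Real.rpow_neg hx0.le, ← div_eq_mul_inv, inv_eq_one_div,
            div_le_div_iff₀ (by positivity) (by positivity), one_mul,
            ← Real.mul_rpow (by norm_num) hn.le]
          gcongr
        · exact zero_le
    _ ≤ ∫⁻ x, (Ioi U).indicator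
          (fun x => ENNReal.ofReal (2 ^ b) * ENNReal.ofReal (x ^ (-b))) x :=
        lintegral_mono' Measure.restrict_le_self le_rfl
    _ = _ := by
        rw [lintegral_indicator measurableSet_Ioi, lintegral_const_mul' _ _ ENNReal.ofReal_ne_top,
          lintegral_Ioi_rpow_neg hb (by linarith), ← ENNReal.ofReal_mul (by positivity)]
        congr 1
        ring

/-! ### Counting lattice points -/

/-- The reciprocal `n^{q+β} j^{-β}` of a reversed weight, with `n` and `j` shifted by one. -/
noncomputable def rowScale (β q : ℝ) (n j : ℕ) : ℝ :=
  ((n + 1 : ℕ) : ℝ) ^ (q + β) * ((j + 1 : ℕ) : ℝ) ^ (-β)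

theorem rowScale_pos (β q : ℝ) (n j : ℕ) : 0 < rowScale β q n j := by
  unfold rowScale; positivity

/-- Since j ≤ n and q + β ≥ 0, replacing n by j in the first factor can only decrease it. Hence a
lattice point below u must have j ≤ u^{1/q}. -/
theorem rpow_le_rowScale {β q : ℝ} (h : 0 ≤ q + β) {n j : ℕ} (hj : j ≤ n) :
    ((j + 1 : ℕ) : ℝ) ^ q ≤ rowScale β q n j := by
  have hj0 : (0 : ℝ) < ((j + 1 : ℕ) : ℝ) := by positivity
  have : ((j + 1 : ℕ) : ℝ) ^ q = ((j + 1 : ℕ) : ℝ) ^ (q + β) * ((j + 1 : ℕ) : ℝ) ^ (-β) := by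
    rw [← Real.rpow_add hj0]; congr 1; ring
  rw [this, rowScale]
  gcongr

theorem one_le_rowScale {β q : ℝ} (hq : 0 ≤ q) (h : 0 ≤ q + β) {n j : ℕ} (hj : j ≤ n) :
    1 ≤ rowScale β q n j := by
  refine le_trans (Real.one_le_rpow ?_ hq) (rpow_le_rowScale h hj)
  push_cast
  have : (0 : ℝ) ≤ j := j.cast_nonneg
  linarith

theorem tsum_sum_range_succ_comm (f : ℕ → ℕ → ℝ≥0∞) :
    ∑' n, ∑ j ∈ Finset.range (n + 1), f n j = ∑' j, ∑' n, if j ≤ n then f n j else 0 := by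
  rw [ENNReal.tsum_comm]
  refine tsum_congr fun n => ?_
  rw [tsum_eq_sum (s := Finset.range (n + 1))]
  · exact Finset.sum_congr rfl fun j hj =>
      (if_pos (Nat.lt_succ_iff.1 (Finset.mem_range.1 hj))).symm
  · intro j hj
    exact if_neg fun h => hj (Finset.mem_range.2 (Nat.lt_succ_iff.2 h))

/-- The number of lattice points `(n, j)`, `1 ≤ j ≤ n`, with `n^{q+β} j^{-β} < u`, the point
`(n, j)` being counted with the weight `n^{r-2}`. -/
noncomputable def latticeCount (r β q u : ℝ) : ℝ≥0∞ :=
  ∑' n : ℕ, ∑ j ∈ Finset.range (n + 1),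
    if rowScale β q n j < u then ENNReal.ofReal (((n + 1 : ℕ) : ℝ) ^ (r - 2)) else 0

/-- For fixed j the condition reads n^{q+β} < u j^β, and summing n^{r-2} over such n gives (u
j^β)^{(r-1)/(q+β)}. The remaining exponent of j is less than -1 when β < -q/r, giving a convergent
series, and equal to -1 when β = -q/r, giving the harmonic sum and its logarithm. -/
theorem latticeCount_le_mul_tsum {r β q : ℝ} (hr : 1 < r) (hq : 0 < q) (hqβ : 0 < q + β) {u : ℝ}
    (hu : 0 < u) :
    latticeCount r β q u ≤
      ENNReal.ofReal ((min 1 (r - 1))⁻¹ * u ^ ((r - 1) / (q + β))) *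
        ∑' j : ℕ, if ((j + 1 : ℕ) : ℝ) ≤ u ^ (1 / q) then
          ENNReal.ofReal (((j + 1 : ℕ) : ℝ) ^ (β * ((r - 1) / (q + β)))) else 0 := by
  unfold latticeCount
  rw [tsum_sum_range_succ_comm, ← ENNReal.tsum_mul_left]
  refine ENNReal.tsum_le_tsum fun j => ?_
  have hj0 : (0 : ℝ) < ((j + 1 : ℕ) : ℝ) := by positivity
  set J : ℝ := ((j + 1 : ℕ) : ℝ) with hJ
  split_ifs with hju
  · calc _ ≤ ∑' n : ℕ, (if ((n + 1 : ℕ) : ℝ) ≤ (u * J ^ β) ^ (1 / (q + β)) then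
            ENNReal.ofReal (((n + 1 : ℕ) : ℝ) ^ (r - 2)) else 0) := by
          refine ENNReal.tsum_le_tsum fun n => ?_
          split_ifs with h1 h2 h3 <;> try simp
          refine absurd ?_ h3
          rw [← Real.rpow_le_rpow_iff (z := q + β) (by positivity) (by positivity) hqβ,
            ← Real.rpow_mul (by positivity), one_div_mul_cancel hqβ.ne', Real.rpow_one]
          rw [rowScale, ← hJ, Real.rpow_neg hj0.le, ← div_eq_mul_inv,
            div_lt_iff₀ (by positivity)] at h2
          exact h2.le
      _ ≤ ENNReal.ofReal ((min 1 (r - 2 + 1))⁻¹ * ((u * J ^ β) ^ (1 / (q + β))) ^ (r - 2 + 1)) :=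
          tsum_ite_le_rpow_le (by linarith) (by positivity)
      _ = _ := by
          have : 0 < min 1 (r - 1) := lt_min one_pos (by linarith)
          rw [← ENNReal.ofReal_mul (by positivity)]
          congr 1
          rw [show r - 2 + 1 = r - 1 by ring, ← Real.rpow_mul (by positivity),
            Real.mul_rpow hu.le (by positivity), ← Real.rpow_mul hj0.le, mul_assoc]
          congr 3 <;> ring
  · rw [mul_zero, nonpos_iff_eq_zero, ENNReal.tsum_eq_zero]
    intro n
    split_ifs with h1 h2 <;> try rfl
    refine absurd ?_ hju
    rw [← Real.rpow_le_rpow_iff (z := q) hj0.le (by positivity) hq,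
      ← Real.rpow_mul hu.le, one_div_mul_cancel hq.ne', Real.rpow_one]
    exact (rpow_le_rowScale hqβ.le h1).trans h2.le

theorem latticeCount_le_of_lt {r β q : ℝ} (hr : 1 < r) (hq : 0 < q) (hqβ : 0 < q + β)
    (h : β < -q / r) :
    ∃ C : ℝ, 0 < C ∧ ∀ u : ℝ, 1 ≤ u →
      latticeCount r β q u ≤ ENNReal.ofReal (C * u ^ ((r - 1) / (q + β))) := by
  have hr0 : 0 < r := by linarith
  have hβ : β * ((r - 1) / (q + β)) < -1 := by
    rw [lt_div_iff₀ hr0] at h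
    rw [← mul_div_assoc, div_lt_iff₀ hqβ]
    linarith
  have hs : Summable fun j : ℕ => ((j + 1 : ℕ) : ℝ) ^ (β * ((r - 1) / (q + β))) :=
    (summable_nat_add_iff 1).2 (Real.summable_nat_rpow.2 hβ)
  set T := ∑' j : ℕ, ENNReal.ofReal (((j + 1 : ℕ) : ℝ) ^ (β * ((r - 1) / (q + β)))) with hT
  have hTfin : T ≠ ⊤ := hs.tsum_ofReal_ne_top
  have hmin : 0 < min 1 (r - 1) := lt_min one_pos (by linarith)
  refine ⟨(min 1 (r - 1))⁻¹ * (T.toReal + 1), by positivity, fun u hu => ?_⟩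
  have hu0 : 0 < u := by linarith
  refine (latticeCount_le_mul_tsum hr hq hqβ hu0).trans ?_
  calc _ ≤ ENNReal.ofReal ((min 1 (r - 1))⁻¹ * u ^ ((r - 1) / (q + β))) * T := by
        gcongr
        refine ENNReal.tsum_le_tsum fun j => ?_
        split_ifs
        · exact le_rfl
        · exact zero_le
    _ ≤ ENNReal.ofReal ((min 1 (r - 1))⁻¹ * u ^ ((r - 1) / (q + β))) *
          ENNReal.ofReal (T.toReal + 1) := by
        gcongr
        exact (ENNReal.ofReal_toReal hTfin).symm.le.trans (ENNReal.ofReal_le_ofReal (by linarith))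
    _ = _ := by
        rw [← ENNReal.ofReal_mul (by positivity)]
        congr 1
        ring

theorem latticeCount_le_of_eq {r β q : ℝ} (hr : 1 < r) (hq : 0 < q) (h : β = -q / r) :
    ∃ C : ℝ, 0 < C ∧ ∀ u : ℝ, 1 ≤ u →
      latticeCount r β q u ≤ ENNReal.ofReal (C * (u ^ (r / q) * (1 + Real.log u))) := by
  have hr0 : 0 < r := by linarith
  have hr1 : 0 < r - 1 := by linarith
  have hqβ' : q + β = q * (r - 1) / r := by rw [h]; field_simp; ring
  have hqβ : 0 < q + β := by rw [hqβ']; positivity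
  have hs : (r - 1) / (q + β) = r / q := by rw [hqβ']; field_simp
  have hβ : β * (r / q) = -1 := by rw [h]; field_simp
  have hmin : 0 < min 1 (r - 1) := lt_min one_pos (by linarith)
  refine ⟨(min 1 (r - 1))⁻¹ * (1 + 1 / q), by positivity, fun u hu => ?_⟩
  have hu0 : 0 < u := by linarith
  have hlog : 0 ≤ Real.log u := Real.log_nonneg hu
  have hU : 1 ≤ u ^ (1 / q) := Real.one_le_rpow hu (by positivity)
  refine (latticeCount_le_mul_tsum hr hq hqβ hu0).trans ?_
  rw [hs, hβ, tsum_ite_le_eq_sum_range, ← ENNReal.ofReal_sum_of_nonneg fun _ _ => by positivity,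
    ← ENNReal.ofReal_mul (by positivity)]
  refine ENNReal.ofReal_le_ofReal ?_
  have hharm := harmonic_floor_le_one_add_log (u ^ (1 / q)) hU
  rw [Real.log_rpow hu0] at hharm
  have : ∑ n ∈ Finset.range ⌊u ^ (1 / q)⌋₊, ((n + 1 : ℕ) : ℝ) ^ (-1 : ℝ) =
      (harmonic ⌊u ^ (1 / q)⌋₊ : ℝ) := by
    simp [harmonic, Real.rpow_neg_one]
  rw [this]
  have h2 : (harmonic ⌊u ^ (1 / q)⌋₊ : ℝ) ≤ (1 + 1 / q) * (1 + Real.log u) := by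
    refine hharm.trans ?_
    have : 0 < 1 / q := by positivity
    nlinarith
  calc _ ≤ (min 1 (r - 1))⁻¹ * u ^ (r / q) * ((1 + 1 / q) * (1 + Real.log u)) := by gcongr
    _ = _ := by ring

/-- With U = u^{1/q}, the rows n ≤ U are counted in full and give U^r. In the rows n > U the
indicator of z < u is bounded by (u/z)^t, and the resulting power sums are again of order u^{r/q}.
-/
theorem latticeCount_le_of_gt {r β q : ℝ} (hr : 1 < r) (hq : 0 < q) (h : -q / r < β) :
    ∃ C : ℝ, 0 < C ∧ ∀ u : ℝ, 1 ≤ u →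
      latticeCount r β q u ≤ ENNReal.ofReal (C * u ^ (r / q)) := by
  have hr0 : 0 < r := by linarith
  -- The first inequality makes the series over n > U converge, the second keeps the inner sum over
  -- j a power sum. For negative β such a t lies between r/q and 1/(-β), an interval that is
  -- nonempty because β > -q/r.
  obtain ⟨t, ht, htβ⟩ : ∃ t : ℝ, r / q < t ∧ -1 < β * t := by
    rcases le_or_gt 0 β with hβ | hβ
    · refine ⟨r / q + 1, by linarith, ?_⟩
      have : 0 ≤ β * (r / q + 1) := by positivity
      linarith
    · have h1 : r / q < 1 / (-β) := by
        rw [div_lt_div_iff₀ hq (by linarith)]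
        rw [div_lt_iff₀ hr0] at h
        linarith
      obtain ⟨t, ht1, ht2⟩ := exists_between h1
      refine ⟨t, ht1, ?_⟩
      rw [lt_div_iff₀ (by linarith)] at ht2
      linarith
  have ht0 : 0 < t := lt_trans (by positivity) ht
  have hb : 1 < q * t - r + 1 := by
    rw [div_lt_iff₀ hq] at ht
    linarith
  have hm1 : 0 < min 1 (r - 1 + 1) := lt_min one_pos (by linarith)
  have hm2 : 0 < min 1 (β * t + 1) := lt_min one_pos (by linarith)
  set b := q * t - r + 1 with hbdef
  refine ⟨(min 1 (r - 1 + 1))⁻¹ + (min 1 (β * t + 1))⁻¹ * (2 ^ b / (b - 1)), ?_, fun u hu => ?_⟩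
  · have : 0 < b - 1 := by linarith
    positivity
  have hu0 : 0 < u := by linarith
  set U := u ^ (1 / q) with hUdef
  have hU : 1 ≤ U := Real.one_le_rpow hu (by positivity)
  have hU0 : 0 < U := by linarith
  have hb1 : 0 < b - 1 := by linarith
  have hUpow : ∀ x : ℝ, U ^ x = u ^ (x / q) := fun x => by
    rw [hUdef, ← Real.rpow_mul hu0.le]; congr 1; ring
  unfold latticeCount
  calc _ ≤ ∑' n : ℕ, ((if ((n + 1 : ℕ) : ℝ) ≤ U then
            ENNReal.ofReal (((n + 1 : ℕ) : ℝ) ^ (r - 1)) else 0) +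
          ENNReal.ofReal (u ^ t * (min 1 (β * t + 1))⁻¹) * (if U < ((n + 1 : ℕ) : ℝ) then
            ENNReal.ofReal (((n + 1 : ℕ) : ℝ) ^ (-b)) else 0)) := by
        refine ENNReal.tsum_le_tsum fun n => ?_
        have hn : (0 : ℝ) < ((n + 1 : ℕ) : ℝ) := by positivity
        rcases le_or_gt ((n + 1 : ℕ) : ℝ) U with hnU | hnU
        · rw [if_pos hnU]
          refine le_trans ?_ le_self_add
          calc _ ≤ ∑ j ∈ Finset.range (n + 1), ENNReal.ofReal (((n + 1 : ℕ) : ℝ) ^ (r - 2)) := by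
                gcongr
                split_ifs
                · exact le_rfl
                · exact zero_le
            _ = _ := by
                rw [Finset.sum_const, Finset.card_range, nsmul_eq_mul, ← ENNReal.ofReal_natCast,
                  ← ENNReal.ofReal_mul hn.le]
                congr 1
                rw [show r - 1 = 1 + (r - 2) by ring, Real.rpow_add hn, Real.rpow_one]
        · rw [if_neg hnU.not_ge, if_pos hnU, zero_add]
          calc _ ≤ ∑ j ∈ Finset.range (n + 1),
                  ENNReal.ofReal (u ^ t * ((n + 1 : ℕ) : ℝ) ^ (r - 2 - (q + β) * t)) *
                    ENNReal.ofReal (((j + 1 : ℕ) : ℝ) ^ (β * t)) := by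
                gcongr with j hj
                split_ifs with hz
                · rw [← ENNReal.ofReal_mul (by positivity)]
                  refine ENNReal.ofReal_le_ofReal ?_
                  have hj0 : (0 : ℝ) < ((j + 1 : ℕ) : ℝ) := by positivity
                  have h1 : 1 ≤ (u / rowScale β q n j) ^ t :=
                    Real.one_le_rpow ((one_le_div (rowScale_pos _ _ _ _)).2 hz.le) ht0.le
                  refine (le_mul_of_one_le_right (by positivity) h1).trans_eq ?_
                  rw [Real.div_rpow hu0.le (rowScale_pos _ _ _ _).le, rowScale,
                    Real.mul_rpow (by positivity) (by positivity), ← Real.rpow_mul hn.le,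
                    ← Real.rpow_mul hj0.le, neg_mul, Real.rpow_neg hj0.le, Real.rpow_sub hn (r - 2)]
                  field_simp
                · exact zero_le
            _ ≤ ENNReal.ofReal (u ^ t * ((n + 1 : ℕ) : ℝ) ^ (r - 2 - (q + β) * t)) *
                  ENNReal.ofReal ((min 1 (β * t + 1))⁻¹ * ((n + 1 : ℕ) : ℝ) ^ (β * t + 1)) := by
                rw [← Finset.mul_sum]
                gcongr
                exact ENNReal.ofReal_sum_range_rpow_le htβ _
            _ = _ := by
                rw [← ENNReal.ofReal_mul (by positivity), ← ENNReal.ofReal_mul (by positivity)]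
                congr 1
                have : ((n + 1 : ℕ) : ℝ) ^ (-b) = ((n + 1 : ℕ) : ℝ) ^ (r - 2 - (q + β) * t) *
                    ((n + 1 : ℕ) : ℝ) ^ (β * t + 1) := by
                  rw [← Real.rpow_add hn]
                  congr 1
                  rw [hbdef]
                  ring
                rw [this]
                ring
    _ ≤ ENNReal.ofReal ((min 1 (r - 1 + 1))⁻¹ * U ^ (r - 1 + 1)) +
          ENNReal.ofReal (u ^ t * (min 1 (β * t + 1))⁻¹) *
            ENNReal.ofReal (2 ^ b / (b - 1) * U ^ (1 - b)) := by
        rw [ENNReal.tsum_add, ENNReal.tsum_mul_left]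
        gcongr
        · exact tsum_ite_le_rpow_le (by linarith) hU0.le
        · exact tsum_ite_lt_rpow_neg_le hb hU
    _ = _ := by
        rw [← ENNReal.ofReal_mul (by positivity), ← ENNReal.ofReal_add (by positivity)
          (by positivity)]
        congr 1
        rw [hUpow, hUpow, sub_add_cancel, show (1 - b) / q = r / q - t by
          rw [hbdef]; field_simp; ring, Real.rpow_sub hu0]
        field_simp

/-! ### Comparing a double series with an integral -/

/-- The integral `∫_1^∞ G(u) u^{s-1} (1 + ln u)^l du`. -/
noncomputable def tailMoment (G : ℝ → ℝ≥0∞) (s : ℝ) (l : ℕ) : ℝ≥0∞ :=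
  ∫⁻ u in Ioi (1 : ℝ), G u * ENNReal.ofReal (u ^ (s - 1) * (1 + Real.log u) ^ l)

/-- The sum `∑_{1 ≤ j ≤ n} G(n^{q+β} j^{-β})`, with `n` shifted by one. -/
noncomputable def rowSum (β q : ℝ) (G : ℝ → ℝ≥0∞) (n : ℕ) : ℝ≥0∞ :=
  ∑ j ∈ Finset.range (n + 1), G (rowScale β q n j)

/-- The series `∑_n n^{r-2} ∑_{1 ≤ j ≤ n} G(n^{q+β} j^{-β})`. -/
noncomputable def rowSeries (r β q : ℝ) (G : ℝ → ℝ≥0∞) : ℝ≥0∞ :=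
  ∑' n : ℕ, ENNReal.ofReal (((n + 1 : ℕ) : ℝ) ^ (r - 2)) * rowSum β q G n

/-- Average over u in (z, 2z], where G(z) ≤ G(u/2) and 1/z ≤ 2/u. Writing G(z) through the indicator
of z < u is what lets a sum over lattice points become a count. -/
theorem le_lintegral_Ioi_of_antitone {G : ℝ → ℝ≥0∞} (hG : Antitone G) {z : ℝ} (hz : 1 ≤ z) :
    G z ≤ ∫⁻ u in Ioi (1 : ℝ), if z < u then G (2⁻¹ * u) * ENNReal.ofReal (2 / u) else 0 := by
  have hz0 : 0 < z := by linarith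
  calc G z = ∫⁻ _ in Ioc z (2 * z), G z * ENNReal.ofReal z⁻¹ := by
        rw [setLIntegral_const, Real.volume_Ioc, mul_assoc, ← ENNReal.ofReal_mul (by positivity),
          show z⁻¹ * (2 * z - z) = 1 by field_simp; ring]
        simp
    _ ≤ ∫⁻ u in Ioc z (2 * z), if z < u then G (2⁻¹ * u) * ENNReal.ofReal (2 / u) else 0 := by
        refine setLIntegral_mono' measurableSet_Ioc fun u hu => ?_
        have hu0 : 0 < u := hz0.trans hu.1
        rw [if_pos hu.1]
        gcongr
        · exact hG (by linarith [hu.2])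
        · rw [inv_eq_one_div, div_le_div_iff₀ hz0 hu0]
          linarith [hu.2]
    _ ≤ _ := lintegral_mono_set fun u hu => hz.trans_lt hu.1

/-- A layer-cake argument: after the averaging bound, exchanging sum and integral leaves the lattice
count at u against G(u/2) du/u. -/
theorem rowSeries_le_tailMoment {r β q s C : ℝ} {l : ℕ} (hq : 0 ≤ q) (hqβ : 0 ≤ q + β)
    (hcount : ∀ u : ℝ, 1 ≤ u →
      latticeCount r β q u ≤ ENNReal.ofReal (C * (u ^ s * (1 + Real.log u) ^ l)))
    {G : ℝ → ℝ≥0∞} (hG : Antitone G) :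
    rowSeries r β q G ≤ ENNReal.ofReal (2 * C) * tailMoment (fun u => G (2⁻¹ * u)) s l := by
  have hmeas : Measurable fun u => G (2⁻¹ * u) * ENNReal.ofReal (2 / u) :=
    (hG.measurable.comp (measurable_const_mul _)).mul (by fun_prop)
  calc rowSeries r β q G
      ≤ ∑' n : ℕ, ENNReal.ofReal (((n + 1 : ℕ) : ℝ) ^ (r - 2)) * ∑ j ∈ Finset.range (n + 1),
          ∫⁻ u in Ioi (1 : ℝ),
            if rowScale β q n j < u then G (2⁻¹ * u) * ENNReal.ofReal (2 / u) else 0 := by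
        refine ENNReal.tsum_le_tsum fun n => ?_
        unfold rowSum
        gcongr with j hj
        exact le_lintegral_Ioi_of_antitone hG
          (one_le_rowScale hq hqβ (Nat.lt_succ_iff.1 (Finset.mem_range.1 hj)))
    _ = ∫⁻ u in Ioi (1 : ℝ), ∑' n : ℕ, ENNReal.ofReal (((n + 1 : ℕ) : ℝ) ^ (r - 2)) *
          ∑ j ∈ Finset.range (n + 1),
            if rowScale β q n j < u then G (2⁻¹ * u) * ENNReal.ofReal (2 / u) else 0 := by
        have hm : ∀ n j, Measurable fun u =>
            if rowScale β q n j < u then G (2⁻¹ * u) * ENNReal.ofReal (2 / u) else 0 :=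
          fun n j => Measurable.ite measurableSet_Ioi hmeas measurable_const
        rw [lintegral_tsum fun n => by
          exact ((Finset.measurable_sum _ fun j _ => hm n j).const_mul _).aemeasurable]
        refine tsum_congr fun n => ?_
        rw [lintegral_const_mul' _ _ ENNReal.ofReal_ne_top, lintegral_finsetSum _ fun j _ => hm n j]
    _ ≤ ∫⁻ u in Ioi (1 : ℝ), ENNReal.ofReal (2 * C) *
          (G (2⁻¹ * u) * ENNReal.ofReal (u ^ (s - 1) * (1 + Real.log u) ^ l)) := by
        refine setLIntegral_mono' measurableSet_Ioi fun u hu => ?_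
        have hu1 : (1 : ℝ) < u := hu
        have hu0 : 0 < u := by linarith
        have hlog := Real.log_nonneg hu1.le
        calc _ = G (2⁻¹ * u) * ENNReal.ofReal (2 / u) * latticeCount r β q u := by
              unfold latticeCount
              rw [← ENNReal.tsum_mul_left]
              refine tsum_congr fun n => ?_
              rw [Finset.mul_sum, Finset.mul_sum]
              refine Finset.sum_congr rfl fun j _ => ?_
              split_ifs <;> ring
          _ ≤ G (2⁻¹ * u) * ENNReal.ofReal (2 / u) *
                ENNReal.ofReal (C * (u ^ s * (1 + Real.log u) ^ l)) := by
              gcongr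
              exact hcount u hu1.le
          _ = _ := by
              rw [mul_assoc, ← ENNReal.ofReal_mul (by positivity),
                mul_left_comm (ENNReal.ofReal (2 * C)), ← ENNReal.ofReal_mul' (by positivity)]
              congr 2
              rw [Real.rpow_sub_one hu0.ne']
              field_simp
    _ = _ := lintegral_const_mul' _ _ ENNReal.ofReal_ne_top

theorem rpow_le_two_rpow_abs_mul {x y b : ℝ} (hy : 0 < y) (hyx : y ≤ x) (hxy : x ≤ 2 * y) :
    x ^ b ≤ 2 ^ |b| * y ^ b := by
  have hx : 0 < x := hy.trans_le hyx
  rw [← div_le_iff₀ (by positivity), ← Real.div_rpow hx.le hy.le]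
  calc (x / y) ^ b ≤ (x / y) ^ |b| :=
        Real.rpow_le_rpow_of_exponent_le ((one_le_div hy).2 hyx) (le_abs_self b)
    _ ≤ 2 ^ |b| := by
        refine Real.rpow_le_rpow (by positivity) ?_ (abs_nonneg b)
        rwa [div_le_iff₀ hy]

/-- After substitution the integral is compared with the series on unit intervals. Since k ≥ 1, x is
at most twice the left endpoint there, so the power weight changes by at most 2^|b-1|. -/
theorem lintegral_le_tsum_comp_mul_rpow {a b c : ℝ} (ha : 0 < a) (hc : 0 < c) (k : ℕ)
    (hk : 1 ≤ k) {G : ℝ → ℝ≥0∞} (hG : Antitone G) :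
    ∫⁻ u in Ioi (c * (k : ℝ) ^ a), G u * ENNReal.ofReal (u ^ (b / a - 1)) ≤
      ENNReal.ofReal (a * c ^ (b / a) * 2 ^ |b - 1|) *
        ∑' n : ℕ, ENNReal.ofReal (((k + n : ℕ) : ℝ) ^ (b - 1)) * G (c * ((k + n : ℕ) : ℝ) ^ a) := by
  rw [lintegral_Ioi_comp_mul_rpow ha hc k.cast_nonneg,
    ENNReal.ofReal_mul (p := a * c ^ (b / a)) (by positivity),
    mul_assoc, ← ENNReal.tsum_mul_left]
  gcongr
  refine lintegral_Ioi_le_tsum k fun n x hx => ?_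
  have hk' : (1 : ℝ) ≤ ((k + n : ℕ) : ℝ) := by exact_mod_cast hk.trans (Nat.le_add_right k n)
  have h0 : (0 : ℝ) < ((k + n : ℕ) : ℝ) := by linarith
  rw [mul_comm (G _), ← mul_assoc, ← ENNReal.ofReal_mul (by positivity)]
  gcongr
  · refine rpow_le_two_rpow_abs_mul h0 hx.1.le (hx.2.trans ?_)
    push_cast at hk' ⊢
    linarith
  · apply hG
    gcongr
    exact hx.1.le

theorem tailMoment_zero (G : ℝ → ℝ≥0∞) (s : ℝ) :
    tailMoment G s 0 = ∫⁻ u in Ioi (1 : ℝ), G u * ENNReal.ofReal (u ^ (s - 1)) := by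
  simp [tailMoment]

/-- One summand per row, the one with scale n^{q+β}, is kept. This holds for every β with q + β > 0
and has the right order when β < -q/r. -/
theorem tailMoment_le_rowSeries_of_lt {r β q : ℝ} (hqβ : 0 < q + β) :
    ∃ B : ℝ, 0 < B ∧ ∃ C : ℝ, ∀ G : ℝ → ℝ≥0∞, Antitone G →
      tailMoment (fun u => G (B * u)) ((r - 1) / (q + β)) 0 ≤
        ENNReal.ofReal C * rowSeries r β q G := by
  refine ⟨1, one_pos, (q + β) * 2 ^ |r - 1 - 1|, fun G hG => ?_⟩
  have h := lintegral_le_tsum_comp_mul_rpow (b := r - 1) hqβ one_pos 1 le_rfl hG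
  simp only [Nat.cast_one, Real.one_rpow, mul_one] at h
  simp only [tailMoment_zero, one_mul]
  refine h.trans (mul_le_mul_right ?_ _)
  refine ENNReal.tsum_le_tsum fun n => ?_
  rw [add_comm 1 n, show r - 1 - 1 = r - 2 by ring, rowSum]
  gcongr
  refine le_trans (le_of_eq ?_) (Finset.single_le_sum (fun _ _ => zero_le) (Finset.mem_range.2 n.succ_pos))
  simp [rowScale]

/-- The upper half of the row, n/2 ≤ j ≤ n, is kept: there the scale is at most 2^|β| n^q, and the
number of such j turns the weight n^{r-2} into n^{r-1}. -/
theorem tailMoment_le_rowSeries_of_gt {r β q : ℝ} (hq : 0 < q) :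
    ∃ B : ℝ, 0 < B ∧ ∃ C : ℝ, ∀ G : ℝ → ℝ≥0∞, Antitone G →
      tailMoment (fun u => G (B * u)) (r / q) 0 ≤ ENNReal.ofReal C * rowSeries r β q G := by
  refine ⟨2 ^ |β|, by positivity, q * 2 ^ |r - 1| * 2, fun G hG => ?_⟩
  have hG' : Antitone fun u => G (2 ^ |β| * u) := fun x y hxy =>
    hG (mul_le_mul_of_nonneg_left hxy (by positivity))
  have h := lintegral_le_tsum_comp_mul_rpow (b := r) hq one_pos 1 le_rfl hG'
  simp only [Nat.cast_one, Real.one_rpow, mul_one, one_mul] at h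
  rw [tailMoment_zero]
  refine h.trans ?_
  rw [ENNReal.ofReal_mul (p := q * 2 ^ |r - 1|) (by positivity), mul_assoc]
  refine mul_le_mul_right ?_ _
  rw [rowSeries, ← ENNReal.tsum_mul_left]
  refine ENNReal.tsum_le_tsum fun n => ?_
  rw [add_comm 1 n]
  have hn : (0 : ℝ) < ((n + 1 : ℕ) : ℝ) := by positivity
  set w := ENNReal.ofReal (((n + 1 : ℕ) : ℝ) ^ (r - 2)) with hw
  have hpow : ENNReal.ofReal (((n + 1 : ℕ) : ℝ) ^ (r - 1)) = w * ((n + 1 : ℕ) : ℝ≥0∞) := by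
    rw [hw, ← ENNReal.ofReal_natCast, ← ENNReal.ofReal_mul (by positivity)]
    congr 1
    rw [show r - 1 = (r - 2) + 1 by ring, Real.rpow_add hn, Real.rpow_one]
  rw [hpow, mul_assoc, mul_left_comm (ENNReal.ofReal 2)]
  refine mul_le_mul_right ?_ _
  set T := Finset.Icc (n / 2) n with hT
  have hcard : (n + 1 : ℕ) ≤ 2 * T.card := by rw [hT, Nat.card_Icc]; omega
  have hTr : T ⊆ Finset.range (n + 1) := fun j hj => by
    rw [hT, Finset.mem_Icc] at hj
    exact Finset.mem_range.2 (by omega)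
  calc _ ≤ ((2 * T.card : ℕ) : ℝ≥0∞) * G (2 ^ |β| * ((n + 1 : ℕ) : ℝ) ^ q) := by
        gcongr
    _ = 2 * ∑ j ∈ T, G (2 ^ |β| * ((n + 1 : ℕ) : ℝ) ^ q) := by
        rw [Finset.sum_const, nsmul_eq_mul]
        push_cast
        ring
    _ ≤ 2 * ∑ j ∈ T, G (rowScale β q n j) := by
        gcongr with j hj
        apply hG
        rw [hT, Finset.mem_Icc] at hj
        have hj0 : (0 : ℝ) < ((j + 1 : ℕ) : ℝ) := by positivity
        have h1 : (j : ℝ) ≤ n := by exact_mod_cast hj.2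
        have h2 : (n + 1 : ℝ) ≤ 2 * (j + 1) := by
          have : n + 1 ≤ 2 * (j + 1) := by omega
          exact_mod_cast this
        have h3 := rpow_le_two_rpow_abs_mul (b := β) hj0 (x := ((n + 1 : ℕ) : ℝ))
          (by push_cast; linarith) (by push_cast; linarith)
        calc rowScale β q n j = ((n + 1 : ℕ) : ℝ) ^ q *
              (((n + 1 : ℕ) : ℝ) ^ β / ((j + 1 : ℕ) : ℝ) ^ β) := by
              rw [rowScale, Real.rpow_add hn, Real.rpow_neg hj0.le]; ring
          _ ≤ ((n + 1 : ℕ) : ℝ) ^ q * 2 ^ |β| := by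
              gcongr
              rw [div_le_iff₀ (by positivity)]
              exact h3
          _ = _ := mul_comm _ _
    _ ≤ _ := by
        rw [ENNReal.ofReal_ofNat, rowSum]
        gcongr

/-- The logarithm is recovered as a harmonic sum over j with j^q < u, so that in the critical case
it can be exchanged with the sum over j. The constant is 1 + q because 1 ≤ H_N and ln u = q ln U ≤ q
H_N. -/
theorem one_add_log_le_sum_inv {q u : ℝ} (hq : 0 < q) (hu : 1 < u) :
    ENNReal.ofReal (1 + Real.log u) ≤ ENNReal.ofReal (1 + q) *
      ∑' j : ℕ, if ((j + 1 : ℕ) : ℝ) ^ q < u then ENNReal.ofReal (((j + 1 : ℕ) : ℝ)⁻¹) else 0 := by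
  have hu0 : 0 < u := by linarith
  set U := u ^ (1 / q) with hU
  have hU1 : 1 < U := Real.one_lt_rpow hu (by positivity)
  -- The largest integer strictly below U, so that every index up to N satisfies the strict
  -- inequality.
  set N := ⌈U⌉₊ - 1 with hN
  have hN2 : 2 ≤ ⌈U⌉₊ := Nat.lt_ceil.2 (by simpa using hU1)
  have hN1 : N + 1 = ⌈U⌉₊ := by omega
  have hlog : Real.log u = q * Real.log U := by
    rw [hU, Real.log_rpow hu0]; field_simp
  have hh1 : Real.log U ≤ harmonic N := by
    refine le_trans ?_ (log_add_one_le_harmonic N)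
    rw [hN1]
    exact Real.log_le_log (by linarith) (Nat.le_ceil U)
  have hsum : (harmonic N : ℝ) = ∑ j ∈ Finset.range N, ((j + 1 : ℕ) : ℝ)⁻¹ := by
    simp [harmonic]
  have hh2 : (1 : ℝ) ≤ harmonic N := by
    rw [hsum]
    refine le_trans (by simp) (Finset.single_le_sum (f := fun j : ℕ => ((j + 1 : ℕ) : ℝ)⁻¹)
      (fun _ _ => by positivity) (Finset.mem_range.2 (show 0 < N by omega)))
  calc _ ≤ ENNReal.ofReal ((1 + q) * ∑ j ∈ Finset.range N, ((j + 1 : ℕ) : ℝ)⁻¹) := by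
        refine ENNReal.ofReal_le_ofReal ?_
        rw [← hsum, hlog]
        nlinarith
    _ = ENNReal.ofReal (1 + q) *
          ∑ j ∈ Finset.range N, ENNReal.ofReal (((j + 1 : ℕ) : ℝ)⁻¹) := by
        rw [ENNReal.ofReal_mul (by positivity), ENNReal.ofReal_sum_of_nonneg]
        intro _ _
        positivity
    _ ≤ ENNReal.ofReal (1 + q) * ∑ j ∈ Finset.range N, (if ((j + 1 : ℕ) : ℝ) ^ q < u then
          ENNReal.ofReal (((j + 1 : ℕ) : ℝ)⁻¹) else 0) := by
        gcongr with j hj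
        rw [if_pos]
        have : j + 1 < ⌈U⌉₊ := by have := Finset.mem_range.1 hj; omega
        have := Nat.lt_ceil.1 this
        rw [hU] at this
        rwa [Real.lt_rpow_inv_iff_of_pos (by positivity) hu0.le hq |>.symm, ← one_div]
    _ ≤ _ := by
        gcongr
        exact ENNReal.sum_le_tsum _

/-- In the critical case every column matters: for each j the sum over n ≥ j dominates a constant
times j^{-1} ∫ G(u) u^{r/q-1} du over u > j^q, the power of j being exactly -1 because -β r/q = 1.
Summing over j gives the logarithm. -/
theorem tailMoment_le_rowSeries_of_eq {r β q : ℝ} (hr : 1 < r) (hq : 0 < q) (h : β = -q / r) :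
    ∃ B : ℝ, 0 < B ∧ ∃ C : ℝ, ∀ G : ℝ → ℝ≥0∞, Antitone G →
      tailMoment (fun u => G (B * u)) (r / q) 1 ≤ ENNReal.ofReal C * rowSeries r β q G := by
  have hr0 : 0 < r := by linarith
  have hr1 : 0 < r - 1 := by linarith
  have hqβ' : q + β = q * (r - 1) / r := by rw [h]; field_simp; ring
  have hqβ : 0 < q + β := by rw [hqβ']; positivity
  have hs : (r - 1) / (q + β) = r / q := by rw [hqβ']; field_simp
  have hβ : -β * (r / q) = 1 := by rw [h]; field_simp
  refine ⟨1, one_pos, (1 + q) * ((q + β) * 2 ^ |r - 1 - 1|), fun G hG => ?_⟩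
  have hGm := hG.measurable
  simp only [one_mul]
  have hmeas : Measurable fun u => G u * ENNReal.ofReal (u ^ (r / q - 1)) :=
    hGm.mul (by fun_prop)
  calc tailMoment G (r / q) 1
      ≤ ∫⁻ u in Ioi (1 : ℝ), ENNReal.ofReal (1 + q) * ∑' j : ℕ,
          ENNReal.ofReal (((j + 1 : ℕ) : ℝ)⁻¹) * (Ioi (((j + 1 : ℕ) : ℝ) ^ q)).indicator
            (fun u => G u * ENNReal.ofReal (u ^ (r / q - 1))) u := by
        refine setLIntegral_mono' measurableSet_Ioi fun u hu => ?_
        have hu0 : 0 < u := one_pos.trans hu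
        rw [pow_one, ENNReal.ofReal_mul (by positivity), ← mul_assoc]
        refine (mul_le_mul_right (one_add_log_le_sum_inv hq hu) _).trans_eq ?_
        rw [mul_left_comm, ← ENNReal.tsum_mul_left]
        congr 1
        refine tsum_congr fun j => ?_
        rw [indicator_apply]
        simp only [mem_Ioi]
        split_ifs <;> ring
    _ ≤ ENNReal.ofReal (1 + q) * ∑' j : ℕ, ENNReal.ofReal (((j + 1 : ℕ) : ℝ)⁻¹) *
          ∫⁻ u in Ioi (((j + 1 : ℕ) : ℝ) ^ q), G u * ENNReal.ofReal (u ^ (r / q - 1)) := by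
        rw [lintegral_const_mul' _ _ ENNReal.ofReal_ne_top, lintegral_tsum fun j =>
          ((hmeas.indicator measurableSet_Ioi).const_mul _).aemeasurable]
        refine mul_le_mul_right (ENNReal.tsum_le_tsum fun j => ?_) _
        rw [lintegral_const_mul' _ _ ENNReal.ofReal_ne_top]
        refine mul_le_mul_right ?_ _
        refine (lintegral_mono' Measure.restrict_le_self le_rfl).trans ?_
        rw [lintegral_indicator measurableSet_Ioi]
    _ ≤ ENNReal.ofReal (1 + q) * ∑' j : ℕ, ENNReal.ofReal ((q + β) * 2 ^ |r - 1 - 1|) *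
          ∑' n : ℕ, if j ≤ n then ENNReal.ofReal (((n + 1 : ℕ) : ℝ) ^ (r - 2)) *
            G (rowScale β q n j) else 0 := by
        refine mul_le_mul_right (ENNReal.tsum_le_tsum fun j => ?_) _
        have hj0 : (0 : ℝ) < ((j + 1 : ℕ) : ℝ) := by positivity
        have h1 := lintegral_le_tsum_comp_mul_rpow (b := r - 1) hqβ
          (c := ((j + 1 : ℕ) : ℝ) ^ (-β)) (by positivity) (j + 1) (by omega) hG
        rw [← Real.rpow_add hj0, show -β + (q + β) = q by ring, hs, ← Real.rpow_mul hj0.le, hβ,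
          Real.rpow_one] at h1
        refine (mul_le_mul_right h1 _).trans ?_
        rw [← mul_assoc, ← ENNReal.ofReal_mul (by positivity),
          show ((j + 1 : ℕ) : ℝ)⁻¹ * ((q + β) * ((j + 1 : ℕ) : ℝ) * 2 ^ |r - 1 - 1|) =
            (q + β) * 2 ^ |r - 1 - 1| by field_simp]
        refine mul_le_mul_right ?_ _
        refine le_trans (le_of_eq ?_) (ENNReal.tsum_comp_le_tsum_of_injective
          (add_right_injective j) _)
        refine tsum_congr fun n => ?_
        rw [if_pos (Nat.le_add_right j n), rowScale, show j + 1 + n = j + n + 1 by ring,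
          mul_comm (((j + 1 : ℕ) : ℝ) ^ (-β)), show r - 1 - 1 = r - 2 by ring]
    _ = _ := by
        rw [ENNReal.tsum_mul_left, ← tsum_sum_range_succ_comm, ← mul_assoc,
          ← ENNReal.ofReal_mul (by positivity), rowSeries]
        congr 1
        refine tsum_congr fun n => ?_
        rw [rowSum, Finset.mul_sum]

/-! ### Tail moments -/

theorem lintegral_Ioi_lt_top_of_le {f : ℝ → ℝ≥0∞} {a b M : ℝ}
    (h1 : ∀ x ∈ Ioc a b, f x ≤ ENNReal.ofReal M) (h2 : ∫⁻ x in Ioi b, f x < ⊤) :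
    ∫⁻ x in Ioi a, f x < ⊤ := by
  have hsub : Ioi a ⊆ Ioc a b ∪ Ioi b := fun x hx => by
    rcases le_or_gt x b with h | h
    · exact Or.inl ⟨hx, h⟩
    · exact Or.inr h
  refine (lintegral_mono_set hsub).trans_lt ((lintegral_union_le _ _ _).trans_lt ?_)
  refine ENNReal.add_lt_top.2 ⟨?_, h2⟩
  refine (setLIntegral_mono' measurableSet_Ioc h1).trans_lt ?_
  rw [setLIntegral_const, Real.volume_Ioc]
  exact ENNReal.mul_lt_top ENNReal.ofReal_lt_top ENNReal.ofReal_lt_top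

theorem logWeight_le {s b u : ℝ} (l : ℕ) (hu : 1 ≤ u) (hub : u ≤ b) :
    u ^ (s - 1) * (1 + Real.log u) ^ l ≤ b ^ |s - 1| * (1 + Real.log b) ^ l := by
  have hlog := Real.log_nonneg hu
  have h1 : u ^ (s - 1) ≤ b ^ |s - 1| :=
    (Real.rpow_le_rpow_of_exponent_le hu (le_abs_self _)).trans
      (Real.rpow_le_rpow (by linarith) hub (abs_nonneg _))
  have h2 : Real.log u ≤ Real.log b := Real.log_le_log (by linarith) hub
  have : 0 < b := by linarith
  gcongr

/-- On a bounded range the integrand is bounded because G ≤ 1, so only large arguments matter. -/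
theorem tailMoment_lt_top_of_Ioi {G : ℝ → ℝ≥0∞} (hG1 : ∀ x, G x ≤ 1) {s b : ℝ} {l : ℕ}
    (h : ∫⁻ u in Ioi b, G u * ENNReal.ofReal (u ^ (s - 1) * (1 + Real.log u) ^ l) < ⊤) :
    tailMoment G s l < ⊤ := by
  refine lintegral_Ioi_lt_top_of_le (b := b) (M := b ^ |s - 1| * (1 + Real.log b) ^ l)
    (fun u hu => ?_) h
  calc _ ≤ 1 * ENNReal.ofReal (b ^ |s - 1| * (1 + Real.log b) ^ l) := by
        gcongr ?_ * ENNReal.ofReal ?_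
        · exact hG1 u
        · exact logWeight_le l hu.1.le hu.2
    _ = _ := one_mul _

theorem tailMoment_mono {G : ℝ → ℝ≥0∞} {s s' : ℝ} {l l' : ℕ} (hs : s ≤ s') (hl : l ≤ l') :
    tailMoment G s l ≤ tailMoment G s' l' := by
  refine setLIntegral_mono' measurableSet_Ioi fun u hu => ?_
  have hu1 : (1 : ℝ) < u := hu
  have hlog := Real.log_nonneg hu1.le
  gcongr
  · exact hu1.le
  · linarith

/-- Finiteness is invariant under dilation, so all multiplicative constants inside G are harmless.
For c < 1 the logarithm is handled by 1 + ln u ≤ (1 + ln c⁻¹)(1 + ln(cu)) for cu > 1. -/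
theorem tailMoment_comp_mul_lt_top {G : ℝ → ℝ≥0∞} (hG : Antitone G) (hG1 : ∀ x, G x ≤ 1)
    {c s : ℝ} {l : ℕ} (hc : 0 < c) (h : tailMoment G s l < ⊤) :
    tailMoment (fun u => G (c * u)) s l < ⊤ := by
  rcases le_or_gt 1 c with hc1 | hc1
  · refine lt_of_le_of_lt (setLIntegral_mono' measurableSet_Ioi fun u hu => ?_) h
    have hu1 : (1 : ℝ) < u := hu
    gcongr
    apply hG
    nlinarith
  · refine tailMoment_lt_top_of_Ioi (fun x => hG1 _) (b := c⁻¹) ?_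
    have hcv := lintegral_Ioi_comp_of_deriv_pos (φ := fun u => c * u) (φ' := fun _ => c)
      (m := c⁻¹) (by fun_prop) (fun u _ => by simpa using (hasDerivAt_id u).const_mul c)
      (fun _ _ => hc) (Filter.tendsto_id.const_mul_atTop hc)
      (fun u => G u * ENNReal.ofReal (u ^ (s - 1) * (1 + Real.log u) ^ l))
    simp only [mul_inv_cancel₀ hc.ne'] at hcv
    rw [tailMoment, hcv] at h
    have hlc : 0 < Real.log c⁻¹ := Real.log_pos ((one_lt_inv₀ hc).2 hc1)
    set K := c⁻¹ * (c ^ (s - 1))⁻¹ * (1 + Real.log c⁻¹) ^ l with hK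
    refine lt_of_le_of_lt ?_ (ENNReal.mul_lt_top (a := ENNReal.ofReal K) ENNReal.ofReal_lt_top h)
    rw [← lintegral_const_mul' _ _ ENNReal.ofReal_ne_top]
    refine setLIntegral_mono' measurableSet_Ioi fun u hu => ?_
    have hu1 : c⁻¹ < u := hu
    have hu0 : 0 < u := lt_trans (by positivity) hu1
    have hcu : 1 < c * u := by
      rwa [inv_lt_iff_one_lt_mul₀ hc, mul_comm] at hu1
    have hlcu := Real.log_nonneg hcu.le
    rw [mul_left_comm _ (G _), mul_left_comm _ (G _), ← ENNReal.ofReal_mul (by positivity),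
      ← ENNReal.ofReal_mul (by positivity)]
    refine mul_le_mul' (hG (by nlinarith)) (ENNReal.ofReal_le_ofReal ?_)
    have hlogu : Real.log u = Real.log c⁻¹ + Real.log (c * u) := by
      rw [Real.log_mul hc.ne' hu0.ne', Real.log_inv]; ring
    have h1 : (1 + Real.log u) ^ l ≤ ((1 + Real.log c⁻¹) * (1 + Real.log (c * u))) ^ l := by
      have : 0 ≤ Real.log u := by rw [hlogu]; positivity
      gcongr
      rw [hlogu]
      nlinarith
    calc u ^ (s - 1) * (1 + Real.log u) ^ l
        ≤ u ^ (s - 1) * ((1 + Real.log c⁻¹) * (1 + Real.log (c * u))) ^ l := by gcongr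
      _ = _ := by
          rw [hK, Real.mul_rpow hc.le hu0.le, mul_pow]
          field_simp

/-- The substitution is w = (x/ε)^{1/p} u; the factor ε^{-1/p} makes the lower endpoint exactly u.
-/
theorem lintegral_comp_mul_rpow_inv {p ε u : ℝ} (hp : 0 < p) (hε : 0 < ε) (hu : 0 < u)
    (G : ℝ → ℝ≥0∞) :
    ∫⁻ x in Ioi ε, G (ε ^ (-(1 / p)) * x ^ (1 / p) * u) =
      ENNReal.ofReal (p * ε * u ^ (-p)) *
        ∫⁻ w in Ioi u, G w * ENNReal.ofReal (w ^ (p - 1)) := by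
  have h := lintegral_Ioi_comp_mul_rpow (a := 1 / p) (b := 1) (c := ε ^ (-(1 / p)) * u) (m := ε)
    (by positivity) (by positivity) hε.le G
  have h1 : ε ^ (-(1 / p)) * u * ε ^ (1 / p) = u := by
    rw [mul_right_comm, ← Real.rpow_add hε]; simp
  rw [h1] at h
  simp only [one_div_one_div, sub_self, Real.rpow_zero, ENNReal.ofReal_one, mul_one] at h
  rw [h, ← mul_assoc, ← ENNReal.ofReal_mul (by positivity)]
  have h2 : p * ε * u ^ (-p) * (1 / p * (ε ^ (-(1 / p)) * u) ^ p) = 1 := by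
    rw [Real.mul_rpow (by positivity) hu.le, ← Real.rpow_mul hε.le,
      show -(1 / p) * p = -1 by field_simp, Real.rpow_neg hu.le, Real.rpow_neg_one]
    field_simp
  rw [h2, ENNReal.ofReal_one, one_mul]
  simp only [mul_right_comm]

/-- For antitone `G ≤ 1`, the integrals `∫_ε^∞ G(c x^{1/p}) dx` and `∫_1^∞ G(u) u^{p-1} du` are
finite simultaneously. -/
theorem lintegral_comp_rpow_lt_top_iff {G : ℝ → ℝ≥0∞} (hG : Antitone G) (hG1 : ∀ x, G x ≤ 1)
    {p c ε : ℝ} (hp : 0 < p) (hc : 0 < c) (hε : 0 < ε) :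
    ∫⁻ x in Ioi ε, G (c * x ^ (1 / p)) < ⊤ ↔ tailMoment G p 0 < ⊤ := by
  set κ := c * ε ^ (1 / p) with hκ
  have hκ0 : 0 < κ := by positivity
  have hG' : Antitone fun u => G (κ * u) := fun x y hxy => hG (by gcongr)
  have h := lintegral_comp_mul_rpow_inv hp hε one_pos (fun u => G (κ * u))
  rw [← tailMoment_zero (fun u => G (κ * u)) p] at h
  have h1 : ∀ x : ℝ, κ * (ε ^ (-(1 / p)) * x ^ (1 / p) * 1) = c * x ^ (1 / p) := fun x => by
    rw [hκ, Real.rpow_neg hε.le]; field_simp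
  simp only [h1] at h
  rw [h]
  have hpos : 0 < p * ε * (1 : ℝ) ^ (-p) := by rw [Real.one_rpow]; positivity
  constructor
  · intro hfin
    have h2 : tailMoment (fun u => G (κ * u)) p 0 < ⊤ := by
      by_contra hcon
      rw [not_lt_top_iff.1 hcon, ENNReal.mul_top (by simpa using hpos)] at hfin
      exact lt_irrefl _ hfin
    have h3 := tailMoment_comp_mul_lt_top hG' (fun x => hG1 _) (inv_pos.2 hκ0) h2
    have h4 : (fun u => G (κ * (κ⁻¹ * u))) = G := by
      funext u; rw [mul_inv_cancel_left₀ hκ0.ne']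
    rwa [h4] at h3
  · intro hfin
    exact ENNReal.mul_lt_top ENNReal.ofReal_lt_top (tailMoment_comp_mul_lt_top hG hG1 hκ0 hfin)

/-- Integrate over the level x first, then exchange u and w. The growth in w of the inner integral
is a power, an extra logarithm or a constant, according to the sign of s - p. -/
theorem lintegral_tailMoment_comp_mul {G : ℝ → ℝ≥0∞} (hG : Antitone G) {p ε s : ℝ} {l : ℕ}
    (hp : 0 < p) (hε : 0 < ε) :
    ∫⁻ x in Ioi ε, tailMoment (fun u => G (ε ^ (-(1 / p)) * x ^ (1 / p) * u)) s l =
      ENNReal.ofReal (p * ε) * ∫⁻ w in Ioi (1 : ℝ), G w * ENNReal.ofReal (w ^ (p - 1)) *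
        ∫⁻ u in Ioo 1 w, ENNReal.ofReal (u ^ (s - p - 1) * (1 + Real.log u) ^ l) := by
  have hm : Measurable G := hG.measurable
  have e1 : ∀ u ∈ Ioi (1 : ℝ), ∫⁻ x in Ioi ε, G (ε ^ (-(1 / p)) * x ^ (1 / p) * u) *
        ENNReal.ofReal (u ^ (s - 1) * (1 + Real.log u) ^ l) =
      ENNReal.ofReal (p * ε) * ∫⁻ w in Ioi (1 : ℝ), (if u < w then
        G w * ENNReal.ofReal (w ^ (p - 1)) *
          ENNReal.ofReal (u ^ (s - p - 1) * (1 + Real.log u) ^ l) else 0) := by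
    intro u hu
    have hu1 : (1 : ℝ) < u := hu
    have hu0 : 0 < u := by linarith
    have hlog := Real.log_nonneg hu1.le
    rw [lintegral_mul_const' _ _ ENNReal.ofReal_ne_top, lintegral_comp_mul_rpow_inv hp hε hu0,
      mul_right_comm, ← ENNReal.ofReal_mul (by positivity)]
    have h1 : p * ε * u ^ (-p) * (u ^ (s - 1) * (1 + Real.log u) ^ l) =
        p * ε * (u ^ (s - p - 1) * (1 + Real.log u) ^ l) := by
      rw [show s - p - 1 = -p + (s - 1) by ring, Real.rpow_add hu0]; ring
    rw [h1, ENNReal.ofReal_mul (by positivity), mul_assoc]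
    congr 1
    have h2 : ∀ w, (if u < w then G w * ENNReal.ofReal (w ^ (p - 1)) *
          ENNReal.ofReal (u ^ (s - p - 1) * (1 + Real.log u) ^ l) else 0) =
        (Ioi u).indicator (fun w => G w * ENNReal.ofReal (w ^ (p - 1)) *
          ENNReal.ofReal (u ^ (s - p - 1) * (1 + Real.log u) ^ l)) w := fun w => by
      rw [indicator_apply]; rfl
    simp only [h2]
    rw [lintegral_indicator measurableSet_Ioi, Measure.restrict_restrict measurableSet_Ioi,
      inter_eq_left.2 (Ioi_subset_Ioi hu1.le), lintegral_mul_const' _ _ ENNReal.ofReal_ne_top,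
      mul_comm]
  unfold tailMoment
  rw [lintegral_lintegral_swap (by fun_prop)]
  rw [setLIntegral_congr_fun measurableSet_Ioi e1, lintegral_const_mul' _ _ ENNReal.ofReal_ne_top]
  congr 1
  have hmeas : Measurable fun z : ℝ × ℝ => if z.1 < z.2 then
      G z.2 * ENNReal.ofReal (z.2 ^ (p - 1)) *
        ENNReal.ofReal (z.1 ^ (s - p - 1) * (1 + Real.log z.1) ^ l) else 0 :=
    Measurable.ite (measurableSet_lt measurable_fst measurable_snd) (by fun_prop) measurable_const
  rw [lintegral_lintegral_swap hmeas.aemeasurable]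
  refine setLIntegral_congr_fun measurableSet_Ioi fun w hw => ?_
  have h2 : ∀ u, (if u < w then G w * ENNReal.ofReal (w ^ (p - 1)) *
        ENNReal.ofReal (u ^ (s - p - 1) * (1 + Real.log u) ^ l) else 0) =
      (Iio w).indicator (fun u => G w * ENNReal.ofReal (w ^ (p - 1)) *
        ENNReal.ofReal (u ^ (s - p - 1) * (1 + Real.log u) ^ l)) u := fun u => by
    rw [indicator_apply]; rfl
  simp only [h2]
  rw [lintegral_indicator measurableSet_Iio, Measure.restrict_restrict measurableSet_Iio,
    Iio_inter_Ioi, lintegral_const_mul _ (by fun_prop)]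

theorem one_add_log_pow_le {η : ℝ} (hη : 0 < η) (l : ℕ) :
    ∃ C : ℝ, 0 < C ∧ ∀ u : ℝ, 1 ≤ u → (1 + Real.log u) ^ l ≤ C * u ^ η := by
  set δ := η / (l + 1) with hδ
  have hδ0 : 0 < δ := by positivity
  refine ⟨(1 + 1 / δ) ^ l, by positivity, fun u hu => ?_⟩
  have hu0 : 0 < u := by linarith
  have h1 := Real.log_le_rpow_div hu0.le hδ0
  have h2 : 1 ≤ u ^ δ := Real.one_le_rpow hu hδ0.le
  have h3 := Real.log_nonneg hu
  calc (1 + Real.log u) ^ l ≤ ((1 + 1 / δ) * u ^ δ) ^ l := by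
        gcongr
        rw [add_mul, one_mul, one_div_mul_eq_div]
        linarith
    _ = (1 + 1 / δ) ^ l * u ^ (δ * l) := by
        rw [mul_pow, ← Real.rpow_natCast (u ^ δ) l, ← Real.rpow_mul hu0.le]
    _ ≤ _ := by
        gcongr
        rw [hδ, div_mul_eq_mul_div, div_le_iff₀ (by positivity)]
        nlinarith

theorem lintegral_Ioc_one_rpow {t w : ℝ} (hw : 1 ≤ w) :
    ∫⁻ u in Ioc 1 w, ENNReal.ofReal (u ^ (t - 1)) =
      ENNReal.ofReal (∫ u in (1 : ℝ)..w, u ^ (t - 1)) := by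
  rw [intervalIntegral.integral_of_le hw, ofReal_integral_eq_lintegral_ofReal]
  · refine (intervalIntegrable_iff_integrableOn_Ioc_of_le hw).1
      (intervalIntegral.intervalIntegrable_rpow (Or.inr ?_))
    rw [uIcc_of_le hw]
    exact fun h => by linarith [h.1]
  · refine (ae_restrict_mem measurableSet_Ioc).mono fun x hx => ?_
    have : 0 < x := by linarith [hx.1]
    simp only [Pi.zero_apply]
    positivity

theorem lintegral_Ioo_logWeight_le_mul {t w : ℝ} {l : ℕ} (hw : 1 ≤ w) :
    ∫⁻ u in Ioo 1 w, ENNReal.ofReal (u ^ (t - 1) * (1 + Real.log u) ^ l) ≤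
      ENNReal.ofReal ((∫ u in (1 : ℝ)..w, u ^ (t - 1)) * (1 + Real.log w) ^ l) := by
  have hlw := Real.log_nonneg hw
  rw [ENNReal.ofReal_mul' (by positivity), ← lintegral_Ioc_one_rpow hw,
    ← lintegral_mul_const' _ _ ENNReal.ofReal_ne_top]
  refine (setLIntegral_mono' measurableSet_Ioo fun u hu => ?_).trans
    (lintegral_mono_set Ioo_subset_Ioc_self)
  have hu0 : 0 < u := by linarith [hu.1]
  have hlu := Real.log_nonneg hu.1.le
  rw [← ENNReal.ofReal_mul (by positivity)]
  gcongr
  exact hu.2.le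

theorem integral_rpow_neg_one_eq_log {w : ℝ} (hw : 1 ≤ w) :
    ∫ u in (1 : ℝ)..w, u ^ ((0 : ℝ) - 1) = Real.log w := by
  have : ∀ u : ℝ, u ^ ((0 : ℝ) - 1) = u⁻¹ := fun u => by rw [zero_sub, Real.rpow_neg_one]
  simp only [this]
  rw [integral_inv_of_pos one_pos (by linarith), div_one]

theorem lintegral_Ioo_logWeight_le_of_pos {t w : ℝ} {l : ℕ} (ht : 0 < t) (hw : 1 ≤ w) :
    ∫⁻ u in Ioo 1 w, ENNReal.ofReal (u ^ (t - 1) * (1 + Real.log u) ^ l) ≤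
      ENNReal.ofReal (t⁻¹ * (w ^ t * (1 + Real.log w) ^ l)) := by
  refine (lintegral_Ioo_logWeight_le_mul hw).trans (ENNReal.ofReal_le_ofReal ?_)
  have hlw := Real.log_nonneg hw
  rw [integral_rpow (Or.inl (by linarith)), sub_add_cancel, Real.one_rpow, ← mul_assoc]
  gcongr
  rw [div_eq_inv_mul]
  gcongr
  linarith

theorem lintegral_Ioo_logWeight_le_of_zero {w : ℝ} {l : ℕ} (hw : 1 ≤ w) :
    ∫⁻ u in Ioo 1 w, ENNReal.ofReal (u ^ ((0 : ℝ) - 1) * (1 + Real.log u) ^ l) ≤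
      ENNReal.ofReal ((1 + Real.log w) ^ (l + 1)) := by
  refine (lintegral_Ioo_logWeight_le_mul hw).trans (ENNReal.ofReal_le_ofReal ?_)
  have hlw := Real.log_nonneg hw
  rw [integral_rpow_neg_one_eq_log hw, pow_succ, mul_comm]
  gcongr
  linarith

/-- Restrict to u > √w: there ln u is at least half of ln w, and ∫ du/u is half of ln w. -/
theorem le_lintegral_Ioo_logWeight_of_zero {w : ℝ} {l : ℕ} (hw : 1 ≤ w) :
    ENNReal.ofReal ((1 / 2) ^ (l + 1) * ((1 + Real.log w) ^ l * Real.log w)) ≤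
      ∫⁻ u in Ioo 1 w, ENNReal.ofReal (u ^ ((0 : ℝ) - 1) * (1 + Real.log u) ^ l) := by
  have hw0 : 0 < w := by linarith
  set a := √w with ha
  have ha1 : 1 ≤ a := Real.one_le_sqrt.2 hw
  have ha0 : 0 < a := by linarith
  have haw : a * a = w := Real.mul_self_sqrt hw0.le
  have hlog : Real.log w = 2 * Real.log a := by
    rw [← haw, Real.log_mul ha0.ne' ha0.ne']; ring
  have hla := Real.log_nonneg ha1
  have haw' : a ≤ w := by nlinarith
  have hI : ∫⁻ u in Ioc a w, ENNReal.ofReal (u ^ ((0 : ℝ) - 1)) = ENNReal.ofReal (Real.log a) := by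
    have h1 := lintegral_Ioc_one_rpow (t := 0) hw
    have h2 := lintegral_Ioc_one_rpow (t := 0) ha1
    rw [integral_rpow_neg_one_eq_log hw] at h1
    rw [integral_rpow_neg_one_eq_log ha1] at h2
    rw [← Ioc_union_Ioc_eq_Ioc ha1 haw', lintegral_union measurableSet_Ioc
      (Ioc_disjoint_Ioc_of_le le_rfl), h2, hlog, two_mul, ENNReal.ofReal_add hla hla] at h1
    exact (ENNReal.add_right_inj ENNReal.ofReal_ne_top).1 h1
  calc _ ≤ ENNReal.ofReal ((1 + Real.log a) ^ l * Real.log a) := by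
        refine ENNReal.ofReal_le_ofReal ?_
        have : (1 / 2 : ℝ) ^ l * (1 + Real.log w) ^ l ≤ (1 + Real.log a) ^ l := by
          rw [← mul_pow, hlog]
          gcongr
          linarith
        calc (1 / 2 : ℝ) ^ (l + 1) * ((1 + Real.log w) ^ l * Real.log w)
            = ((1 / 2 : ℝ) ^ l * (1 + Real.log w) ^ l) * Real.log a := by rw [hlog]; ring
          _ ≤ _ := by gcongr
    _ = ∫⁻ u in Ioo a w, ENNReal.ofReal ((1 + Real.log a) ^ l) *
          ENNReal.ofReal (u ^ ((0 : ℝ) - 1)) := by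
        rw [lintegral_const_mul' _ _ ENNReal.ofReal_ne_top, setLIntegral_congr Ioo_ae_eq_Ioc, hI,
          ENNReal.ofReal_mul (by positivity)]
    _ ≤ ∫⁻ u in Ioo a w, ENNReal.ofReal (u ^ ((0 : ℝ) - 1) * (1 + Real.log u) ^ l) := by
        refine setLIntegral_mono' measurableSet_Ioo fun u hu => ?_
        have hu0 : 0 < u := ha0.trans hu.1
        rw [← ENNReal.ofReal_mul (by positivity), mul_comm]
        gcongr
        exact hu.1.le
    _ ≤ _ := lintegral_mono_set (Ioo_subset_Ioo_left ha1)

/-- Half of the negative exponent absorbs the logarithms, and the other half keeps the integral over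
(1, ∞) finite. -/
theorem lintegral_Ioo_logWeight_le_of_neg {t : ℝ} {l : ℕ} (ht : t < 0) :
    ∃ C : ℝ, ∀ w : ℝ,
      ∫⁻ u in Ioo 1 w, ENNReal.ofReal (u ^ (t - 1) * (1 + Real.log u) ^ l) ≤
        ENNReal.ofReal C := by
  obtain ⟨C, hC, hle⟩ := one_add_log_pow_le (η := -t / 2) (by linarith) l
  refine ⟨C * ((1 : ℝ) ^ (1 - (1 - t / 2)) / (1 - t / 2 - 1)), fun w => ?_⟩
  rw [ENNReal.ofReal_mul hC.le, ← lintegral_Ioi_rpow_neg (by linarith) one_pos,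
    ← lintegral_const_mul' _ _ ENNReal.ofReal_ne_top]
  refine (lintegral_mono_set Ioo_subset_Ioi_self).trans
    (setLIntegral_mono' measurableSet_Ioi fun u hu => ?_)
  have hu1 : (1 : ℝ) < u := hu
  have hu0 : 0 < u := by linarith
  rw [← ENNReal.ofReal_mul hC.le]
  refine ENNReal.ofReal_le_ofReal ?_
  calc _ ≤ u ^ (t - 1) * (C * u ^ (-t / 2)) := by gcongr; exact hle u hu1.le
    _ = _ := by
      rw [mul_left_comm, ← Real.rpow_add hu0]
      congr 2
      ring

/-! ### The integrated double series -/

/-- The moment conditions in integral form, with `l` the exponent of the extra logarithm. -/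
def TailMomentCond (G : ℝ → ℝ≥0∞) (p s : ℝ) (l : ℕ) : Prop :=
  (s < p → tailMoment G p 0 < ⊤) ∧ (p = s → tailMoment G s (l + 1) < ⊤) ∧
    (p < s → tailMoment G s l < ⊤)

theorem TailMomentCond.comp_mul {G : ℝ → ℝ≥0∞} {p s c : ℝ} {l : ℕ} (h : TailMomentCond G p s l)
    (hG : Antitone G) (hG1 : ∀ x, G x ≤ 1) (hc : 0 < c) :
    TailMomentCond (fun u => G (c * u)) p s l :=
  ⟨fun h' => tailMoment_comp_mul_lt_top hG hG1 hc (h.1 h'),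
    fun h' => tailMoment_comp_mul_lt_top hG hG1 hc (h.2.1 h'),
    fun h' => tailMoment_comp_mul_lt_top hG hG1 hc (h.2.2 h')⟩

/-- All three cases contain the pure moment of order max(p, s); the maximal inequality draws its
moment of order v from it. -/
theorem TailMomentCond.tailMoment_max_lt_top {G : ℝ → ℝ≥0∞} {p s : ℝ} {l : ℕ}
    (h : TailMomentCond G p s l) : tailMoment G (max p s) 0 < ⊤ := by
  rcases lt_trichotomy p s with h' | h' | h'
  · rw [max_eq_right h'.le]
    exact (tailMoment_mono le_rfl l.zero_le).trans_lt (h.2.2 h')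
  · rw [max_eq_right h'.le]
    exact (tailMoment_mono le_rfl (Nat.zero_le _)).trans_lt (h.2.1 h')
  · rw [max_eq_left h'.le]
    exact h.1 h'

/-- The three upper bounds for the inner integral correspond one by one to the three clauses of the
moment condition. -/
theorem lintegral_tailMoment_comp_mul_lt_top {G : ℝ → ℝ≥0∞} (hG : Antitone G)
    {p ε s : ℝ} {l : ℕ} (hp : 0 < p) (hε : 0 < ε) (h : TailMomentCond G p s l) :
    ∫⁻ x in Ioi ε, tailMoment (fun u => G (ε ^ (-(1 / p)) * x ^ (1 / p) * u)) s l < ⊤ := by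
  rw [lintegral_tailMoment_comp_mul hG hp hε]
  refine ENNReal.mul_lt_top ENNReal.ofReal_lt_top ?_
  rcases lt_trichotomy p s with hps | hps | hps
  · refine lt_of_le_of_lt (setLIntegral_mono' measurableSet_Ioi fun w hw =>
      mul_le_mul_right (lintegral_Ioo_logWeight_le_of_pos (sub_pos.2 hps) (le_of_lt hw)) _)
      (lt_of_eq_of_lt ?_ (ENNReal.mul_lt_top (a := ENNReal.ofReal (s - p)⁻¹)
        ENNReal.ofReal_lt_top (h.2.2 hps)))
    rw [tailMoment, ← lintegral_const_mul' _ _ ENNReal.ofReal_ne_top]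
    refine setLIntegral_congr_fun measurableSet_Ioi fun w hw => ?_
    have hw0 : 0 < w := one_pos.trans hw
    have hsp : 0 < s - p := sub_pos.2 hps
    rw [mul_assoc, mul_left_comm (ENNReal.ofReal _) (G w), ← ENNReal.ofReal_mul (by positivity),
      ← ENNReal.ofReal_mul (by positivity)]
    congr 2
    rw [show s - 1 = (p - 1) + (s - p) by ring, Real.rpow_add hw0]
    ring
  · subst hps
    refine lt_of_le_of_lt (setLIntegral_mono' measurableSet_Ioi fun w hw => ?_) (h.2.1 rfl)
    have hw0 : 0 < w := one_pos.trans hw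
    rw [ENNReal.ofReal_mul (by positivity), ← mul_assoc, sub_self]
    gcongr
    exact lintegral_Ioo_logWeight_le_of_zero (le_of_lt hw)
  · obtain ⟨C, hC⟩ := lintegral_Ioo_logWeight_le_of_neg (l := l) (sub_neg.2 hps)
    refine lt_of_le_of_lt (setLIntegral_mono' measurableSet_Ioi fun w hw =>
      mul_le_mul_right (hC w) _) ?_
    rw [lintegral_mul_const' _ _ ENNReal.ofReal_ne_top, ← tailMoment_zero]
    exact ENNReal.mul_lt_top (h.1 hps) ENNReal.ofReal_lt_top

/-- The converse for p = s: the inner integral is bounded below by one more power of the logarithm.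
-/
theorem tailMoment_succ_lt_top {G : ℝ → ℝ≥0∞} (hG : Antitone G) (hG1 : ∀ x, G x ≤ 1)
    {p ε : ℝ} {l : ℕ} (hp : 0 < p) (hε : 0 < ε)
    (h : ∫⁻ x in Ioi ε, tailMoment (fun u => G (ε ^ (-(1 / p)) * x ^ (1 / p) * u)) p l < ⊤) :
    tailMoment G p (l + 1) < ⊤ := by
  rw [lintegral_tailMoment_comp_mul hG hp hε] at h
  have h1 : ∫⁻ w in Ioi (1 : ℝ), G w * ENNReal.ofReal (w ^ (p - 1)) *
      ∫⁻ u in Ioo 1 w, ENNReal.ofReal (u ^ (p - p - 1) * (1 + Real.log u) ^ l) < ⊤ := by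
    by_contra hcon
    rw [not_lt_top_iff.1 hcon, ENNReal.mul_top (by simpa using by positivity)] at h
    exact lt_irrefl _ h
  -- Beyond e one has 1 + ln w ≤ 2 ln w, which turns ln w from the lower bound into 1 + ln w.
  refine tailMoment_lt_top_of_Ioi hG1 (b := Real.exp 1) ?_
  refine lt_of_le_of_lt ?_ (ENNReal.mul_lt_top (a := ENNReal.ofReal (2 * 2 ^ (l + 1)))
    ENNReal.ofReal_lt_top h1)
  rw [← lintegral_const_mul' _ _ ENNReal.ofReal_ne_top]
  have he : (1 : ℝ) ≤ Real.exp 1 := Real.one_le_exp zero_le_one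
  refine (setLIntegral_mono' measurableSet_Ioi fun w hw => ?_).trans
    (lintegral_mono_set (Ioi_subset_Ioi he))
  have hwe : Real.exp 1 < w := hw
  have hw1 : 1 ≤ w := he.trans hwe.le
  have hw0 : 0 < w := by linarith
  have hlog : 1 ≤ Real.log w := by
    rw [Real.le_log_iff_exp_le hw0]; exact hwe.le
  have h2 := le_lintegral_Ioo_logWeight_of_zero (l := l) hw1
  rw [sub_self]
  calc _ ≤ ENNReal.ofReal (2 * 2 ^ (l + 1)) * (G w * ENNReal.ofReal (w ^ (p - 1)) *
        ENNReal.ofReal ((1 / 2) ^ (l + 1) * ((1 + Real.log w) ^ l * Real.log w))) := by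
        rw [mul_assoc, mul_left_comm (ENNReal.ofReal _) (G w), ← ENNReal.ofReal_mul (by positivity),
          ← ENNReal.ofReal_mul (by positivity)]
        refine mul_le_mul_right (ENNReal.ofReal_le_ofReal ?_) _
        calc w ^ (p - 1) * (1 + Real.log w) ^ (l + 1)
            = w ^ (p - 1) * (1 + Real.log w) ^ l * (1 + Real.log w) := by ring
          _ ≤ w ^ (p - 1) * (1 + Real.log w) ^ l * (2 * Real.log w) := by gcongr; linarith
          _ = _ := by
            rw [one_div, inv_pow]
            field_simp
    _ ≤ _ := by gcongr

theorem rowSum_measurable {G : ℝ → ℝ≥0∞} (hG : Antitone G) (β q c p : ℝ) (n : ℕ) :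
    Measurable fun x : ℝ => rowSum β q (fun u => G (c * x ^ (1 / p) * u)) n := by
  have := hG.measurable
  unfold rowSum
  fun_prop

theorem lintegral_rowSeries {G : ℝ → ℝ≥0∞} (hG : Antitone G) (r β q c p ε : ℝ) :
    ∫⁻ x in Ioi ε, rowSeries r β q (fun u => G (c * x ^ (1 / p) * u)) =
      ∑' n : ℕ, ENNReal.ofReal (((n + 1 : ℕ) : ℝ) ^ (r - 2)) *
        ∫⁻ x in Ioi ε, rowSum β q (fun u => G (c * x ^ (1 / p) * u)) n := by
  unfold rowSeries
  rw [lintegral_tsum fun n => ((rowSum_measurable hG β q c p n).const_mul _).aemeasurable]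
  refine tsum_congr fun n => ?_
  rw [lintegral_const_mul' _ _ ENNReal.ofReal_ne_top]

theorem lintegral_rowSeries_lt_top {r β q s C p c ε : ℝ} {l : ℕ} (hq : 0 ≤ q) (hqβ : 0 ≤ q + β)
    (hcount : ∀ u : ℝ, 1 ≤ u →
      latticeCount r β q u ≤ ENNReal.ofReal (C * (u ^ s * (1 + Real.log u) ^ l)))
    {G : ℝ → ℝ≥0∞} (hG : Antitone G) (hG1 : ∀ x, G x ≤ 1) (hp : 0 < p) (hc : 0 < c) (hε : 0 < ε)
    (h : TailMomentCond G p s l) :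
    ∫⁻ x in Ioi ε, rowSeries r β q (fun u => G (c * x ^ (1 / p) * u)) < ⊤ := by
  -- The given dilation, the normalisation of the level at ε, and the 1/2 from averaging over (z,
  -- 2z].
  set κ := c * ε ^ (1 / p) * 2⁻¹ with hκ
  have hκ0 : 0 < κ := by positivity
  have hG' : Antitone fun u => G (κ * u) := fun x y hxy => hG (by gcongr)
  have h1 := lintegral_tailMoment_comp_mul_lt_top hG' hp hε (h.comp_mul hG hG1 hκ0)
  refine lt_of_le_of_lt ?_ (ENNReal.mul_lt_top (a := ENNReal.ofReal (2 * C))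
    ENNReal.ofReal_lt_top h1)
  rw [← lintegral_const_mul' _ _ ENNReal.ofReal_ne_top]
  refine setLIntegral_mono' measurableSet_Ioi fun x hx => ?_
  have hx0 : 0 < x := hε.trans hx
  refine (rowSeries_le_tailMoment hq hqβ hcount fun a b hab => hG (by gcongr)).trans_eq ?_
  congr 2
  funext u
  congr 1
  rw [hκ, Real.rpow_neg hε.le]
  field_simp

theorem tailMoment_succ_lt_top_of_rowSeries {r β q p B C c ε : ℝ} {l : ℕ} (hB : 0 < B)
    (hlow : ∀ G : ℝ → ℝ≥0∞, Antitone G →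
      tailMoment (fun u => G (B * u)) p l ≤ ENNReal.ofReal C * rowSeries r β q G)
    {G : ℝ → ℝ≥0∞} (hG : Antitone G) (hG1 : ∀ x, G x ≤ 1) (hp : 0 < p) (hc : 0 < c) (hε : 0 < ε)
    (h : ∫⁻ x in Ioi ε, rowSeries r β q (fun u => G (c * x ^ (1 / p) * u)) < ⊤) :
    tailMoment G p (l + 1) < ⊤ := by
  set κ := c * ε ^ (1 / p) * B with hκ
  have hκ0 : 0 < κ := by positivity
  have hG' : Antitone fun u => G (κ * u) := fun x y hxy => hG (by gcongr)
  have h1 : tailMoment (fun u => G (κ * u)) p (l + 1) < ⊤ := by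
    refine tailMoment_succ_lt_top hG' (fun x => hG1 _) hp hε (lt_of_le_of_lt ?_
      (ENNReal.mul_lt_top (a := ENNReal.ofReal C) ENNReal.ofReal_lt_top h))
    rw [← lintegral_const_mul' _ _ ENNReal.ofReal_ne_top]
    refine setLIntegral_mono' measurableSet_Ioi fun x hx => ?_
    have hx0 : 0 < x := hε.trans hx
    refine le_trans (le_of_eq ?_) (hlow (fun u => G (c * x ^ (1 / p) * u))
      fun a b hab => hG (by gcongr))
    congr 1
    funext u
    congr 1
    rw [hκ, Real.rpow_neg hε.le]
    field_simp
  have h3 := tailMoment_comp_mul_lt_top hG' (fun x => hG1 _) (inv_pos.2 hκ0) h1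
  have h4 : (fun u => G (κ * (κ⁻¹ * u))) = G := by
    funext u; rw [mul_inv_cancel_left₀ hκ0.ne']
  rwa [h4] at h3

/-! ### Sublinear expectations -/

namespace SublinearExpectationSpace

variable {Ω : Type*} [MeasurableSpace Ω] (S : SublinearExpectationSpace Ω)

/-! ### Closure properties of the space of random variables. -/

section Closure

variable {S} {X Y : Ω → ℝ}

/-- A constant is a function of zero variables. -/
theorem const_mem (c : ℝ) : (fun _ => c) ∈ S.H :=
  S.comp_mem 0 (fun i => i.elim0) (fun i => i.elim0) (fun _ => c)
    ⟨1, one_pos, 0, fun x y => by rw [sub_self, abs_zero]; positivity⟩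

theorem comp_mem_of_local_lip (hX : X ∈ S.H) {φ : ℝ → ℝ} {C : ℝ} (hC : 0 < C) (m : ℕ)
    (hφ : ∀ x y, |φ x - φ y| ≤ C * (1 + |x| ^ m + |y| ^ m) * |x - y|) :
    (fun ω => φ (X ω)) ∈ S.H := by
  refine S.comp_mem 1 (fun _ => X) (fun _ => hX) (fun x => φ (x 0)) ⟨C, hC, m, fun x y => ?_⟩
  refine (hφ _ _).trans ?_
  have h1 : |x 0| ≤ ‖x‖ := norm_le_pi_norm x 0
  have h2 : |y 0| ≤ ‖y‖ := norm_le_pi_norm y 0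
  have h3 : |x 0 - y 0| ≤ ‖x - y‖ := norm_le_pi_norm (x - y) 0
  gcongr

theorem comp_mem_of_lip (hX : X ∈ S.H) {φ : ℝ → ℝ} {C : ℝ} (hC : 0 ≤ C)
    (hφ : ∀ x y, |φ x - φ y| ≤ C * |x - y|) : (fun ω => φ (X ω)) ∈ S.H :=
  comp_mem_of_local_lip hX (C := C + 1) (by linarith) 0 fun x y => (hφ x y).trans (by
    have := abs_nonneg (x - y)
    simp only [pow_zero]
    nlinarith)

theorem comp₂_mem (hX : X ∈ S.H) (hY : Y ∈ S.H) {φ : ℝ → ℝ → ℝ} {C : ℝ} (hC : 0 < C) (m : ℕ)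
    (hφ : ∀ x : Fin 2 → ℝ, ∀ y : Fin 2 → ℝ, |φ (x 0) (x 1) - φ (y 0) (y 1)| ≤
      C * (1 + ‖x‖ ^ m + ‖y‖ ^ m) * ‖x - y‖) :
    (fun ω => φ (X ω) (Y ω)) ∈ S.H :=
  S.comp_mem 2 ![X, Y] (fun i => by fin_cases i <;> simp [hX, hY]) (fun x => φ (x 0) (x 1))
    ⟨C, hC, m, hφ⟩

theorem add_mem (hX : X ∈ S.H) (hY : Y ∈ S.H) : (fun ω => X ω + Y ω) ∈ S.H := by
  refine comp₂_mem hX hY (φ := fun a b => a + b) one_pos 0 fun x y => ?_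
  have h3 : |x 0 - y 0| ≤ ‖x - y‖ := norm_le_pi_norm (x - y) 0
  have h4 : |x 1 - y 1| ≤ ‖x - y‖ := norm_le_pi_norm (x - y) 1
  have h5 := norm_nonneg (x - y)
  rw [add_sub_add_comm]
  refine (abs_add_le _ _).trans ?_
  simp only [pow_zero]
  linarith

theorem mul_mem (hX : X ∈ S.H) (hY : Y ∈ S.H) : (fun ω => X ω * Y ω) ∈ S.H := by
  refine comp₂_mem hX hY (φ := fun a b => a * b) one_pos 1 fun x y => ?_
  have h3 : |x 0 - y 0| ≤ ‖x - y‖ := norm_le_pi_norm (x - y) 0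
  have h4 : |x 1 - y 1| ≤ ‖x - y‖ := norm_le_pi_norm (x - y) 1
  have h1 : |x 0| ≤ ‖x‖ := norm_le_pi_norm x 0
  have h2 : |y 1| ≤ ‖y‖ := norm_le_pi_norm y 1
  have h5 := norm_nonneg (x - y)
  calc |x 0 * x 1 - y 0 * y 1| = |x 0 * (x 1 - y 1) + y 1 * (x 0 - y 0)| := by congr 1; ring
    _ ≤ |x 0| * |x 1 - y 1| + |y 1| * |x 0 - y 0| := by
        rw [← abs_mul, ← abs_mul]; exact abs_add_le _ _
    _ ≤ ‖x‖ * ‖x - y‖ + ‖y‖ * ‖x - y‖ := by gcongr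
    _ ≤ _ := by rw [pow_one, pow_one]; nlinarith

theorem max_mem (hX : X ∈ S.H) (hY : Y ∈ S.H) : (fun ω => max (X ω) (Y ω)) ∈ S.H := by
  refine comp₂_mem hX hY (φ := fun a b => max a b) one_pos 0 fun x y => ?_
  have h3 : |x 0 - y 0| ≤ ‖x - y‖ := norm_le_pi_norm (x - y) 0
  have h4 : |x 1 - y 1| ≤ ‖x - y‖ := norm_le_pi_norm (x - y) 1
  have h5 := norm_nonneg (x - y)
  refine (abs_max_sub_max_le_max _ _ _ _).trans ((max_le h3 h4).trans ?_)
  simp only [pow_zero]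
  linarith

theorem const_mul_mem (c : ℝ) (hX : X ∈ S.H) : (fun ω => c * X ω) ∈ S.H :=
  mul_mem (const_mem c) hX

theorem neg_mem (hX : X ∈ S.H) : (fun ω => -X ω) ∈ S.H := by
  simpa using const_mul_mem (-1) hX

theorem sub_mem (hX : X ∈ S.H) (hY : Y ∈ S.H) : (fun ω => X ω - Y ω) ∈ S.H := by
  simpa [sub_eq_add_neg] using add_mem hX (neg_mem hY)

theorem abs_mem (hX : X ∈ S.H) : (fun ω => |X ω|) ∈ S.H :=
  comp_mem_of_lip hX zero_le_one fun x y => by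
    rw [one_mul]; exact abs_abs_sub_abs_le_abs_sub x y

theorem sum_mem {ι : Type*} (s : Finset ι) {Z : ι → Ω → ℝ} (h : ∀ i ∈ s, Z i ∈ S.H) :
    (fun ω => ∑ i ∈ s, Z i ω) ∈ S.H := by
  classical
  induction s using Finset.induction_on with
  | empty => simpa using const_mem (S := S) 0
  | insert i s hi ih =>
    simp only [Finset.sum_insert hi]
    exact add_mem (h i (Finset.mem_insert_self i s))
      (ih fun j hj => h j (Finset.mem_insert_of_mem hj))

end Closure

/-! ### Elementary bounds for the sublinear expectation. -/

section Bounds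

variable {S} {X Y : Ω → ℝ} {a b : ℝ}

theorem E_le_of_le (hX : X ∈ S.H) (hY : Y ∈ S.H) (h : ∀ ω, X ω ≤ Y ω) : S.E X ≤ S.E Y :=
  S.mono Y hY X hX h

theorem E_nonneg (hX : X ∈ S.H) (h : ∀ ω, 0 ≤ X ω) : 0 ≤ S.E X := by
  simpa [S.const] using E_le_of_le (const_mem 0) hX h

theorem E_le_of_le_const (hX : X ∈ S.H) (h : ∀ ω, X ω ≤ a) : S.E X ≤ (a : EReal) := by
  simpa [S.const] using E_le_of_le hX (const_mem a) h

/-- Finite upper bounds exclude the form ∞ - ∞, so subadditivity applies without knowing that the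
expectations are finite from below. -/
theorem E_add_le (hX : X ∈ S.H) (hY : Y ∈ S.H) (ha : S.E X ≤ (a : EReal))
    (hb : S.E Y ≤ (b : EReal)) : S.E (fun ω => X ω + Y ω) ≤ ((a + b : ℝ) : EReal) := by
  have h1 : S.E X ≠ ⊤ := (ha.trans_lt (EReal.coe_lt_top a)).ne
  have h2 : S.E Y ≠ ⊤ := (hb.trans_lt (EReal.coe_lt_top b)).ne
  rw [EReal.coe_add]
  exact (S.subadditive X hX Y hY (fun h => h1 h.1) (fun h => h2 h.2)).trans (add_le_add ha hb)

theorem E_const_mul_le (hX : X ∈ S.H) {l : ℝ} (hl : 0 ≤ l) (ha : S.E X ≤ (a : EReal)) :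
    S.E (fun ω => l * X ω) ≤ ((l * a : ℝ) : EReal) := by
  rw [S.pos_homogeneous X hX l hl, EReal.coe_mul]
  exact mul_le_mul_of_nonneg_left ha (EReal.coe_nonneg.2 hl)

theorem E_sum_le {ι : Type*} (s : Finset ι) {Z : ι → Ω → ℝ} {c : ι → ℝ}
    (h : ∀ i ∈ s, Z i ∈ S.H) (hc : ∀ i ∈ s, S.E (Z i) ≤ (c i : EReal)) :
    S.E (fun ω => ∑ i ∈ s, Z i ω) ≤ ((∑ i ∈ s, c i : ℝ) : EReal) := by
  classical
  induction s using Finset.induction_on with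
  | empty => simpa using (S.const 0).le
  | insert i s hi ih =>
    simp only [Finset.sum_insert hi]
    exact E_add_le (h i (Finset.mem_insert_self i s))
      (sum_mem s fun j hj => h j (Finset.mem_insert_of_mem hj))
      (hc i (Finset.mem_insert_self i s))
      (ih (fun j hj => h j (Finset.mem_insert_of_mem hj))
        fun j hj => hc j (Finset.mem_insert_of_mem hj))

theorem coe_toReal_E (hX : X ∈ S.H) (h0 : ∀ ω, 0 ≤ X ω) (h1 : ∀ ω, X ω ≤ a) :
    ((S.E X).toReal : EReal) = S.E X := by
  refine EReal.coe_toReal ?_ ?_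
  · exact ((E_le_of_le_const hX h1).trans_lt (EReal.coe_lt_top a)).ne
  · exact (lt_of_lt_of_le (EReal.bot_lt_coe 0) (E_nonneg hX h0)).ne'

/-- Affine images of a nonnegative bounded random variable. -/
theorem E_const_add_mul (hX : X ∈ S.H) (h0 : ∀ ω, 0 ≤ X ω) {K : ℝ} (h1 : ∀ ω, X ω ≤ K)
    (ha : 0 ≤ a) (hb : 0 ≤ b) :
    S.E (fun ω => a + b * X ω) = ((a + b * (S.E X).toReal : ℝ) : EReal) := by
  have hbX := const_mul_mem b hX
  have hE : S.E (fun ω => b * X ω) = ((b * (S.E X).toReal : ℝ) : EReal) := by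
    rw [S.pos_homogeneous X hX b hb, EReal.coe_mul, coe_toReal_E hX h0 h1]
  have hsum := add_mem (const_mem (S := S) a) hbX
  apply le_antisymm
  · exact E_add_le (const_mem a) hbX (S.const a).le hE.le
  · have hz := coe_toReal_E (S := S) (X := fun ω => a + b * X ω) (a := a + b * K) hsum
      (fun ω => by have := h0 ω; positivity) (fun ω => by have := h1 ω; gcongr)
    -- The lower bound: adding the constant -a recovers b X, and subadditivity applied to this sum
    -- gives the reverse inequality.
    have h2 := E_add_le hsum (const_mem (S := S) (-a)) hz.symm.le (S.const (-a)).le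
    have h3 : (fun ω => a + b * X ω + -a) = fun ω => b * X ω := by funext ω; ring
    rw [h3, hE, EReal.coe_le_coe_iff] at h2
    rw [← hz, EReal.coe_le_coe_iff]
    linarith

end Bounds

/-! ### Capacities -/

section Capacity

variable {S} {A B : Set Ω}

theorem E_indicator_eq (hA : MeasurableSet A) :
    S.E (A.indicator fun _ => (1 : ℝ)) = (S.cap A : EReal) := by
  rw [cap, EReal.coe_toENNReal]
  exact E_nonneg (S.indicator_mem A hA) fun ω => indicator_nonneg (fun _ _ => zero_le_one) ω

theorem cap_le_of_E_le {a : ℝ}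
    (h : S.E (A.indicator fun _ => (1 : ℝ)) ≤ (a : EReal)) : S.cap A ≤ ENNReal.ofReal a := by
  have := EReal.toENNReal_le_toENNReal h
  simpa [cap] using this

theorem cap_mono (hA : MeasurableSet A) (hB : MeasurableSet B) (h : A ⊆ B) :
    S.cap A ≤ S.cap B :=
  EReal.toENNReal_le_toENNReal (E_le_of_le (S.indicator_mem A hA) (S.indicator_mem B hB)
    (indicator_le_indicator_of_subset h fun _ => zero_le_one))

theorem cap_le_one (hA : MeasurableSet A) : S.cap A ≤ 1 := by
  have := cap_le_of_E_le (S := S) (a := 1) (E_le_of_le_const (S.indicator_mem A hA)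
    fun ω => indicator_le_self' (fun _ _ => zero_le_one) ω)
  simpa using this

theorem cap_univ : S.cap (univ : Set Ω) = 1 := by
  rw [cap, indicator_univ, S.const, EReal.toENNReal_of_ne_top (EReal.coe_ne_top _)]
  simp

theorem E_indicator_toReal (hA : MeasurableSet A) :
    (S.E (A.indicator fun _ => (1 : ℝ))).toReal = (S.cap A).toReal := by
  rw [E_indicator_eq hA, EReal.toReal_coe_ennreal]

theorem cap_eq_ofReal_toReal (hA : MeasurableSet A) :
    S.cap A = ENNReal.ofReal (S.cap A).toReal :=
  (ENNReal.ofReal_toReal (ne_top_of_le_ne_top ENNReal.one_ne_top (cap_le_one hA))).symm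

theorem E_indicator_eq_toReal (hA : MeasurableSet A) :
    S.E (A.indicator fun _ => (1 : ℝ)) = ((S.cap A).toReal : EReal) := by
  rw [← E_indicator_toReal hA, coe_toReal_E (a := 1) (S.indicator_mem A hA)]
  · exact fun ω => indicator_nonneg (fun _ _ => zero_le_one) ω
  · exact fun ω => indicator_le_self' (fun _ _ => zero_le_one) ω

theorem cap_biUnion_le {ι : Type*} (s : Finset ι) {A : ι → Set Ω}
    (hA : ∀ i ∈ s, MeasurableSet (A i)) : S.cap (⋃ i ∈ s, A i) ≤ ∑ i ∈ s, S.cap (A i) := by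
  have hU : MeasurableSet (⋃ i ∈ s, A i) := Finset.measurableSet_biUnion s hA
  have h := E_sum_le (S := S) s (Z := fun i => (A i).indicator fun _ => (1 : ℝ))
    (c := fun i => (S.cap (A i)).toReal) (fun i hi => S.indicator_mem _ (hA i hi))
    fun i hi => (E_indicator_eq_toReal (hA i hi)).le
  have h2 := cap_le_of_E_le ((E_le_of_le (S.indicator_mem _ hU)
    (sum_mem s fun i hi => S.indicator_mem _ (hA i hi)) fun ω => ?_).trans h)
  · refine h2.trans_eq ?_
    rw [ENNReal.ofReal_sum_of_nonneg fun _ _ => ENNReal.toReal_nonneg]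
    exact Finset.sum_congr rfl fun i hi => (cap_eq_ofReal_toReal (hA i hi)).symm
  · have hnn : ∀ i ∈ s, 0 ≤ (A i).indicator (fun _ => (1 : ℝ)) ω :=
      fun i _ => indicator_nonneg (fun _ _ => zero_le_one) ω
    by_cases hω : ω ∈ ⋃ i ∈ s, A i
    · rw [indicator_of_mem hω]
      obtain ⟨i, hi, hωi⟩ := mem_iUnion₂.1 hω
      refine le_trans ?_ (Finset.single_le_sum hnn hi)
      rw [indicator_of_mem hωi]
    · rw [indicator_of_notMem hω]
      exact Finset.sum_nonneg hnn

theorem cap_union_le (hA : MeasurableSet A) (hB : MeasurableSet B) :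
    S.cap (A ∪ B) ≤ S.cap A + S.cap B := by
  have h := cap_biUnion_le (S := S) Finset.univ (A := fun b : Bool => if b then A else B)
    (fun i _ => by cases i <;> simp [hA, hB])
  have h2 : (⋃ i ∈ (Finset.univ : Finset Bool), (if i = true then A else B)) = A ∪ B := by
    ext ω; simp [or_comm]
  rw [h2] at h
  simpa using h

/-- Markov's inequality. -/
theorem ofReal_mul_cap_le_E {Y : Ω → ℝ} (hY : Y ∈ S.H) (h0 : ∀ ω, 0 ≤ Y ω) {c : ℝ} (hc : 0 ≤ c) :
    ENNReal.ofReal c * S.cap {ω | c < Y ω} ≤ (S.E Y).toENNReal := by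
  have hm : MeasurableSet {ω | c < Y ω} := measurableSet_lt measurable_const (S.measurable_of_mem Y hY)
  have h1 := E_le_of_le (S := S) (const_mul_mem c (S.indicator_mem _ hm)) hY fun ω => ?_
  · rw [S.pos_homogeneous _ (S.indicator_mem _ hm) c hc, E_indicator_eq hm] at h1
    have h2 := EReal.toENNReal_le_toENNReal h1
    rw [EReal.toENNReal_mul (EReal.coe_nonneg.2 hc)] at h2
    simpa using h2
  · by_cases hω : ω ∈ {ω | c < Y ω}
    · rw [indicator_of_mem hω, mul_one]
      exact le_of_lt hω
    · rw [indicator_of_notMem hω, mul_zero]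
      exact h0 ω

theorem cap_lt_antitone {Y : Ω → ℝ} (hY : Measurable Y) :
    Antitone fun x : ℝ => S.cap {ω | x < Y ω} := fun _ _ hxy =>
  cap_mono (measurableSet_lt measurable_const hY) (measurableSet_lt measurable_const hY)
    fun _ hω => lt_of_le_of_lt hxy hω

/-- The sublinear expectation of a nonnegative random variable is at most its Choquet integral. -/
theorem E_le_lintegral_cap {Y : Ω → ℝ} (hY : Y ∈ S.H) (h0 : ∀ ω, 0 ≤ Y ω) :
    (S.E Y).toENNReal ≤ ∫⁻ x in Ioi (0 : ℝ), S.cap {ω | x < Y ω} := by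
  have hYm := S.measurable_of_mem Y hY
  have hm : ∀ c : ℝ, MeasurableSet {ω | c < Y ω} := fun c => measurableSet_lt measurable_const hYm
  refine ENNReal.le_of_forall_pos_le_add fun δ hδ _ => ?_
  have hδ' : (0 : ℝ) < δ := hδ
  have hE : ∀ n : ℕ, (S.E fun ω => (δ : ℝ) *
      {ω | (n * δ : ℝ) < Y ω}.indicator (fun _ => (1 : ℝ)) ω).toENNReal =
        δ * S.cap {ω | (n * δ : ℝ) < Y ω} := fun n => by
    rw [S.pos_homogeneous _ (S.indicator_mem _ (hm _)) _ hδ'.le, E_indicator_eq (hm _),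
      EReal.toENNReal_mul (EReal.coe_nonneg.2 hδ'.le)]
    simp
  -- Discretisation: Y ≤ ∑ δ 1{nδ < Y}, with infinitely many terms since Y may be unbounded. The
  -- term n = 0 costs at most δ; the term n + 1 is dominated by the integral over (nδ, (n+1)δ].
  have h1 := S.countably_subadditive Y hY
    (fun n ω => (δ : ℝ) * {ω | (n * δ : ℝ) < Y ω}.indicator (fun _ => (1 : ℝ)) ω)
    (fun n => const_mul_mem _ (S.indicator_mem _ (hm _))) h0
    (fun n ω => mul_nonneg hδ'.le (indicator_nonneg (fun _ _ => zero_le_one) ω)) fun ω => ?_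
  · refine h1.trans ?_
    simp only [hE]
    rw [tsum_eq_zero_add' ENNReal.summable, add_comm]
    refine add_le_add ?_ ?_
    · have hcv := lintegral_Ioi_comp_of_deriv_pos (φ := fun u => (δ : ℝ) * u)
        (φ' := fun _ => (δ : ℝ)) (m := ((0 : ℕ) : ℝ)) (by fun_prop)
        (fun u _ => by simpa using (hasDerivAt_id u).const_mul (δ : ℝ))
        (fun _ _ => hδ') (Filter.tendsto_id.const_mul_atTop hδ')
        (fun x => S.cap {ω | x < Y ω})
      rw [Nat.cast_zero, mul_zero] at hcv
      rw [hcv, ← Nat.cast_zero]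
      refine tsum_le_lintegral_Ioi 0 fun n x hx => ?_
      rw [ENNReal.ofReal_coe_nnreal]
      gcongr
      rw [zero_add] at hx
      apply cap_lt_antitone hYm
      rw [mul_comm]
      gcongr
      exact hx.2
    · exact (mul_le_mul_right (cap_le_one (hm _)) _).trans_eq (mul_one _)
  · obtain ⟨N, hN⟩ : ∃ N : ℕ, N = ⌈Y ω / δ⌉₊ := ⟨_, rfl⟩
    calc ENNReal.ofReal (Y ω) ≤ ENNReal.ofReal (∑ n ∈ Finset.range N,
          (δ : ℝ) * {ω | (n * δ : ℝ) < Y ω}.indicator (fun _ => (1 : ℝ)) ω) := by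
          refine ENNReal.ofReal_le_ofReal ?_
          have : ∀ n ∈ Finset.range N, (δ : ℝ) *
              {ω | (n * δ : ℝ) < Y ω}.indicator (fun _ => (1 : ℝ)) ω = δ := fun n hn => by
            rw [Finset.mem_range, hN, Nat.lt_ceil, lt_div_iff₀ hδ'] at hn
            rw [indicator_of_mem (show ω ∈ {ω | (n * δ : ℝ) < Y ω} from hn), mul_one]
          rw [Finset.sum_congr rfl this, Finset.sum_const, Finset.card_range, nsmul_eq_mul, hN,
            ← div_le_iff₀ hδ']
          exact Nat.le_ceil _
      _ = ∑ n ∈ Finset.range N, ENNReal.ofReal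
          ((δ : ℝ) * {ω | (n * δ : ℝ) < Y ω}.indicator (fun _ => (1 : ℝ)) ω) :=
          ENNReal.ofReal_sum_of_nonneg fun n _ =>
            mul_nonneg hδ'.le (indicator_nonneg (fun _ _ => zero_le_one) ω)
      _ ≤ _ := ENNReal.sum_le_tsum _

theorem E_le_of_lintegral_cap_le {Y : Ω → ℝ} (hY : Y ∈ S.H) (h0 : ∀ ω, 0 ≤ Y ω) {d : ℝ}
    (hd : 0 ≤ d) (h : ∫⁻ x in Ioi (0 : ℝ), S.cap {ω | x < Y ω} ≤ ENNReal.ofReal d) :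
    S.E Y ≤ (d : EReal) := by
  have h1 := (E_le_lintegral_cap hY h0).trans h
  rw [← EReal.coe_toENNReal (E_nonneg hY h0)]
  refine (EReal.coe_ennreal_le_coe_ennreal_iff.2 h1).trans_eq ?_
  rw [EReal.coe_ennreal_ofReal, max_eq_left hd]

theorem choquet_eq_of_nonneg {Y : Ω → ℝ} (h0 : ∀ ω, 0 ≤ Y ω) :
    S.choquet Y = ((∫⁻ x in Ioi (0 : ℝ), S.cap {ω | x < Y ω} : ℝ≥0∞) : EReal) := by
  have h : ∫⁻ x in Iio (0 : ℝ), (1 - S.cap {ω | x < Y ω}) = 0 := by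
    rw [setLIntegral_congr_fun (g := fun _ => 0) measurableSet_Iio fun x hx => ?_]
    · simp
    · have : {ω | x < Y ω} = univ := eq_univ_of_forall fun ω => lt_of_lt_of_le hx (h0 ω)
      simp only
      rw [this, cap_univ, tsub_self]
  rw [choquet, h]
  simp

/-- For a variable bounded below the negative part of the Choquet integral is finite. This covers
|X|^s ln|X|, which is negative for 0 < |X| < 1 but bounded below. -/
theorem choquet_lt_top_iff {Y : Ω → ℝ} {M : ℝ} (h0 : ∀ ω, -M ≤ Y ω) :
    S.choquet Y < ⊤ ↔ ∫⁻ x in Ioi (0 : ℝ), S.cap {ω | x < Y ω} < ⊤ := by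
  have h : ∫⁻ x in Iio (0 : ℝ), (1 - S.cap {ω | x < Y ω}) ≠ ⊤ := by
    refine ne_top_of_le_ne_top (b := ENNReal.ofReal (0 - -M)) ENNReal.ofReal_ne_top ?_
    calc _ ≤ ∫⁻ x in Iio (0 : ℝ), (Ici (-M)).indicator (fun _ => 1) x := by
          refine setLIntegral_mono' measurableSet_Iio fun x _ => ?_
          rcases lt_or_ge x (-M) with hx | hx
          · have : {ω | x < Y ω} = univ := eq_univ_of_forall fun ω => lt_of_lt_of_le hx (h0 ω)
            rw [this, cap_univ, tsub_self]
            exact zero_le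
          · rw [indicator_of_mem (show x ∈ Ici (-M) from hx)]
            exact tsub_le_self
      _ = _ := by
          rw [lintegral_indicator measurableSet_Ici, setLIntegral_const, one_mul,
            Measure.restrict_apply measurableSet_Ici, Ici_inter_Iio, Real.volume_Ico]
  rw [choquet]
  set a := ∫⁻ x in Ioi (0 : ℝ), S.cap {ω | x < Y ω}
  set b := ∫⁻ x in Iio (0 : ℝ), (1 - S.cap {ω | x < Y ω})
  lift b to NNReal using h with b'
  constructor
  · intro hab
    by_contra hcon
    rw [not_lt_top_iff.1 hcon] at hab
    refine absurd hab ?_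
    rw [EReal.coe_ennreal_top, show (((b' : ℝ≥0∞)) : EReal) = ((b' : ℝ) : EReal) from rfl,
      EReal.top_sub_coe]
    exact lt_irrefl _
  · intro ha
    lift a to NNReal using ha.ne with a'
    exact EReal.coe_lt_top ((a' : ℝ) - (b' : ℝ))

end Capacity

end SublinearExpectationSpace

namespace SublinearExpectationSpace

variable {Ω : Type*} [MeasurableSpace Ω] {S : SublinearExpectationSpace Ω}

/-! ### Independent sequences -/

section Independence

variable {Xs : ℕ → Ω → ℝ}

/-- The only form in which independence is used: ψ(x, y) = A(x) + B(x) g(y) with bounded nonnegative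
factors, for which the inner expectation is explicit and affine in E[g]. -/
theorem E_add_mul_of_indepSeq (hindep : S.IndepSeq Xs) {k : ℕ}
    {A B : (ℕ → ℝ) → ℝ} {g : ℝ → ℝ} {K : ℝ} (hA : Measurable A) (hB : Measurable B)
    (hg : Measurable g) (hAk : ∀ x y : ℕ → ℝ, (∀ i < k, x i = y i) → A x = A y)
    (hBk : ∀ x y : ℕ → ℝ, (∀ i < k, x i = y i) → B x = B y)
    (hA0 : ∀ x, 0 ≤ A x) (hB0 : ∀ x, 0 ≤ B x) (hg0 : ∀ x, 0 ≤ g x)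
    (hAK : ∀ x, A x ≤ K) (hBK : ∀ x, B x ≤ K) (hgK : ∀ x, g x ≤ K)
    (hAH : (fun ω => A fun i => Xs i ω) ∈ S.H) (hBH : (fun ω => B fun i => Xs i ω) ∈ S.H)
    (hgH : (fun ω => g (Xs k ω)) ∈ S.H) :
    S.E (fun ω => A (fun i => Xs i ω) + B (fun i => Xs i ω) * g (Xs k ω)) =
      S.E (fun ω => A (fun i => Xs i ω) + B (fun i => Xs i ω) *
        (S.E fun ω => g (Xs k ω)).toReal) := by
  set e := (S.E fun ω => g (Xs k ω)).toReal with he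
  have hK : 0 ≤ K := (hg0 0).trans (hgK 0)
  have hinner : ∀ a b : ℝ, 0 ≤ a → 0 ≤ b →
      S.E (fun ω => a + b * g (Xs k ω)) = ((a + b * e : ℝ) : EReal) := fun a b ha hb =>
    E_const_add_mul hgH (fun ω => hg0 _) (fun ω => hgK _) ha hb
  have he0 : 0 ≤ e := EReal.toReal_nonneg (E_nonneg hgH fun ω => hg0 _)
  -- For k = 0 there is no past, and A and B are constants.
  rcases k with _ | n
  · have h1 : ∀ ω, A (fun i => Xs i ω) = A 0 := fun ω => hAk _ _ (by simp)
    have h2 : ∀ ω, B (fun i => Xs i ω) = B 0 := fun ω => hBk _ _ (by simp)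
    simp only [h1, h2]
    rw [hinner _ _ (hA0 _) (hB0 _), S.const]
  -- Extension by zero is harmless, as A and B depend on the first coordinates only.
  · set ext : (Fin (n + 1) → ℝ) → ℕ → ℝ := fun v i => if h : i < n + 1 then v ⟨i, h⟩ else 0
      with hext
    have hextm : Measurable ext := by
      refine measurable_pi_lambda _ fun i => ?_
      by_cases h : i < n + 1
      · simp only [hext, h, dite_true]
        exact measurable_pi_apply _
      · simp only [hext, h, dite_false]
        exact measurable_const
    have hAe : ∀ ω, A (ext fun i : Fin (n + 1) => Xs i ω) = A fun i => Xs i ω := fun ω =>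
      hAk _ _ fun i hi => dif_pos hi
    have hBe : ∀ ω, B (ext fun i : Fin (n + 1) => Xs i ω) = B fun i => Xs i ω := fun ω =>
      hBk _ _ fun i hi => dif_pos hi
    set ψ : (Fin (n + 1) → ℝ) × (Fin 1 → ℝ) → ℝ :=
      fun z => A (ext z.1) + B (ext z.1) * g (z.2 0) with hψ
    have hψm : Measurable ψ := by
      have h1 : Measurable fun z : (Fin (n + 1) → ℝ) × (Fin 1 → ℝ) => A (ext z.1) :=
        hA.comp (hextm.comp measurable_fst)
      have h2 : Measurable fun z : (Fin (n + 1) → ℝ) × (Fin 1 → ℝ) => B (ext z.1) :=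
        hB.comp (hextm.comp measurable_fst)
      have h3 : Measurable fun z : (Fin (n + 1) → ℝ) × (Fin 1 → ℝ) => g (z.2 0) :=
        hg.comp ((measurable_pi_apply 0).comp measurable_snd)
      exact h1.add (h2.mul h3)
    have hψ0 : ∀ z, 0 ≤ ψ z := fun z => by
      have := hA0 (ext z.1); have := hB0 (ext z.1); have := hg0 (z.2 0)
      positivity
    have habs : ∀ z, |ψ z| = ψ z := fun z => abs_of_nonneg (hψ0 z)
    have hE : ∀ x : Fin (n + 1) → ℝ, S.E (fun ω => ψ (x, fun _ => Xs (n + 1) ω)) =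
        ((A (ext x) + B (ext x) * e : ℝ) : EReal) := fun x =>
      hinner (A (ext x)) (B (ext x)) (hA0 _) (hB0 _)
    have hout : (fun ω => A (fun i => Xs i ω) + B (fun i => Xs i ω) * e) ∈ S.H :=
      add_mem hAH (mul_mem hBH (const_mem e))
    have h := hindep n ψ hψm
    simp only [habs, hE, EReal.toReal_coe] at h
    simp only [hψ, hAe, hBe] at h
    refine h (add_mem hAH (mul_mem hBH hgH))
      (fun x => add_mem (const_mem _) (const_mul_mem _ hgH)) (fun x => EReal.coe_lt_top _) hout ?_
      hout
    refine (E_le_of_le_const (a := K + K * e) hout fun ω => ?_).trans_lt (EReal.coe_lt_top _)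
    have := hAK fun i => Xs i ω
    have := hBK fun i => Xs i ω
    gcongr

theorem setOf_exists_mem_measurableSet (hXs : ∀ n, Measurable (Xs n)) {B : ℕ → Set ℝ}
    (hB : ∀ i, MeasurableSet (B i)) (k : ℕ) : MeasurableSet {ω | ∃ i < k, Xs i ω ∈ B i} := by
  have : {ω | ∃ i < k, Xs i ω ∈ B i} = ⋃ i ∈ Finset.range k, Xs i ⁻¹' B i := by
    ext ω; simp
  rw [this]
  exact Finset.measurableSet_biUnion _ fun i _ => hXs i (hB i)

/-- Writing the new union as 1_U + (1 - 1_U) 1_{A_k}, independence gives the exact recursion v_{k+1}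
= e + (1 - e) v_k for the capacities, as in the additive case. The bound T/(1 + T) is preserved by
it. -/
theorem le_cap_exists_mem_of_indepSeq (hXs : ∀ n, Xs n ∈ S.H) (hindep : S.IndepSeq Xs)
    {B : ℕ → Set ℝ} (hB : ∀ i, MeasurableSet (B i)) (k : ℕ) :
    (∑ i ∈ Finset.range k, (S.cap {ω | Xs i ω ∈ B i}).toReal) /
      (1 + ∑ i ∈ Finset.range k, (S.cap {ω | Xs i ω ∈ B i}).toReal) ≤
      (S.cap {ω | ∃ i < k, Xs i ω ∈ B i}).toReal := by
  classical
  have hXm : ∀ n, Measurable (Xs n) := fun n => S.measurable_of_mem _ (hXs n)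
  induction k with
  | zero => simp
  | succ k ih =>
    set U := {ω | ∃ i < k, Xs i ω ∈ B i} with hU
    have hUm : MeasurableSet U := setOf_exists_mem_measurableSet hXm hB k
    have hU'm : MeasurableSet {ω | ∃ i < k + 1, Xs i ω ∈ B i} :=
      setOf_exists_mem_measurableSet hXm hB (k + 1)
    set F : Set (ℕ → ℝ) := {x | ∃ i < k, x i ∈ B i} with hF
    have hFm : MeasurableSet F :=
      setOf_exists_mem_measurableSet (Xs := fun i (x : ℕ → ℝ) => x i) measurable_pi_apply hB k
    have hFk : ∀ x y : ℕ → ℝ, (∀ i < k, x i = y i) →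
        F.indicator (fun _ => (1 : ℝ)) x = F.indicator (fun _ => (1 : ℝ)) y := fun x y hxy => by
      have : x ∈ F ↔ y ∈ F :=
        exists_congr fun i => and_congr_right fun hi => by rw [hxy i hi]
      simp only [indicator_apply, this]
    have hF0 : ∀ x, 0 ≤ F.indicator (fun _ => (1 : ℝ)) x := fun x =>
      indicator_nonneg (fun _ _ => zero_le_one) x
    have hF1 : ∀ x, F.indicator (fun _ => (1 : ℝ)) x ≤ 1 := fun x =>
      indicator_le_self' (fun _ _ => zero_le_one) x
    have hFX : ∀ ω, F.indicator (fun _ => (1 : ℝ)) (fun i => Xs i ω) =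
        U.indicator (fun _ => (1 : ℝ)) ω := fun ω => rfl
    have hAm : MeasurableSet {ω | Xs k ω ∈ B k} := hXm k (hB k)
    set T := ∑ i ∈ Finset.range k, (S.cap {ω | Xs i ω ∈ B i}).toReal with hT
    set e := (S.cap {ω | Xs k ω ∈ B k}).toReal with he
    have he0 : 0 ≤ e := ENNReal.toReal_nonneg
    have he1 : e ≤ 1 := ENNReal.toReal_mono ENNReal.one_ne_top (cap_le_one hAm)
    have hT0 : 0 ≤ T := Finset.sum_nonneg fun _ _ => ENNReal.toReal_nonneg
    have hFind : Measurable (F.indicator fun _ => (1 : ℝ)) := measurable_const.indicator hFm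
    have hmain := E_add_mul_of_indepSeq (S := S) hindep (k := k)
      (A := F.indicator fun _ => (1 : ℝ)) (B := fun x => 1 - F.indicator (fun _ => (1 : ℝ)) x)
      (g := (B k).indicator fun _ => (1 : ℝ)) (K := 1) hFind (measurable_const.sub hFind)
      (measurable_const.indicator (hB k)) hFk (fun x y hxy => by rw [hFk x y hxy]) hF0
      (fun x => sub_nonneg.2 (hF1 x)) (fun x => indicator_nonneg (fun _ _ => zero_le_one) x)
      hF1 (fun x => sub_le_self _ (hF0 x)) (fun x => indicator_le_self' (fun _ _ => zero_le_one) x)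
      (S.indicator_mem U hUm) (sub_mem (const_mem 1) (S.indicator_mem U hUm))
      (S.indicator_mem _ hAm)
    have hL : (fun ω => F.indicator (fun _ => (1 : ℝ)) (fun i => Xs i ω) +
        (1 - F.indicator (fun _ => (1 : ℝ)) (fun i => Xs i ω)) *
          (B k).indicator (fun _ => (1 : ℝ)) (Xs k ω)) =
        {ω | ∃ i < k + 1, Xs i ω ∈ B i}.indicator fun _ => (1 : ℝ) := by
      funext ω
      simp only [hFX, indicator_apply, hU, mem_ofPred_eq, Nat.exists_lt_succ_right]
      by_cases h1 : ∃ i < k, Xs i ω ∈ B i <;> by_cases h2 : Xs k ω ∈ B k <;> simp [h1, h2]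
    have hg : (fun ω => (B k).indicator (fun _ => (1 : ℝ)) (Xs k ω)) =
        {ω | Xs k ω ∈ B k}.indicator fun _ => (1 : ℝ) := rfl
    rw [hL, hg, E_indicator_toReal hAm, E_indicator_eq_toReal hU'm] at hmain
    have hR : (fun ω => F.indicator (fun _ => (1 : ℝ)) (fun i => Xs i ω) +
        (1 - F.indicator (fun _ => (1 : ℝ)) (fun i => Xs i ω)) * e) =
        fun ω => e + (1 - e) * U.indicator (fun _ => (1 : ℝ)) ω := by
      funext ω
      rw [hFX]
      ring
    rw [hR, E_const_add_mul (S.indicator_mem U hUm)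
      (fun ω => indicator_nonneg (fun _ _ => zero_le_one) ω)
      (fun ω => indicator_le_self' (fun _ _ => zero_le_one) ω) he0 (sub_nonneg.2 he1),
      E_indicator_toReal hUm, EReal.coe_eq_coe_iff] at hmain
    rw [hmain, Finset.sum_range_succ, ← hT, ← he]
    rw [div_le_iff₀ (by positivity)] at ih
    rw [div_le_iff₀ (by positivity)]
    set v := (S.cap U).toReal
    have h1 : (1 - e) * T ≤ (1 - e) * (v * (1 + T)) :=
      mul_le_mul_of_nonneg_left ih (sub_nonneg.2 he1)
    have hv : 0 ≤ v := ENNReal.toReal_nonneg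
    have h2 : 0 ≤ (1 - e) * (v * e) := mul_nonneg (sub_nonneg.2 he1) (mul_nonneg hv he0)
    nlinarith [mul_nonneg he0 he0]

/-- This is T/(1 + T) ≥ min(1, T)/2, a converse to the union bound. -/
theorem min_one_sum_cap_le (hXs : ∀ n, Xs n ∈ S.H) (hindep : S.IndepSeq Xs)
    {B : ℕ → Set ℝ} (hB : ∀ i, MeasurableSet (B i)) (k : ℕ) :
    min 1 (∑ i ∈ Finset.range k, S.cap {ω | Xs i ω ∈ B i}) ≤
      2 * S.cap {ω | ∃ i < k, Xs i ω ∈ B i} := by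
  have hXm : ∀ n, Measurable (Xs n) := fun n => S.measurable_of_mem _ (hXs n)
  have h := le_cap_exists_mem_of_indepSeq hXs hindep hB k
  set T := ∑ i ∈ Finset.range k, (S.cap {ω | Xs i ω ∈ B i}).toReal with hT
  have hT0 : 0 ≤ T := Finset.sum_nonneg fun _ _ => ENNReal.toReal_nonneg
  have hsum : ∑ i ∈ Finset.range k, S.cap {ω | Xs i ω ∈ B i} = ENNReal.ofReal T := by
    rw [hT, ENNReal.ofReal_sum_of_nonneg fun _ _ => ENNReal.toReal_nonneg]
    exact Finset.sum_congr rfl fun i _ => cap_eq_ofReal_toReal (hXm i (hB i))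
  rw [hsum, cap_eq_ofReal_toReal (setOf_exists_mem_measurableSet hXm hB k), ← ENNReal.ofReal_one,
    ← ENNReal.ofReal_min, ← ENNReal.ofReal_ofNat, ← ENNReal.ofReal_mul zero_le_two]
  refine ENNReal.ofReal_le_ofReal (le_trans ?_ (mul_le_mul_of_nonneg_left h zero_le_two))
  rw [← mul_div_assoc, le_div_iff₀ (by positivity)]
  rcases le_total 1 T with h1 | h1
  · rw [min_eq_left h1]; linarith
  · rw [min_eq_right h1]; nlinarith

/-- The products `∏_{i<k} g_i(x_i)`, stopped when they exceed `c`. -/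
noncomputable def stoppedProduct (g : ℕ → ℝ → ℝ) (c : ℝ) : ℕ → (ℕ → ℝ) → ℝ
  | 0, _ => 1
  | k + 1, x => if c < stoppedProduct g c k x then stoppedProduct g c k x
      else stoppedProduct g c k x * g k (x k)

variable {g : ℕ → ℝ → ℝ} {c : ℝ}

theorem stoppedProduct_nonneg (hg0 : ∀ i x, 0 ≤ g i x) (k : ℕ) (x : ℕ → ℝ) :
    0 ≤ stoppedProduct g c k x := by
  induction k with
  | zero => exact zero_le_one
  | succ k ih =>
    rw [stoppedProduct]
    split_ifs
    · exact ih
    · exact mul_nonneg ih (hg0 _ _)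

theorem stoppedProduct_le (hg0 : ∀ i x, 0 ≤ g i x) {K : ℝ} (hK : 1 ≤ K)
    (hgK : ∀ i x, g i x ≤ K) (k : ℕ) (x : ℕ → ℝ) : stoppedProduct g c k x ≤ K ^ k := by
  induction k with
  | zero => simp [stoppedProduct]
  | succ k ih =>
    rw [stoppedProduct, pow_succ]
    split_ifs
    · exact ih.trans (le_mul_of_one_le_right (by positivity) hK)
    · exact mul_le_mul ih (hgK _ _) (hg0 _ _) (by positivity)

theorem measurable_stoppedProduct (hg : ∀ i, Measurable (g i)) (k : ℕ) :
    Measurable (stoppedProduct g c k) := by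
  induction k with
  | zero => exact measurable_const
  | succ k ih =>
    exact Measurable.ite (measurableSet_lt measurable_const ih) ih
      (ih.mul ((hg k).comp (measurable_pi_apply k)))

theorem stoppedProduct_congr (k : ℕ) (x y : ℕ → ℝ) (h : ∀ i < k, x i = y i) :
    stoppedProduct g c k x = stoppedProduct g c k y := by
  induction k with
  | zero => rfl
  | succ k ih =>
    rw [stoppedProduct, stoppedProduct, ih fun i hi => h i (by omega), h k (by omega)]

/-- Consequently, if some partial product passes c, so does the stopped product at the final time;
the maximum is thus controlled by one random variable. -/
theorem lt_stoppedProduct_or (n : ℕ) (x : ℕ → ℝ) :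
    c < stoppedProduct g c n x ∨
      (stoppedProduct g c n x = ∏ i ∈ Finset.range n, g i (x i) ∧
        ∀ k ≤ n, ¬ c < ∏ i ∈ Finset.range k, g i (x i)) := by
  induction n with
  | zero =>
    rcases lt_or_ge c 1 with h | h
    · exact Or.inl h
    · refine Or.inr ⟨by simp [stoppedProduct], fun k hk => ?_⟩
      rw [Nat.le_zero.1 hk]
      simpa using h
  | succ n ih =>
    rcases ih with h | ⟨h1, h2⟩
    · left
      rwa [stoppedProduct, if_pos h]
    · have h3 : stoppedProduct g c (n + 1) x = ∏ i ∈ Finset.range (n + 1), g i (x i) := by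
        rw [stoppedProduct, h1, if_neg (h2 n le_rfl), Finset.prod_range_succ]
      by_cases h4 : c < ∏ i ∈ Finset.range (n + 1), g i (x i)
      · left
        rwa [h3]
      · refine Or.inr ⟨h3, fun k hk => ?_⟩
        rcases Nat.le_succ_iff.1 hk with hk | rfl
        · exact h2 k hk
        · exact h4

/-- The supermartingale property: W_{k+1} = 1{W > c} W + 1{W ≤ c} W g is affine in g, and replacing
g by its expectation, at most 1, gives something at most W. Membership in `H` is carried along,
through indicators and products, since the stopping rule is discontinuous. -/
theorem stoppedProduct_mem_and_E_le_one (hXs : ∀ n, Xs n ∈ S.H) (hindep : S.IndepSeq Xs)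
    (hg : ∀ i, Measurable (g i)) (hg0 : ∀ i x, 0 ≤ g i x) {K : ℝ} (hK : 1 ≤ K)
    (hgK : ∀ i x, g i x ≤ K) (hgH : ∀ i, (fun ω => g i (Xs i ω)) ∈ S.H)
    {n : ℕ} (hE : ∀ i < n, S.E (fun ω => g i (Xs i ω)) ≤ 1) :
    (fun ω => stoppedProduct g c n fun i => Xs i ω) ∈ S.H ∧
      S.E (fun ω => stoppedProduct g c n fun i => Xs i ω) ≤ 1 := by
  have hXm : Measurable fun ω => fun i => Xs i ω :=
    measurable_pi_lambda _ fun n => S.measurable_of_mem _ (hXs n)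
  induction n with
  | zero => exact ⟨const_mem 1, by simpa [stoppedProduct] using (S.const 1).le⟩
  | succ k ih =>
    obtain ⟨ihm, ihE⟩ := ih fun i hi => hE i (by omega)
    set W := stoppedProduct g c k with hW
    have hWm : Measurable W := measurable_stoppedProduct hg k
    have hW0 : ∀ x, 0 ≤ W x := stoppedProduct_nonneg hg0 k
    have hWK : ∀ x, W x ≤ K ^ k := stoppedProduct_le hg0 hK hgK k
    set F : Set (ℕ → ℝ) := {x | c < W x} with hF
    have hFm : MeasurableSet F := measurableSet_lt measurable_const hWm
    have hcongr : ∀ x y : ℕ → ℝ, (∀ i < k, x i = y i) → W x = W y := fun x y h =>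
      stoppedProduct_congr k x y h
    set A : (ℕ → ℝ) → ℝ := fun x => F.indicator (fun _ => 1) x * W x with hA
    set B : (ℕ → ℝ) → ℝ := fun x => Fᶜ.indicator (fun _ => 1) x * W x with hB
    have hi0 : ∀ (G : Set (ℕ → ℝ)) x, 0 ≤ G.indicator (fun _ => (1 : ℝ)) x := fun G x =>
      indicator_nonneg (fun _ _ => zero_le_one) x
    have hi1 : ∀ (G : Set (ℕ → ℝ)) x, G.indicator (fun _ => (1 : ℝ)) x ≤ 1 := fun G x =>
      indicator_le_self' (fun _ _ => zero_le_one) x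
    have hFxy : ∀ x y : ℕ → ℝ, (∀ i < k, x i = y i) → (x ∈ F ↔ y ∈ F) := fun x y h => by
      simp only [hF, mem_ofPred_eq, hcongr x y h]
    have hAH : (fun ω => A fun i => Xs i ω) ∈ S.H :=
      mul_mem (S.indicator_mem _ (hXm hFm)) ihm
    have hBH : (fun ω => B fun i => Xs i ω) ∈ S.H :=
      mul_mem (S.indicator_mem _ (hXm hFm.compl)) ihm
    have hAB : ∀ x, A x + B x = W x := fun x => by
      by_cases hx : x ∈ F <;> simp [hA, hB, hx]
    have hsucc : ∀ x, stoppedProduct g c (k + 1) x = A x + B x * g k (x k) := fun x => by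
      rw [stoppedProduct]
      by_cases hx : c < W x
      · have hx' : x ∈ F := hx
        rw [if_pos hx]
        simp [hA, hB, hx', hW]
      · have hx' : x ∉ F := hx
        rw [if_neg hx]
        simp [hA, hB, hx', hW]
    simp only [hsucc]
    refine ⟨add_mem hAH (mul_mem hBH (hgH k)), ?_⟩
    have hKk : K ≤ K ^ (k + 1) := le_self_pow₀ hK k.succ_ne_zero
    have hKk' : K ^ k ≤ K ^ (k + 1) := pow_le_pow_right₀ hK k.le_succ
    have hmain := E_add_mul_of_indepSeq (S := S) hindep (k := k) (A := A) (B := B) (g := g k)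
      (K := K ^ (k + 1)) ((measurable_const.indicator hFm).mul hWm)
      ((measurable_const.indicator hFm.compl).mul hWm) (hg k)
      (fun x y h => by simp only [hA, indicator_apply, hFxy x y h, hcongr x y h])
      (fun x y h => by simp only [hB, indicator_apply, mem_compl_iff, hFxy x y h, hcongr x y h])
      (fun x => mul_nonneg (hi0 _ _) (hW0 x)) (fun x => mul_nonneg (hi0 _ _) (hW0 x)) (hg0 k)
      (fun x => (mul_le_of_le_one_left (hW0 x) (hi1 _ _)).trans ((hWK x).trans hKk'))
      (fun x => (mul_le_of_le_one_left (hW0 x) (hi1 _ _)).trans ((hWK x).trans hKk'))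
      (fun x => (hgK k x).trans hKk) hAH hBH (hgH k)
    rw [hmain]
    have he1 : (S.E fun ω => g k (Xs k ω)).toReal ≤ 1 := by
      have h1 := hE k k.lt_succ_self
      rw [← coe_toReal_E (hgH k) (fun ω => hg0 _ _) (fun ω => hgK _ _)] at h1
      exact_mod_cast h1
    refine (E_le_of_le (add_mem hAH (mul_mem hBH (const_mem _))) ihm fun ω => ?_).trans ihE
    rw [← hAB]
    gcongr
    exact mul_le_of_le_one_right (mul_nonneg (hi0 _ _) (hW0 _)) he1

/-- Ville's maximal inequality. -/
theorem cap_exists_lt_prod_le (hXs : ∀ n, Xs n ∈ S.H) (hindep : S.IndepSeq Xs)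
    (hg : ∀ i, Measurable (g i)) (hg0 : ∀ i x, 0 ≤ g i x) {K : ℝ} (hK : 1 ≤ K)
    (hgK : ∀ i x, g i x ≤ K) (hgH : ∀ i, (fun ω => g i (Xs i ω)) ∈ S.H)
    {n : ℕ} (hE : ∀ i < n, S.E (fun ω => g i (Xs i ω)) ≤ 1) (hc : 0 < c) :
    S.cap {ω | ∃ k ≤ n, c < ∏ i ∈ Finset.range k, g i (Xs i ω)} ≤ ENNReal.ofReal c⁻¹ := by
  obtain ⟨h1, h2⟩ := stoppedProduct_mem_and_E_le_one (c := c) hXs hindep hg hg0 hK hgK hgH hE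
  have hXm : ∀ i, Measurable (Xs i) := fun n => S.measurable_of_mem _ (hXs n)
  have hm : MeasurableSet {ω | ∃ k ≤ n, c < ∏ i ∈ Finset.range k, g i (Xs i ω)} := by
    have : {ω | ∃ k ≤ n, c < ∏ i ∈ Finset.range k, g i (Xs i ω)} =
        ⋃ k ∈ Finset.Iic n, {ω | c < ∏ i ∈ Finset.range k, g i (Xs i ω)} := by
      ext ω; simp
    rw [this]
    exact Finset.measurableSet_biUnion _ fun k _ => measurableSet_lt measurable_const
      (Finset.measurable_prod _ fun i _ => (hg i).comp (hXm i))
  have hWm := S.measurable_of_mem _ h1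
  refine (cap_mono hm (measurableSet_lt measurable_const hWm) fun ω hω => ?_).trans
    (b := S.cap {ω | c < stoppedProduct g c n fun i => Xs i ω}) ?_
  · obtain ⟨k, hk, hlt⟩ := hω
    exact (lt_stoppedProduct_or n fun i => Xs i ω).resolve_right fun h => h.2 k hk hlt
  · have h3 := (ofReal_mul_cap_le_E h1 (fun ω => stoppedProduct_nonneg hg0 n _) hc.le).trans
      (EReal.toENNReal_le_toENNReal h2)
    have h4 : EReal.toENNReal 1 = 1 := by
      rw [← EReal.coe_one, EReal.real_coe_toENNReal, ENNReal.ofReal_one]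
    rw [h4] at h3
    rw [ENNReal.ofReal_inv_of_pos hc]
    exact ENNReal.le_inv_iff_mul_le.2 (by rwa [mul_comm])

end Independence

end SublinearExpectationSpace

/-! ### Exponential inequalities for truncated sums -/

/-- Truncation at level one. -/
noncomputable def unitClamp (w : ℝ) : ℝ := max (-1) (min w 1)

theorem neg_one_le_unitClamp (w : ℝ) : -1 ≤ unitClamp w := le_max_left _ _

theorem unitClamp_le_one (w : ℝ) : unitClamp w ≤ 1 := max_le (by norm_num) (min_le_right _ _)

theorem abs_unitClamp_le_one (w : ℝ) : |unitClamp w| ≤ 1 :=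
  abs_le.2 ⟨neg_one_le_unitClamp w, unitClamp_le_one w⟩

theorem unitClamp_of_abs_le {w : ℝ} (h : |w| ≤ 1) : unitClamp w = w := by
  rw [abs_le] at h
  rw [unitClamp, min_eq_left h.2, max_eq_right h.1]

theorem abs_unitClamp_sub_le (x y : ℝ) : |unitClamp x - unitClamp y| ≤ |x - y| := by
  refine (abs_max_sub_max_le_max _ _ _ _).trans ?_
  rw [sub_self, abs_zero]
  refine max_le (abs_nonneg _) ((abs_min_sub_min_le_max _ _ _ _).trans ?_)
  rw [sub_self, abs_zero]
  exact max_le le_rfl (abs_nonneg _)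

theorem measurable_unitClamp : Measurable unitClamp :=
  measurable_const.max (measurable_id.min measurable_const)

theorem abs_unitClamp_le_abs (w : ℝ) : |unitClamp w| ≤ |w| := by
  have h := abs_unitClamp_sub_le w 0
  rwa [unitClamp_of_abs_le (w := 0) (by simp), sub_zero, sub_zero] at h

/-- With a moment of order v ≤ 1 the clamped mean is small without any centring. -/
theorem abs_unitClamp_le_rpow {w v : ℝ} (hv0 : 0 < v) (hv1 : v ≤ 1) :
    |unitClamp w| ≤ |w| ^ v := by
  rcases le_or_gt |w| 1 with h | h
  · refine (abs_unitClamp_le_abs w).trans ?_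
    simpa using Real.rpow_le_rpow_of_exponent_ge' (abs_nonneg w) h hv0.le hv1
  · exact (abs_unitClamp_le_one w).trans (Real.one_le_rpow h.le hv0.le)

theorem unitClamp_sq_le_rpow {w v : ℝ} (hv0 : 0 < v) (hv2 : v ≤ 2) :
    unitClamp w ^ 2 ≤ |w| ^ v := by
  rw [← sq_abs]
  rcases le_or_gt |w| 1 with h | h
  · refine (pow_le_pow_left₀ (abs_nonneg _) (abs_unitClamp_le_abs w) 2).trans ?_
    have := Real.rpow_le_rpow_of_exponent_ge' (abs_nonneg w) h hv0.le hv2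
    rwa [Real.rpow_two] at this
  · exact (pow_le_one₀ (abs_nonneg _) (abs_unitClamp_le_one w)).trans
      (Real.one_le_rpow h.le hv0.le)

/-- Clamping errs by at most (|w| - 1)^+, so a nonpositive mean is inherited up to this error; for v
≥ 1 the error is at most |w|^v. -/
theorem unitClamp_le_add_max (w : ℝ) : unitClamp w ≤ w + max (|w| - 1) 0 := by
  rcases le_or_gt |w| 1 with h | h
  · rw [unitClamp_of_abs_le h]
    linarith [le_max_right (|w| - 1) 0]
  · have h1 := le_max_left (|w| - 1) 0
    rcases le_total 0 w with hw | hw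
    · rw [abs_of_nonneg hw] at h h1 ⊢
      linarith [unitClamp_le_one w]
    · rw [abs_of_nonpos hw] at h h1 ⊢
      rw [unitClamp, min_eq_left (by linarith), max_eq_left (by linarith)]
      linarith

theorem max_abs_sub_one_le_rpow {w v : ℝ} (hv : 1 ≤ v) : max (|w| - 1) 0 ≤ |w| ^ v := by
  refine max_le ?_ (by positivity)
  rcases le_or_gt |w| 1 with h | h
  · exact (sub_nonpos.2 h).trans (by positivity)
  · have := Real.rpow_le_rpow_of_exponent_le h.le hv
    rw [Real.rpow_one] at this
    linarith

theorem exp_sub_exp_le {M x y : ℝ} (hx : x ≤ M) (hy : y ≤ M) :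
    |Real.exp x - Real.exp y| ≤ Real.exp M * |x - y| := by
  wlog h : y ≤ x generalizing x y
  · rw [abs_sub_comm, abs_sub_comm x]
    exact this hy hx (le_of_not_ge h)
  rw [abs_of_nonneg (sub_nonneg.2 (Real.exp_le_exp.2 h)), abs_of_nonneg (sub_nonneg.2 h)]
  have h1 := Real.add_one_le_exp (y - x)
  have h2 : Real.exp y = Real.exp x * Real.exp (y - x) := by rw [← Real.exp_add]; congr 1; ring
  calc Real.exp x - Real.exp y = Real.exp x * (1 - Real.exp (y - x)) := by rw [h2]; ring
    _ ≤ Real.exp x * (x - y) := mul_le_mul_of_nonneg_left (by linarith) (Real.exp_pos x).le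
    _ ≤ _ := by
      have : 0 ≤ x - y := sub_nonneg.2 h
      gcongr

/-- Only an upper bound on x is needed. For x ≥ 0 use e^x - 1 ≤ x e^x twice; for x ≤ 0 use e^x ≤
1/(1 - x) ≤ 1 + x + x². -/
theorem exp_le_one_add_add_sq_mul {x L : ℝ} (hL : 0 ≤ L) (hx : x ≤ L) :
    Real.exp x ≤ 1 + x + x ^ 2 * Real.exp L := by
  rcases le_total 0 x with h | h
  · have h1 : Real.exp x - 1 ≤ x * Real.exp x := by
      have h2 := Real.add_one_le_exp (-x)
      have h3 : Real.exp x * Real.exp (-x) = 1 := by rw [← Real.exp_add]; simp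
      have := Real.exp_pos x
      nlinarith
    have h2 := Real.exp_le_exp.2 hx
    have h3 := Real.exp_pos x
    have h4 : Real.exp x - 1 ≤ x + x ^ 2 * Real.exp x := by nlinarith
    nlinarith [sq_nonneg x]
  · have h1 := Real.add_one_le_exp (-x)
    have h2 : Real.exp x * Real.exp (-x) = 1 := by rw [← Real.exp_add]; simp
    have h3 := Real.exp_pos x
    have h4 : 1 ≤ Real.exp L := Real.one_le_exp hL
    have h5 : Real.exp x * (1 - x) ≤ 1 := by nlinarith
    have h6 : Real.exp x ≤ 1 + x + x ^ 2 := by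
      have h7 : 1 ≤ (1 + x + x ^ 2) * (1 - x) := by nlinarith [mul_nonneg (sq_nonneg x) (neg_nonneg.2 h)]
      nlinarith
    nlinarith [sq_nonneg x]

/-- With D = e^{-2L} the compensator in the exponential inequality stays bounded; this is the origin
of the constant e³. -/
theorem exp_weight_mul_exp_le_three {L : ℝ} (hL : 0 ≤ L) :
    (L + L ^ 2 * Real.exp L) * Real.exp (-(2 * L)) ≤ 3 := by
  have h1 := Real.quadratic_le_exp_of_nonneg hL
  have h2 : Real.exp (-(2 * L)) = (Real.exp L * Real.exp L)⁻¹ := by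
    rw [Real.exp_neg, two_mul, Real.exp_add]
  have h3 : 1 ≤ Real.exp L := Real.one_le_exp hL
  rw [h2, ← div_eq_mul_inv, div_le_iff₀ (by positivity)]
  nlinarith

namespace SublinearExpectationSpace

variable {Ω : Type*} [MeasurableSpace Ω] {S : SublinearExpectationSpace Ω}

theorem unitClamp_mem {X : Ω → ℝ} (hX : X ∈ S.H) (b : ℝ) :
    (fun ω => unitClamp (b * X ω)) ∈ S.H :=
  comp_mem_of_lip hX (φ := fun x => unitClamp (b * x)) (abs_nonneg b) fun x y => by
    rw [← abs_mul, mul_sub]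
    exact abs_unitClamp_sub_le _ _

theorem exp_unitClamp_mem {X : Ω → ℝ} (hX : X ∈ S.H) (b L κ : ℝ) (hL : 0 ≤ L) (hκ : 0 ≤ κ) :
    (fun ω => Real.exp (L * unitClamp (b * X ω) - κ)) ∈ S.H := by
  refine comp_mem_of_lip hX (φ := fun x => Real.exp (L * unitClamp (b * x) - κ))
    (C := Real.exp L * (L * |b|)) (by positivity) fun x y => ?_
  have hle : ∀ z, L * unitClamp (b * z) - κ ≤ L := fun z => by
    have := unitClamp_le_one (b * z)
    nlinarith
  refine (exp_sub_exp_le (hle x) (hle y)).trans ?_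
  rw [mul_assoc]
  gcongr
  rw [sub_sub_sub_cancel_right, ← mul_sub, abs_mul, abs_of_nonneg hL, mul_assoc, ← abs_mul b,
    mul_sub b]
  exact mul_le_mul_of_nonneg_left (abs_unitClamp_sub_le _ _) hL

/-- Expanding to second order gives E[e^{Lτ}] ≤ 1 + κ ≤ e^κ, where the first and second moments of
the clamped variable τ share the bound d. -/
theorem E_exp_unitClamp_le_one {X : Ω → ℝ} (hX : X ∈ S.H) {b L d : ℝ} (hL : 0 ≤ L) (hd : 0 ≤ d)
    (h1 : S.E (fun ω => unitClamp (b * X ω)) ≤ (d : EReal))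
    (h2 : S.E (fun ω => unitClamp (b * X ω) ^ 2) ≤ (d : EReal)) :
    S.E (fun ω => Real.exp (L * unitClamp (b * X ω) - (L + L ^ 2 * Real.exp L) * d)) ≤ 1 := by
  set κ := (L + L ^ 2 * Real.exp L) * d with hκ
  have hκ0 : 0 ≤ κ := by positivity
  have hτ := unitClamp_mem hX b
  have hτ2 : (fun ω => unitClamp (b * X ω) ^ 2) ∈ S.H := by
    simpa only [pow_two] using mul_mem hτ hτ
  have h3 := E_add_le (const_mem (S := S) 1) (add_mem (const_mul_mem L hτ)
    (const_mul_mem (L ^ 2 * Real.exp L) hτ2)) (S.const 1).le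
    (E_add_le (const_mul_mem L hτ) (const_mul_mem (L ^ 2 * Real.exp L) hτ2)
      (E_const_mul_le hτ hL h1) (E_const_mul_le hτ2 (by positivity) h2))
  have hsum := add_mem (const_mem (S := S) 1) (add_mem (const_mul_mem L hτ)
    (const_mul_mem (L ^ 2 * Real.exp L) hτ2))
  have h4 := E_const_mul_le hsum (Real.exp_pos (-κ)).le h3
  refine (E_le_of_le (exp_unitClamp_mem hX b L κ hL hκ0) (const_mul_mem _ hsum) fun ω => ?_).trans
    (h4.trans ?_)
  · rw [sub_eq_neg_add, Real.exp_add]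
    gcongr
    have hle : L * unitClamp (b * X ω) ≤ L := by
      have := unitClamp_le_one (b * X ω)
      nlinarith
    refine (exp_le_one_add_add_sq_mul hL hle).trans_eq ?_
    ring
  · rw [← EReal.coe_one, EReal.coe_le_coe_iff]
    have h5 := Real.add_one_le_exp κ
    calc Real.exp (-κ) * (1 + (L * d + L ^ 2 * Real.exp L * d)) = Real.exp (-κ) * (κ + 1) := by
          rw [hκ]; ring
      _ ≤ Real.exp (-κ) * Real.exp κ := by gcongr
      _ = 1 := by rw [← Real.exp_add]; simp

variable {Xs : ℕ → Ω → ℝ}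

theorem setOf_exists_lt_sum_measurableSet {Y : ℕ → Ω → ℝ} (hY : ∀ i, Measurable (Y i)) (n : ℕ)
    (t : ℝ) : MeasurableSet {ω | ∃ k ≤ n, t < ∑ i ∈ Finset.range k, Y i ω} := by
  have : {ω | ∃ k ≤ n, t < ∑ i ∈ Finset.range k, Y i ω} =
      ⋃ k ∈ Finset.Iic n, {ω | t < ∑ i ∈ Finset.range k, Y i ω} := by
    ext ω; simp
  rw [this]
  exact Finset.measurableSet_biUnion _ fun k _ => measurableSet_lt measurable_const
    (Finset.measurable_sum _ fun i _ => hY i)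

/-- Ville's inequality for the compensated exponentials; replacing the compensator at time k by its
final value covers all k at once. -/
theorem cap_exists_lt_sum_unitClamp_le_exp (hXs : ∀ n, Xs n ∈ S.H) (hindep : S.IndepSeq Xs)
    {n : ℕ} {b d : ℕ → ℝ} (hd : ∀ i, 0 ≤ d i)
    (h1 : ∀ i < n, S.E (fun ω => unitClamp (b i * Xs i ω)) ≤ (d i : EReal))
    (h2 : ∀ i < n, S.E (fun ω => unitClamp (b i * Xs i ω) ^ 2) ≤ (d i : EReal))
    {L : ℝ} (hL : 0 ≤ L) (t : ℝ) :
    S.cap {ω | ∃ k ≤ n, t < ∑ i ∈ Finset.range k, unitClamp (b i * Xs i ω)} ≤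
      ENNReal.ofReal (Real.exp ((L + L ^ 2 * Real.exp L) * ∑ i ∈ Finset.range n, d i - L * t)) := by
  rcases hL.eq_or_lt with rfl | hLpos
  · have hXm : ∀ i, Measurable fun ω => unitClamp (b i * Xs i ω) := fun i =>
      S.measurable_of_mem _ (unitClamp_mem (hXs i) _)
    simpa using cap_le_one (setOf_exists_lt_sum_measurableSet hXm n t)
  set M := L + L ^ 2 * Real.exp L with hM
  have hM0 : 0 ≤ M := by positivity
  set D := ∑ i ∈ Finset.range n, d i with hD
  have hXm : ∀ i, Measurable (Xs i) := fun i => S.measurable_of_mem _ (hXs i)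
  have hmeas : ∀ i, Measurable fun x => Real.exp (L * unitClamp (b i * x) - M * d i) := fun i =>
    (((measurable_unitClamp.comp (measurable_const_mul (b i))).const_mul L).sub_const _).exp
  have h3 := cap_exists_lt_prod_le (S := S) (c := Real.exp (L * t - M * D))
    (g := fun i x => Real.exp (L * unitClamp (b i * x) - M * d i)) (K := Real.exp L) (n := n)
    hXs hindep hmeas (fun i x => (Real.exp_pos _).le) (Real.one_le_exp hL)
    (fun i x => Real.exp_le_exp.2 (by
      have := unitClamp_le_one (b i * x)
      have := mul_nonneg hM0 (hd i)
      nlinarith))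
    (fun i => exp_unitClamp_mem (hXs i) _ _ _ hL (mul_nonneg hM0 (hd i)))
    (fun i hi => E_exp_unitClamp_le_one (hXs i) hL (hd i) (h1 i hi) (h2 i hi)) (Real.exp_pos _)
  rw [← Real.exp_neg, neg_sub] at h3
  refine (cap_mono (setOf_exists_lt_sum_measurableSet (fun i =>
    S.measurable_of_mem _ (unitClamp_mem (hXs i) _)) n t) ?_ ?_).trans h3
  · have : {ω | ∃ k ≤ n, Real.exp (L * t - M * D) <
        ∏ i ∈ Finset.range k, Real.exp (L * unitClamp (b i * Xs i ω) - M * d i)} =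
        ⋃ k ∈ Finset.Iic n, {ω | Real.exp (L * t - M * D) <
          ∏ i ∈ Finset.range k, Real.exp (L * unitClamp (b i * Xs i ω) - M * d i)} := by
      ext ω; simp
    rw [this]
    exact Finset.measurableSet_biUnion _ fun k _ => measurableSet_lt measurable_const
      (Finset.measurable_prod _ fun i _ => (hmeas i).comp (hXm i))
  · rintro ω ⟨k, hk, hlt⟩
    refine ⟨k, hk, ?_⟩
    rw [← Real.exp_sum, Real.exp_lt_exp, Finset.sum_sub_distrib, ← Finset.mul_sum,
      ← Finset.mul_sum]
    have h4 : ∑ i ∈ Finset.range k, d i ≤ D :=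
      Finset.sum_le_sum_of_subset_of_nonneg (Finset.range_mono hk) fun i _ _ => hd i
    have h5 := mul_le_mul_of_nonneg_left h4 hM0
    have h6 := mul_lt_mul_of_pos_left hlt hLpos
    linarith

/-- For D < 1 choose L with e^{-2L} = D, so that e^{-Lt} = D^{t/2}; for D ≥ 1 the right side is at
least 1. The exponent t/2 is at one's disposal. -/
theorem cap_exists_lt_sum_unitClamp_le_rpow (hXs : ∀ n, Xs n ∈ S.H) (hindep : S.IndepSeq Xs)
    {n : ℕ} {b d : ℕ → ℝ} (hd : ∀ i, 0 ≤ d i)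
    (h1 : ∀ i < n, S.E (fun ω => unitClamp (b i * Xs i ω)) ≤ (d i : EReal))
    (h2 : ∀ i < n, S.E (fun ω => unitClamp (b i * Xs i ω) ^ 2) ≤ (d i : EReal))
    {D t : ℝ} (hD0 : 0 < D) (hD : ∑ i ∈ Finset.range n, d i ≤ D) (ht : 0 ≤ t) :
    S.cap {ω | ∃ k ≤ n, t < ∑ i ∈ Finset.range k, unitClamp (b i * Xs i ω)} ≤
      ENNReal.ofReal (Real.exp 3 * D ^ (t / 2)) := by
  rcases le_or_gt 1 D with hD1 | hD1
  · refine (cap_le_one (setOf_exists_lt_sum_measurableSet (fun i =>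
      S.measurable_of_mem _ (unitClamp_mem (hXs i) _)) n t)).trans ?_
    rw [← ENNReal.ofReal_one]
    refine ENNReal.ofReal_le_ofReal ?_
    exact one_le_mul_of_one_le_of_one_le (Real.one_le_exp (by norm_num))
      (Real.one_le_rpow hD1 (by positivity))
  · set L := -(Real.log D) / 2 with hLdef
    have hL : 0 ≤ L := by have := Real.log_neg hD0 hD1; rw [hLdef]; linarith
    have hDL : D = Real.exp (-(2 * L)) := by
      rw [hLdef, show -(2 * (-Real.log D / 2)) = Real.log D by ring, Real.exp_log hD0]
    refine (cap_exists_lt_sum_unitClamp_le_exp hXs hindep hd h1 h2 hL t).trans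
      (ENNReal.ofReal_le_ofReal ?_)
    have h3 : D ^ (t / 2) = Real.exp (-(L * t)) := by
      rw [hDL, ← Real.exp_mul]; congr 1; ring
    rw [h3, ← Real.exp_add, Real.exp_le_exp]
    have h4 : (L + L ^ 2 * Real.exp L) * ∑ i ∈ Finset.range n, d i ≤
        (L + L ^ 2 * Real.exp L) * D := by gcongr
    have h5 := exp_weight_mul_exp_le_three hL
    rw [← hDL] at h5
    linarith

/-- Since |x|^v is not locally Lipschitz at 0 for v < 1, |X|^v need not belong to `H`. The
comparison is therefore made between tails, not by monotonicity of E. -/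
theorem E_le_abs_rpow_mul {X Y : Ω → ℝ} (hX : X ∈ S.H) (hY : Y ∈ S.H) (h0 : ∀ ω, 0 ≤ Y ω)
    {v b K : ℝ} (hv : 0 < v) (hK : 0 ≤ K)
    (hXK : ∫⁻ x in Ioi (0 : ℝ), S.cap {ω | x < |X ω| ^ v} ≤ ENNReal.ofReal K)
    (hYX : ∀ ω, Y ω ≤ |b * X ω| ^ v) : S.E Y ≤ ((|b| ^ v * K : ℝ) : EReal) := by
  rcases eq_or_ne b 0 with rfl | hb
  · have hY0 : ∀ ω, Y ω ≤ 0 := fun ω => by simpa [Real.zero_rpow hv.ne'] using hYX ω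
    simpa [Real.zero_rpow hv.ne'] using E_le_of_le_const hY hY0
  have hb0 : 0 < |b| ^ v := Real.rpow_pos_of_pos (abs_pos.2 hb) v
  have hXm := S.measurable_of_mem X hX
  have hYm := S.measurable_of_mem Y hY
  have hXv : Measurable fun ω => |X ω| ^ v := by fun_prop
  refine E_le_of_lintegral_cap_le hY h0 (by positivity) ?_
  have hcv := lintegral_Ioi_comp_of_deriv_pos (φ := fun u => |b| ^ v * u)
    (φ' := fun _ => |b| ^ v) (m := 0) (by fun_prop)
    (fun u _ => by simpa using (hasDerivAt_id u).const_mul (|b| ^ v))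
    (fun _ _ => hb0) (Filter.tendsto_id.const_mul_atTop hb0) (fun x => S.cap {ω | x < Y ω})
  rw [mul_zero] at hcv
  rw [hcv, lintegral_const_mul' _ _ ENNReal.ofReal_ne_top, ENNReal.ofReal_mul hb0.le]
  gcongr
  refine le_trans (lintegral_mono fun x => ?_) hXK
  refine cap_mono (measurableSet_lt measurable_const hYm) (measurableSet_lt measurable_const hXv)
    fun ω hω => ?_
  have h1 : |b| ^ v * x < |b * X ω| ^ v := lt_of_lt_of_le hω (hYX ω)
  rw [abs_mul, Real.mul_rpow (abs_nonneg _) (abs_nonneg _)] at h1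
  exact lt_of_mul_lt_mul_left h1 hb0.le

theorem E_unitClamp_sq_le {X : Ω → ℝ} (hX : X ∈ S.H) {v b K : ℝ} (hv : 0 < v) (hv2 : v ≤ 2)
    (hK : 0 ≤ K) (hXK : ∫⁻ x in Ioi (0 : ℝ), S.cap {ω | x < |X ω| ^ v} ≤ ENNReal.ofReal K) :
    S.E (fun ω => unitClamp (b * X ω) ^ 2) ≤ ((|b| ^ v * K : ℝ) : EReal) := by
  have hτ := unitClamp_mem hX b
  refine E_le_abs_rpow_mul hX (by simpa only [pow_two] using mul_mem hτ hτ)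
    (fun ω => sq_nonneg _) hv hK hXK fun ω => unitClamp_sq_le_rpow hv hv2

theorem E_unitClamp_le {X : Ω → ℝ} (hX : X ∈ S.H) {v b K : ℝ} (hv : 0 < v)
    (hK : 0 ≤ K) (hXK : ∫⁻ x in Ioi (0 : ℝ), S.cap {ω | x < |X ω| ^ v} ≤ ENNReal.ofReal K)
    (hmean : v ≤ 1 ∨ (1 ≤ v ∧ S.E (fun ω => b * X ω) ≤ 0)) :
    S.E (fun ω => unitClamp (b * X ω)) ≤ ((|b| ^ v * K : ℝ) : EReal) := by
  have hτ := unitClamp_mem hX b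
  rcases hmean with hv1 | ⟨hv1, hE⟩
  · exact (E_le_of_le hτ (abs_mem hτ) fun ω => le_abs_self _).trans
      (E_le_abs_rpow_mul hX (abs_mem hτ) (fun ω => abs_nonneg _) hv hK hXK
        fun ω => abs_unitClamp_le_rpow hv hv1)
  · have hbX := const_mul_mem b hX
    have hmax : (fun ω => max (|b * X ω| - 1) 0) ∈ S.H :=
      max_mem (sub_mem (abs_mem hbX) (const_mem 1)) (const_mem 0)
    have h1 := E_le_abs_rpow_mul hX hmax (fun ω => le_max_right _ _) hv hK hXK
      fun ω => max_abs_sub_one_le_rpow (w := b * X ω) hv1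
    have h2 := E_add_le (a := 0) hbX hmax hE h1
    rw [zero_add] at h2
    exact (E_le_of_le hτ (add_mem hbX hmax) fun ω => unitClamp_le_add_max _).trans h2

/-- A maximal inequality for weighted sums of independent random variables. -/
theorem cap_exists_lt_abs_sum_le (hXs : ∀ n, Xs n ∈ S.H) (hindep : S.IndepSeq Xs) {n : ℕ}
    {a : ℕ → ℝ} {v K c D t : ℝ} (hv : 0 < v) (hv2 : v ≤ 2) (hK : 0 ≤ K)
    (hXK : ∀ i, ∫⁻ x in Ioi (0 : ℝ), S.cap {ω | x < |Xs i ω| ^ v} ≤ ENNReal.ofReal K)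
    (hmean : v ≤ 1 ∨ (1 ≤ v ∧ ∀ i, ∀ b : ℝ, S.E (fun ω => b * Xs i ω) ≤ 0)) (hc : 0 < c)
    (hD0 : 0 < D) (hD : ∑ i ∈ Finset.range n, |a i / c| ^ v * K ≤ D) (ht : 0 ≤ t) :
    S.cap {ω | ∃ k ≤ n, t * c < |∑ i ∈ Finset.range k, a i * Xs i ω|} ≤
      ∑ i ∈ Finset.range n, S.cap {ω | c < |a i * Xs i ω|} +
        2 * ENNReal.ofReal (Real.exp 3 * D ^ (t / 2)) := by
  have hXm : ∀ i, Measurable (Xs i) := fun i => S.measurable_of_mem _ (hXs i)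
  have hmean' : ∀ i, ∀ b : ℝ, v ≤ 1 ∨ (1 ≤ v ∧ S.E (fun ω => b * Xs i ω) ≤ 0) := fun i b =>
    hmean.imp id fun h => ⟨h.1, h.2 i b⟩
  have hone : ∀ σ : ℝ, |σ| = 1 →
      S.cap {ω | ∃ k ≤ n, t < ∑ i ∈ Finset.range k, unitClamp (σ * (a i / c) * Xs i ω)} ≤
        ENNReal.ofReal (Real.exp 3 * D ^ (t / 2)) := fun σ hσ => by
    have habs : ∀ i, |σ * (a i / c)| = |a i / c| := fun i => by rw [abs_mul, hσ, one_mul]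
    refine cap_exists_lt_sum_unitClamp_le_rpow hXs hindep (d := fun i => |a i / c| ^ v * K)
      (fun i => by positivity) (fun i _ => ?_) (fun i _ => ?_) hD0 hD ht
    · rw [← habs i]
      exact E_unitClamp_le (hXs i) hv hK (hXK i) (hmean' i _)
    · rw [← habs i]
      exact E_unitClamp_sq_le (hXs i) hv hv2 hK (hXK i)
  have hm : ∀ σ : ℝ, MeasurableSet
      {ω | ∃ k ≤ n, t < ∑ i ∈ Finset.range k, unitClamp (σ * (a i / c) * Xs i ω)} := fun σ =>
    setOf_exists_lt_sum_measurableSet (fun i =>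
      S.measurable_of_mem _ (unitClamp_mem (hXs i) _)) n t
  have hmi : ∀ i ∈ Finset.range n, MeasurableSet {ω | c < |a i * Xs i ω|} := fun i _ =>
    measurableSet_lt measurable_const (by have := hXm i; fun_prop)
  have hmU := Finset.measurableSet_biUnion _ hmi
  have hmL : MeasurableSet {ω | ∃ k ≤ n, t * c < |∑ i ∈ Finset.range k, a i * Xs i ω|} := by
    have : {ω | ∃ k ≤ n, t * c < |∑ i ∈ Finset.range k, a i * Xs i ω|} =
        ⋃ k ∈ Finset.Iic n, {ω | t * c < |∑ i ∈ Finset.range k, a i * Xs i ω|} := by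
      ext ω; simp
    rw [this]
    exact Finset.measurableSet_biUnion _ fun k _ => measurableSet_lt measurable_const
      (Finset.measurable_sum _ fun i _ => (hXm i).const_mul _).abs
  -- If no summand exceeds c, then clamping at level c is invisible, and a large absolute value
  -- means a large sum for one of the two signs.
  have hsub : {ω | ∃ k ≤ n, t * c < |∑ i ∈ Finset.range k, a i * Xs i ω|} ⊆
      (⋃ i ∈ Finset.range n, {ω | c < |a i * Xs i ω|}) ∪
        ({ω | ∃ k ≤ n, t < ∑ i ∈ Finset.range k, unitClamp (1 * (a i / c) * Xs i ω)} ∪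
          {ω | ∃ k ≤ n, t < ∑ i ∈ Finset.range k, unitClamp (-1 * (a i / c) * Xs i ω)}) := by
    rintro ω ⟨k, hk, hlt⟩
    by_cases hU : ω ∈ ⋃ i ∈ Finset.range n, {ω | c < |a i * Xs i ω|}
    · exact Or.inl hU
    right
    have hle : ∀ i < n, |a i * Xs i ω| ≤ c := fun i hi => by
      by_contra hcon
      exact hU (mem_biUnion (Finset.mem_coe.2 (Finset.mem_range.2 hi)) (not_le.1 hcon))
    have hsum : ∀ σ : ℝ, |σ| = 1 → ∑ i ∈ Finset.range k, unitClamp (σ * (a i / c) * Xs i ω) =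
        σ / c * ∑ i ∈ Finset.range k, a i * Xs i ω := fun σ hσ => by
      rw [Finset.mul_sum]
      refine Finset.sum_congr rfl fun i hi => ?_
      have hi' : i < n := (Finset.mem_range.1 hi).trans_le hk
      have heq : σ * (a i / c) * Xs i ω = σ / c * (a i * Xs i ω) := by ring
      rw [heq]
      refine unitClamp_of_abs_le ?_
      rw [abs_mul, abs_div, hσ, abs_of_pos hc, one_div_mul_eq_div, div_le_one hc]
      exact hle i hi'
    rcases lt_abs.1 hlt with h | h
    · left
      refine ⟨k, hk, ?_⟩
      rw [hsum 1 (by simp), one_div_mul_eq_div, lt_div_iff₀ hc]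
      exact h
    · right
      refine ⟨k, hk, ?_⟩
      rw [hsum (-1) (by simp), neg_div, neg_mul, one_div_mul_eq_div, ← neg_div, lt_div_iff₀ hc]
      exact h
  refine (cap_mono hmL (hmU.union ((hm 1).union (hm (-1)))) hsub).trans ?_
  refine (cap_union_le hmU ((hm 1).union (hm (-1)))).trans (add_le_add (cap_biUnion_le _ hmi) ?_)
  refine (cap_union_le (hm 1) (hm (-1))).trans ?_
  rw [two_mul]
  exact add_le_add (hone 1 (by simp)) (hone (-1) (by simp))

end SublinearExpectationSpace

/-! ### Level sets of the excess. -/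

theorem excess_nonneg {Ω : Type*} {Xs : ℕ → Ω → ℝ} {a : ℕ → ℕ → ℝ} {p ε : ℝ} (n : ℕ)
    (ω : Ω) : 0 ≤ excess a Xs p ε n ω := le_max_right _ _

theorem lt_excess_iff {Ω : Type*} {Xs : ℕ → Ω → ℝ} {a : ℕ → ℕ → ℝ} {p ε : ℝ}
    (hp : 0 < p) (hε : 0 < ε) {x : ℝ} (hx : 0 ≤ x) (n : ℕ) (ω : Ω) :
    x < excess a Xs p ε (n + 1) ω ↔
      ∃ k ≤ n + 1, (ε + x) ^ (1 / p) < |∑ i ∈ Finset.range k, a (n + 1) i * Xs i ω| := by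
  have hεx : 0 < ε + x := by linarith
  rw [excess, lt_max_iff, or_iff_left hx.not_gt, lt_sub_iff_add_lt, add_comm x,
    ← Finset.sup'_univ_eq_ciSup, Finset.lt_sup'_iff]
  simp only [Finset.mem_univ, true_and, one_div,
    Real.rpow_inv_lt_iff_of_pos hεx.le (abs_nonneg _) hp]
  constructor
  · rintro ⟨k, hk⟩
    exact ⟨k + 1, by omega, hk⟩
  · rintro ⟨k, hk, hlt⟩
    -- The empty sum is allowed on the right for convenience; being zero, it cannot exceed a
    -- positive level.
    rcases k with _ | k
    · rw [Finset.range_zero, Finset.sum_empty, abs_zero, Real.zero_rpow hp.ne'] at hlt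
      linarith
    · exact ⟨⟨k, by omega⟩, hlt⟩

namespace SublinearExpectationSpace

variable {Ω : Type*} [MeasurableSpace Ω] {S : SublinearExpectationSpace Ω}

/-! ### Choquet moments in terms of tails -/

/-- The tail function `x ↦ V(|X| > x)`. -/
noncomputable def tailCap (S : SublinearExpectationSpace Ω) (X : Ω → ℝ) (x : ℝ) : ℝ≥0∞ :=
  S.cap {ω | x < |X ω|}

section Tails

variable {X Y : Ω → ℝ}

theorem tailCap_antitone (hX : X ∈ S.H) : Antitone (S.tailCap X) :=
  cap_lt_antitone (S.measurable_of_mem X hX).abs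

theorem tailCap_le_one (hX : X ∈ S.H) (x : ℝ) : S.tailCap X x ≤ 1 :=
  cap_le_one (measurableSet_lt measurable_const (S.measurable_of_mem X hX).abs)

theorem cap_eq_of_identDistr (hX : X ∈ S.H) (hY : Y ∈ S.H) (h : S.IdentDistr X Y) {B : Set ℝ}
    (hB : MeasurableSet B) : S.cap {ω | X ω ∈ B} = S.cap {ω | Y ω ∈ B} := by
  have hXB : MeasurableSet {ω | X ω ∈ B} := S.measurable_of_mem X hX hB
  have hYB : MeasurableSet {ω | Y ω ∈ B} := S.measurable_of_mem Y hY hB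
  have h1 := h (B.indicator fun _ => (1 : ℝ)) (measurable_const.indicator hB)
    (S.indicator_mem _ hXB) (S.indicator_mem _ hYB)
  have e1 : (fun ω => B.indicator (fun _ => (1 : ℝ)) (X ω)) =
      {ω | X ω ∈ B}.indicator fun _ => (1 : ℝ) := rfl
  have e2 : (fun ω => B.indicator (fun _ => (1 : ℝ)) (Y ω)) =
      {ω | Y ω ∈ B}.indicator fun _ => (1 : ℝ) := rfl
  rw [e1, e2, E_indicator_eq_toReal hXB, E_indicator_eq_toReal hYB] at h1
  have h2 := h1 (EReal.coe_ne_top _) (EReal.coe_ne_bot _) (EReal.coe_ne_top _) (EReal.coe_ne_bot _)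
  rw [EReal.coe_eq_coe_iff] at h2
  rw [cap_eq_ofReal_toReal hXB, cap_eq_ofReal_toReal hYB, h2]

theorem tailCap_eq_of_identDistr (hX : X ∈ S.H) (hY : Y ∈ S.H) (h : S.IdentDistr X Y) :
    S.tailCap X = S.tailCap Y :=
  funext fun x => cap_eq_of_identDistr hX hY h (B := {y | x < |y|})
    (measurableSet_lt measurable_const measurable_id.abs)

theorem lintegral_cap_rpow_eq {v : ℝ} (hv : 0 < v) :
    ∫⁻ x in Ioi (0 : ℝ), S.cap {ω | x < |X ω| ^ v} =
      ∫⁻ x in Ioi (0 : ℝ), S.tailCap X (1 * x ^ (1 / v)) := by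
  refine setLIntegral_congr_fun measurableSet_Ioi fun x hx => ?_
  have hx0 : 0 < x := hx
  rw [tailCap, one_mul]
  congr 1
  ext ω
  change x < |X ω| ^ v ↔ x ^ (1 / v) < |X ω|
  rw [one_div, Real.rpow_inv_lt_iff_of_pos hx0.le (abs_nonneg _) hv]

theorem lintegral_cap_rpow_lt_top_iff (hX : X ∈ S.H) {v : ℝ} (hv : 0 < v) :
    ∫⁻ x in Ioi (0 : ℝ), S.cap {ω | x < |X ω| ^ v} < ⊤ ↔ tailMoment (S.tailCap X) v 0 < ⊤ := by
  rw [lintegral_cap_rpow_eq hv, ← lintegral_comp_rpow_lt_top_iff (tailCap_antitone hX)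
    (tailCap_le_one hX) hv one_pos one_pos]
  refine ⟨fun h => (lintegral_mono_set (Ioi_subset_Ioi zero_le_one)).trans_lt h,
    fun h => lintegral_Ioi_lt_top_of_le (b := 1) (M := 1) (fun x _ => ?_) h⟩
  simpa using tailCap_le_one hX _

theorem choquet_rpow_lt_top_iff (hX : X ∈ S.H) {v : ℝ} (hv : 0 < v) :
    S.choquet (fun ω => |X ω| ^ v) < ⊤ ↔ tailMoment (S.tailCap X) v 0 < ⊤ := by
  rw [choquet_lt_top_iff (M := 0) fun ω => by rw [neg_zero]; positivity,
    lintegral_cap_rpow_lt_top_iff hX hv]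

/-- The quantity is the k-th power of u^{s/k} ln u, which is bounded by k/s on (0, 1]. -/
theorem abs_rpow_mul_log_pow_le {s u : ℝ} (hs : 0 < s) {k : ℕ} (hk : 1 ≤ k) (h0 : 0 ≤ u)
    (h1 : u ≤ 1) : |u ^ s * Real.log u ^ k| ≤ (k / s) ^ k := by
  have hk0 : (0 : ℝ) < k := by exact_mod_cast hk
  rcases h0.eq_or_lt with rfl | h0
  · rw [Real.zero_rpow hs.ne', zero_mul, abs_zero]
    positivity
  · have h2 := Real.abs_log_mul_self_rpow_lt u (s / k) h0 h1 (by positivity)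
    have h3 : u ^ s * Real.log u ^ k = (Real.log u * u ^ (s / k)) ^ k := by
      rw [mul_pow, ← Real.rpow_natCast (u ^ (s / k)), ← Real.rpow_mul h0.le,
        div_mul_cancel₀ _ hk0.ne', mul_comm]
    rw [h3, abs_pow]
    rw [one_div_div] at h2
    gcongr

theorem rpow_mul_log_pow_strictMonoOn {s : ℝ} (hs : 0 < s) {k : ℕ} :
    StrictMonoOn (fun u : ℝ => u ^ s * Real.log u ^ k) (Ici 1) := by
  intro u hu w hw huw
  have hu1 : (1 : ℝ) ≤ u := hu
  have hlu := Real.log_nonneg hu1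
  have hlw : 0 < Real.log w := Real.log_pos (hu1.trans_lt huw)
  have h1 : u ^ s < w ^ s := Real.rpow_lt_rpow (by linarith) huw hs
  have h2 : Real.log u ≤ Real.log w := Real.log_le_log (by linarith) huw.le
  calc u ^ s * Real.log u ^ k ≤ u ^ s * Real.log w ^ k := by gcongr
    _ < w ^ s * Real.log w ^ k := by gcongr

/-- Change variables by φ(u) = u^s ln^k u. It need not be monotone on [0, 1], but beyond a large m
its level sets are those of |X|, and φ' is comparable to u^{s-1} (1 + ln u)^k. -/
theorem lintegral_cap_rpow_mul_log_lt_top_iff (hX : X ∈ S.H) {s : ℝ} (hs : 0 < s) {k : ℕ}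
    (hk : 1 ≤ k) :
    ∫⁻ x in Ioi (0 : ℝ), S.cap {ω | x < |X ω| ^ s * Real.log |X ω| ^ k} < ⊤ ↔
      tailMoment (S.tailCap X) s k < ⊤ := by
  set M : ℝ := (k / s) ^ k with hM
  set φ : ℝ → ℝ := fun u => u ^ s * Real.log u ^ k with hφ
  set φ' : ℝ → ℝ := fun u => s * u ^ (s - 1) * Real.log u ^ k +
    u ^ s * (k * Real.log u ^ (k - 1) * u⁻¹) with hφ'
  have hk0 : (0 : ℝ) < k := by exact_mod_cast hk
  have htop : Filter.Tendsto φ Filter.atTop Filter.atTop :=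
    (tendsto_rpow_atTop hs).atTop_mul_atTop₀
      ((Filter.tendsto_pow_atTop (by omega)).comp Real.tendsto_log_atTop)
  -- φ(m) ≥ M puts the levels above all values of φ on [0, 1]; m ≥ e gives ln u ≥ 1.
  obtain ⟨m, hmM, hme⟩ := ((htop.eventually_ge_atTop M).and
    (Filter.eventually_ge_atTop (Real.exp 1))).exists
  have hm1 : 1 ≤ m := (Real.one_le_exp zero_le_one).trans hme
  have hlog : ∀ u, m < u → 1 ≤ Real.log u := fun u hu => by
    rw [Real.le_log_iff_exp_le (by linarith)]
    exact hme.trans hu.le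
  have hder : ∀ u ∈ Ioi m, HasDerivAt φ (φ' u) u := fun u hu => by
    have hu0 : 0 < u := by linarith [show m < u from hu]
    exact (Real.hasDerivAt_rpow_const (Or.inl hu0.ne')).mul ((Real.hasDerivAt_log hu0.ne').pow k)
  have hup : ∀ u, m < u → φ' u ≤ (s + k) * (u ^ (s - 1) * (1 + Real.log u) ^ k) := fun u hu => by
    have hu0 : 0 < u := by linarith
    have hl := hlog u hu
    have h1 : u ^ s * (k * Real.log u ^ (k - 1) * u⁻¹) =
        k * (u ^ (s - 1) * Real.log u ^ (k - 1)) := by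
      rw [Real.rpow_sub_one hu0.ne']; ring
    have h2 : Real.log u ^ (k - 1) ≤ (1 + Real.log u) ^ k :=
      (pow_le_pow_left₀ (by linarith) (by linarith) _).trans
        (pow_le_pow_right₀ (by linarith) (Nat.sub_le _ _))
    have h3 : Real.log u ^ k ≤ (1 + Real.log u) ^ k :=
      pow_le_pow_left₀ (by linarith) (by linarith) _
    calc φ' u = s * (u ^ (s - 1) * Real.log u ^ k) + k * (u ^ (s - 1) * Real.log u ^ (k - 1)) := by
          rw [← h1, hφ']; ring
      _ ≤ s * (u ^ (s - 1) * (1 + Real.log u) ^ k) + k * (u ^ (s - 1) * (1 + Real.log u) ^ k) := by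
          gcongr
      _ = _ := by ring
  have hlow : ∀ u, m < u → u ^ (s - 1) * (1 + Real.log u) ^ k ≤ 2 ^ k / s * φ' u := fun u hu => by
    have hu0 : 0 < u := by linarith
    have hl := hlog u hu
    have h2 : (1 + Real.log u) ^ k ≤ 2 ^ k * Real.log u ^ k := by
      rw [← mul_pow]
      exact pow_le_pow_left₀ (by linarith) (by linarith) _
    have h3 : 0 ≤ u ^ s * (k * Real.log u ^ (k - 1) * u⁻¹) := by positivity
    calc u ^ (s - 1) * (1 + Real.log u) ^ k ≤ u ^ (s - 1) * (2 ^ k * Real.log u ^ k) := by gcongr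
      _ = 2 ^ k / s * (s * u ^ (s - 1) * Real.log u ^ k) := by field_simp
      _ ≤ 2 ^ k / s * φ' u := by
          gcongr
          exact le_add_of_nonneg_right h3
  have hpos : ∀ u ∈ Ioi m, 0 < φ' u := fun u hu => by
    have hu0 : 0 < u := by linarith [show m < u from hu]
    have hl := hlog u hu
    have : 0 < Real.log u := by linarith
    positivity
  have hmono := rpow_mul_log_pow_strictMonoOn hs (k := k)
  have hset : ∀ u, m < u → {ω | φ u < |X ω| ^ s * Real.log |X ω| ^ k} = {ω | u < |X ω|} :=
    fun u hu => by
      ext ω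
      change φ u < φ |X ω| ↔ u < |X ω|
      constructor
      · intro h
        by_contra hcon
        rw [not_lt] at hcon
        refine absurd h (not_lt.2 ?_)
        rcases le_total |X ω| 1 with h1 | h1
        · exact (le_of_abs_le (abs_rpow_mul_log_pow_le hs hk (abs_nonneg _) h1)).trans
            (hmM.trans (hmono.monotoneOn (mem_Ici.2 hm1) (mem_Ici.2 (by linarith)) hu.le))
        · exact hmono.monotoneOn (mem_Ici.2 h1) (mem_Ici.2 (by linarith)) hcon
      · intro h
        exact hmono (mem_Ici.2 (by linarith)) (mem_Ici.2 (by linarith)) h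
  have hcont : ContinuousOn φ (Ici m) := fun u hu => by
    have hu0 : 0 < u := by linarith [show m ≤ u from hu]
    exact ((Real.continuousAt_rpow_const u s (Or.inl hu0.ne')).mul
      ((Real.continuousAt_log hu0.ne').pow k)).continuousWithinAt
  have hcv := lintegral_Ioi_comp_of_deriv_pos hcont hder hpos htop
    (fun x => S.cap {ω | x < |X ω| ^ s * Real.log |X ω| ^ k})
  have hcv' : ∫⁻ u in Ioi m, ENNReal.ofReal (φ' u) *
      S.cap {ω | φ u < |X ω| ^ s * Real.log |X ω| ^ k} =
      ∫⁻ u in Ioi m, ENNReal.ofReal (φ' u) * S.tailCap X u :=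
    setLIntegral_congr_fun measurableSet_Ioi fun u hu => by
      rw [hset u hu, tailCap]
  rw [hcv'] at hcv
  have hXm := S.measurable_of_mem X hX
  have hfm : Measurable fun ω => |X ω| ^ s * Real.log |X ω| ^ k := by fun_prop
  constructor
  · intro h
    refine tailMoment_lt_top_of_Ioi (tailCap_le_one hX) (b := m) ?_
    have hφm : 0 ≤ φ m := by have := Real.log_nonneg hm1; positivity
    have h1 := (lintegral_mono_set (Ioi_subset_Ioi hφm)).trans_lt h
    rw [hcv] at h1
    refine lt_of_le_of_lt ?_ (ENNReal.mul_lt_top (a := ENNReal.ofReal (2 ^ k / s))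
      ENNReal.ofReal_lt_top h1)
    rw [← lintegral_const_mul' _ _ ENNReal.ofReal_ne_top]
    refine setLIntegral_mono' measurableSet_Ioi fun u hu => ?_
    rw [← mul_assoc, ← ENNReal.ofReal_mul (by positivity), mul_comm]
    exact mul_le_mul_left (ENNReal.ofReal_le_ofReal (hlow u hu)) _
  · intro h
    refine lintegral_Ioi_lt_top_of_le (b := φ m) (M := 1) (fun x _ => ?_) ?_
    · rw [ENNReal.ofReal_one]
      exact cap_le_one (measurableSet_lt measurable_const hfm)
    · rw [hcv]
      refine lt_of_le_of_lt ?_ (ENNReal.mul_lt_top (a := ENNReal.ofReal (s + k))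
        ENNReal.ofReal_lt_top h)
      rw [tailMoment, ← lintegral_const_mul' _ _ ENNReal.ofReal_ne_top]
      refine (setLIntegral_mono' measurableSet_Ioi fun u hu => ?_).trans
        (lintegral_mono_set (Ioi_subset_Ioi hm1))
      rw [mul_left_comm, ← ENNReal.ofReal_mul (by positivity), mul_comm]
      exact mul_le_mul_right (ENNReal.ofReal_le_ofReal (hup u hu)) _

theorem choquet_rpow_mul_log_lt_top_iff (hX : X ∈ S.H) {s : ℝ} (hs : 0 < s) {k : ℕ}
    (hk : 1 ≤ k) :
    S.choquet (fun ω => |X ω| ^ s * Real.log |X ω| ^ k) < ⊤ ↔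
      tailMoment (S.tailCap X) s k < ⊤ := by
  rw [choquet_lt_top_iff (M := (k / s) ^ k), lintegral_cap_rpow_mul_log_lt_top_iff hX hs hk]
  intro ω
  rcases le_total |X ω| 1 with h1 | h1
  · exact (abs_le.1 (abs_rpow_mul_log_pow_le hs hk (abs_nonneg _) h1)).1
  · have := Real.log_nonneg h1
    have h2 : (0 : ℝ) ≤ (k / s) ^ k := by positivity
    have h3 : 0 ≤ |X ω| ^ s * Real.log |X ω| ^ k := by positivity
    linarith

theorem momentCond_iff (hX : X ∈ S.H) {p s : ℝ} (hp : 0 < p) (hs : 0 < s) :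
    S.MomentCond X p s ↔ TailMomentCond (S.tailCap X) p s 0 := by
  have h1 := choquet_rpow_mul_log_lt_top_iff hX hs (le_refl 1)
  simp only [pow_one] at h1
  rw [MomentCond, TailMomentCond, choquet_rpow_lt_top_iff hX hp, choquet_rpow_lt_top_iff hX hs, h1]

theorem logMomentCond_iff (hX : X ∈ S.H) {p s : ℝ} (hp : 0 < p) (hs : 0 < s) :
    S.LogMomentCond X p s ↔ TailMomentCond (S.tailCap X) p s 1 := by
  have h1 := choquet_rpow_mul_log_lt_top_iff hX hs (le_refl 1)
  simp only [pow_one] at h1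
  rw [LogMomentCond, TailMomentCond, choquet_rpow_lt_top_iff hX hp,
    choquet_rpow_mul_log_lt_top_iff hX hs one_le_two, h1, one_add_one_eq_two]

end Tails

/-! ### The excess of the maximal weighted sum -/

section Excess

variable {Xs : ℕ → Ω → ℝ} {a : ℕ → ℕ → ℝ} {p ε : ℝ}

theorem rpow_sub_rpow_le {p δ x y : ℝ} (hp : 0 < p) (hδ : 0 < δ) (hx : δ ≤ x) (hxy : x ≤ y) :
    y ^ p - x ^ p ≤ p * (δ ^ (p - 1) + y ^ |p - 1|) * (y - x) := by
  have hx0 : 0 < x := hδ.trans_le hx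
  have h := (convex_Icc x y).norm_image_sub_le_of_norm_hasDerivWithin_le
    (f := fun t : ℝ => t ^ p) (f' := fun t => p * t ^ (p - 1))
    (C := p * (δ ^ (p - 1) + y ^ |p - 1|)) (x := x) (y := y)
    (fun t ht => (Real.hasDerivAt_rpow_const
      (Or.inl (hx0.trans_le ht.1).ne')).hasDerivWithinAt) (fun t ht => ?_)
    (left_mem_Icc.2 hxy) (right_mem_Icc.2 hxy)
  · rw [Real.norm_eq_abs, Real.norm_eq_abs, abs_of_nonneg (sub_nonneg.2 hxy)] at h
    exact (le_abs_self _).trans h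
  · have ht0 : 0 < t := hx0.trans_le ht.1
    have hy0 : 0 < y := hx0.trans_le hxy
    rw [Real.norm_of_nonneg (by positivity)]
    refine mul_le_mul_of_nonneg_left ?_ hp.le
    rcases le_total 0 (p - 1) with h1 | h1
    · rw [abs_of_nonneg h1]
      exact (Real.rpow_le_rpow ht0.le ht.2 h1).trans (le_add_of_nonneg_left (by positivity))
    · exact (Real.rpow_le_rpow_of_nonpos hδ (hx.trans ht.1) h1).trans
        (le_add_of_nonneg_right (by positivity))

/-- Cutting |x| off below at ε^{1/p} removes the singularity of |x|^p at 0 when p < 1. This is why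
the excess lies in `H`. -/
theorem max_rpow_sub_eq {p ε x : ℝ} (hp : 0 < p) (hε : 0 < ε) :
    max (|x| ^ p - ε) 0 = max |x| (ε ^ (1 / p)) ^ p - ε := by
  have hδ : (ε ^ (1 / p)) ^ p = ε := by
    rw [← Real.rpow_mul hε.le, one_div_mul_cancel hp.ne', Real.rpow_one]
  rcases le_total |x| (ε ^ (1 / p)) with h | h
  · have h1 := Real.rpow_le_rpow (abs_nonneg x) h hp.le
    rw [hδ] at h1
    rw [max_eq_right h, hδ, max_eq_right (by linarith), sub_self]
  · have h1 := Real.rpow_le_rpow (by positivity) h hp.le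
    rw [hδ] at h1
    rw [max_eq_left h, max_eq_left (by linarith)]

theorem max_rpow_sub_mem {X : Ω → ℝ} (hX : X ∈ S.H) (hp : 0 < p) (hε : 0 < ε) :
    (fun ω => max (|X ω| ^ p - ε) 0) ∈ S.H := by
  set δ := ε ^ (1 / p) with hδdef
  have hδ : 0 < δ := by positivity
  set m := ⌈|p - 1|⌉₊ with hm
  refine comp_mem_of_local_lip hX (φ := fun x => max (|x| ^ p - ε) 0)
    (C := p * (δ ^ (p - 1) + δ ^ |p - 1| + 1)) (by positivity) m fun x y => ?_
  simp only [max_rpow_sub_eq hp hε, ← hδdef, sub_sub_sub_cancel_right]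
  wlog h : |x| ≤ |y| generalizing x y
  · have := this y x (le_of_not_ge h)
    rw [abs_sub_comm, abs_sub_comm x, add_right_comm 1]
    exact this
  have hXY : max |x| δ ≤ max |y| δ := max_le_max_right _ h
  have h1 := rpow_sub_rpow_le hp hδ (le_max_right |x| δ) hXY
  rw [abs_sub_comm, abs_of_nonneg
    (sub_nonneg.2 (Real.rpow_le_rpow (by positivity) hXY hp.le))]
  refine h1.trans ?_
  have h2 : max |y| δ - max |x| δ ≤ |x - y| := by
    refine (le_abs_self _).trans ((abs_max_sub_max_le_max _ _ _ _).trans ?_)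
    rw [sub_self, abs_zero, abs_sub_comm x]
    exact max_le (abs_abs_sub_abs_le_abs_sub _ _) (abs_nonneg _)
  have h3 : |y| ^ |p - 1| ≤ 1 + |y| ^ m := by
    rcases le_total |y| 1 with hy | hy
    · exact (Real.rpow_le_one (abs_nonneg y) hy (abs_nonneg _)).trans
        (le_add_of_nonneg_right (by positivity))
    · have := Real.rpow_le_rpow_of_exponent_le hy (Nat.le_ceil |p - 1|)
      rw [Real.rpow_natCast] at this
      exact this.trans (le_add_of_nonneg_left zero_le_one)
  have h4 : max |y| δ ^ |p - 1| ≤ δ ^ |p - 1| + (1 + |y| ^ m) := by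
    rcases le_total |y| δ with hy | hy
    · rw [max_eq_right hy]
      exact le_add_of_nonneg_right (by positivity)
    · rw [max_eq_left hy]
      exact h3.trans (le_add_of_nonneg_left (by positivity))
  have h5 : p * (δ ^ (p - 1) + max |y| δ ^ |p - 1|) ≤
      p * (δ ^ (p - 1) + δ ^ |p - 1| + 1) * (1 + |x| ^ m + |y| ^ m) := by
    rw [mul_assoc]
    refine mul_le_mul_of_nonneg_left ?_ hp.le
    have e1 : 0 < δ ^ (p - 1) := by positivity
    have e2 : 0 < δ ^ |p - 1| := by positivity
    have e3 : 0 ≤ |x| ^ m := by positivity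
    have e4 : 0 ≤ |y| ^ m := by positivity
    nlinarith [mul_nonneg e1.le e3, mul_nonneg e1.le e4, mul_nonneg e2.le e3, mul_nonneg e2.le e4]
  exact mul_le_mul h5 h2 (sub_nonneg.2 hXY) (by positivity)

/-- The positive part commutes with finite maxima, so the excess is a maximum of excesses of single
partial sums. -/
theorem excess_mem (hXs : ∀ n, Xs n ∈ S.H) (hp : 0 < p) (hε : 0 < ε) (n : ℕ) :
    excess a Xs p ε (n + 1) ∈ S.H := by
  set Z : Fin (n + 1) → Ω → ℝ := fun k ω =>
    max (|∑ i ∈ Finset.range ((k : ℕ) + 1), a (n + 1) i * Xs i ω| ^ p - ε) 0 with hZ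
  have hZH : ∀ k, Z k ∈ S.H := fun k =>
    max_rpow_sub_mem (sum_mem _ fun i _ => const_mul_mem _ (hXs i)) hp hε
  have heq : excess a Xs p ε (n + 1) =
      (Finset.univ : Finset (Fin (n + 1))).sup' Finset.univ_nonempty Z := by
    funext ω
    have hmono : Monotone fun t : ℝ => max (t - ε) 0 := fun x y hxy =>
      max_le_max_right _ (sub_le_sub_right hxy _)
    rw [Finset.sup'_apply, excess, ← Finset.sup'_univ_eq_ciSup]
    exact Finset.apply_sup'_eq_sup'_comp Finset.univ_nonempty (fun t : ℝ => max (t - ε) 0)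
      fun x y => hmono.map_sup x y
  rw [heq]
  exact Finset.sup'_induction Finset.univ_nonempty Z (p := fun Y => Y ∈ S.H)
    (fun _ h1 _ h2 => max_mem h1 h2) fun k _ => hZH k

end Excess

end SublinearExpectationSpace

/-! ### Series with bounded terms -/

theorem ENNReal.lt_top_of_mul_lt_top_right {a b : ℝ≥0∞} (ha : a ≠ 0) (h : a * b < ⊤) : b < ⊤ := by
  by_contra hcon
  rw [not_lt_top_iff.1 hcon, ENNReal.mul_top ha] at h
  exact lt_irrefl _ h

theorem ENNReal.tsum_lt_top_of_tsum_add_lt_top {f : ℕ → ℝ≥0∞} (N : ℕ) (hf : ∀ n, f n < ⊤)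
    (h : ∑' n, f (n + N) < ⊤) : ∑' n, f n < ⊤ := by
  rw [← Summable.sum_add_tsum_nat_add' (f := f) (k := N) ENNReal.summable]
  exact ENNReal.add_lt_top.2 ⟨ENNReal.sum_lt_top.2 fun n _ => hf n, h⟩

theorem ENNReal.tsum_add_le_tsum (f : ℕ → ℝ≥0∞) (N : ℕ) : ∑' n, f (n + N) ≤ ∑' n, f n :=
  ENNReal.tsum_comp_le_tsum_of_injective (add_left_injective N) f

theorem rowSum_lt_top {β q : ℝ} {G : ℝ → ℝ≥0∞} (hG1 : ∀ x, G x ≤ 1) (n : ℕ) :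
    rowSum β q G n < ⊤ :=
  ENNReal.sum_lt_top.2 fun _ _ => (hG1 _).trans_lt ENNReal.one_lt_top

/-- Passing from row n to a row at most twice as long multiplies the scales by at most 2^{q+β},
which the dilation undoes. -/
theorem rowSum_le_rowSum {β q : ℝ} (hqβ : 0 < q + β) {G : ℝ → ℝ≥0∞} (hG : Antitone G) {c : ℝ}
    (hc : 0 < c) {n m : ℕ} (hnm : n ≤ m) (hmn : m ≤ 2 * n + 1) :
    rowSum β q (fun u => G (c * u)) n ≤
      rowSum β q (fun u => G (c / 2 ^ (q + β) * u)) m := by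
  unfold rowSum
  refine (Finset.sum_le_sum fun j _ => ?_).trans
    (Finset.sum_le_sum_of_subset (Finset.range_mono (Nat.succ_le_succ hnm)))
  apply hG
  have h1 : ((m + 1 : ℕ) : ℝ) ≤ 2 * ((n + 1 : ℕ) : ℝ) := by
    have : m + 1 ≤ 2 * (n + 1) := by omega
    exact_mod_cast this
  rw [div_mul_eq_mul_div, div_le_iff₀ (by positivity), rowScale, rowScale]
  calc c * (((m + 1 : ℕ) : ℝ) ^ (q + β) * ((j + 1 : ℕ) : ℝ) ^ (-β))
      ≤ c * ((2 * ((n + 1 : ℕ) : ℝ)) ^ (q + β) * ((j + 1 : ℕ) : ℝ) ^ (-β)) := by gcongr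
    _ = _ := by rw [Real.mul_rpow (by norm_num) (by positivity)]; ring

/-- If the truncated double series converges for all dilations, its row sums tend to zero. -/
theorem exists_forall_rowSum_lt_one {r β q : ℝ} (hr : 1 < r) (hqβ : 0 < q + β) {G : ℝ → ℝ≥0∞}
    (hG : Antitone G) {N : ℕ} {c : ℝ} (hc : 0 < c)
    (h : ∑' n : ℕ, ENNReal.ofReal (((n + N + 1 : ℕ) : ℝ) ^ (r - 2)) *
      min 1 (rowSum β q (fun u => G (c / 2 ^ (q + β) * u)) (n + N)) < ⊤) :
    ∃ N₁, N ≤ N₁ ∧ ∀ n, N₁ ≤ n → rowSum β q (fun u => G (c * u)) n < 1 := by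
  set f : ℕ → ℝ≥0∞ := fun n => ENNReal.ofReal (((n + 1 : ℕ) : ℝ) ^ (r - 2)) *
      min 1 (rowSum β q (fun u => G (c / 2 ^ (q + β) * u)) n) with hf
  set T := ∑' n : ℕ, f (n + N) with hT
  have hT' : T < ⊤ := h
  have htop : Filter.Tendsto (fun n : ℕ => (2 ^ |2 - r|)⁻¹ * ((n + 1 : ℕ) : ℝ) ^ (r - 1))
      Filter.atTop Filter.atTop :=
    ((tendsto_rpow_atTop (by linarith)).comp (tendsto_natCast_atTop_atTop.comp
      (Filter.tendsto_add_atTop_nat 1))).const_mul_atTop (by positivity)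
  obtain ⟨N₀, hN₀⟩ := Filter.eventually_atTop.1 (htop.eventually_gt_atTop T.toReal)
  refine ⟨max N N₀, le_max_left _ _, fun n hn => ?_⟩
  by_contra hcon
  rw [not_lt] at hcon
  have hn0 : (0 : ℝ) < ((n + 1 : ℕ) : ℝ) := by positivity
  -- If row n is at least 1, so are the dilated rows n, ..., 2n. Together they contribute a constant
  -- times n^{r-1}, which exceeds the total T for large n.
  have hge : ∀ m ∈ Finset.Icc n (2 * n), ENNReal.ofReal ((2 ^ |2 - r|)⁻¹ *
      ((n + 1 : ℕ) : ℝ) ^ (r - 2)) ≤ f m := fun m hm => by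
    rw [Finset.mem_Icc] at hm
    have h1 : 1 ≤ rowSum β q (fun u => G (c / 2 ^ (q + β) * u)) m :=
      hcon.trans (rowSum_le_rowSum hqβ hG hc hm.1 (by omega))
    rw [hf]
    simp only
    rw [min_eq_left h1, mul_one]
    refine ENNReal.ofReal_le_ofReal ?_
    have hm0 : (0 : ℝ) < ((m + 1 : ℕ) : ℝ) := by positivity
    have h2 := rpow_le_two_rpow_abs_mul (b := 2 - r) hn0 (x := ((m + 1 : ℕ) : ℝ))
      (by exact_mod_cast Nat.succ_le_succ hm.1)
      (by have : m + 1 ≤ 2 * (n + 1) := by omega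
          exact_mod_cast this)
    rw [show r - 2 = -(2 - r) by ring, Real.rpow_neg hn0.le, Real.rpow_neg hm0.le, ← mul_inv]
    gcongr
  have h3 : ∑ m ∈ Finset.Icc n (2 * n), f m ≤ T := by
    have hinj : ∑ m ∈ Finset.Icc n (2 * n), f m = ∑ m ∈ Finset.Icc (n - N) (2 * n - N), f (m + N) := by
      have hnN : N ≤ n := (le_max_left _ _).trans hn
      refine Finset.sum_nbij' (fun m => m - N) (fun m => m + N) ?_ ?_ ?_ ?_ ?_
      · intro m hm; rw [Finset.mem_Icc] at hm ⊢; omega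
      · intro m hm; rw [Finset.mem_Icc] at hm ⊢; omega
      · intro m hm; rw [Finset.mem_Icc] at hm; omega
      · intro m hm; omega
      · intro m hm; rw [Finset.mem_Icc] at hm; rw [Nat.sub_add_cancel (by omega)]
    rw [hinj]
    exact ENNReal.sum_le_tsum _
  have h4 : ENNReal.ofReal ((2 ^ |2 - r|)⁻¹ * ((n + 1 : ℕ) : ℝ) ^ (r - 1)) ≤ T := by
    refine le_trans ?_ ((Finset.sum_le_sum hge).trans h3)
    rw [Finset.sum_const, Nat.card_Icc, nsmul_eq_mul, show 2 * n + 1 - n = n + 1 by omega,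
      ← ENNReal.ofReal_natCast, ← ENNReal.ofReal_mul hn0.le]
    refine ENNReal.ofReal_le_ofReal (le_of_eq ?_)
    rw [show r - 1 = 1 + (r - 2) by ring, Real.rpow_add hn0, Real.rpow_one]
    ring
  rw [← ENNReal.ofReal_toReal hT'.ne] at h4
  have h5 := (ENNReal.ofReal_le_ofReal_iff ENNReal.toReal_nonneg).1 h4
  exact absurd (hN₀ n ((le_max_right _ _).trans hn)) (not_lt.2 h5)

/-! ### Weights and scales. -/

theorem reversedWeight_eq_inv_rowScale {β q : ℝ} {n j : ℕ} (hj : j ≤ n) :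
    reversedWeight β q (n + 1) (n - j) = (rowScale β q n j)⁻¹ := by
  have hn : (0 : ℝ) < ((n + 1 : ℕ) : ℝ) := by positivity
  have hj0 : (0 : ℝ) < ((j + 1 : ℕ) : ℝ) := by positivity
  have h1 : ((n + 1 : ℕ) : ℝ) - ((n - j : ℕ) : ℝ) = ((j + 1 : ℕ) : ℝ) := by
    rw [Nat.cast_sub hj]; push_cast; ring
  rw [reversedWeight, h1, rowScale, Real.div_rpow hj0.le hn.le, Real.rpow_neg hj0.le,
    Real.rpow_add hn]
  field_simp

theorem ArrayApprox.exists_rowScale_bounds {β q : ℝ} {a : ℕ → ℕ → ℝ}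
    (ha : ArrayApprox a (reversedWeight β q)) :
    ∃ C : ℝ, 0 < C ∧ ∃ N : ℕ, ∀ n, N ≤ n → ∀ i ≤ n,
      (rowScale β q n (n - i))⁻¹ ≤ C * a (n + 1) i ∧
        a (n + 1) i ≤ C * (rowScale β q n (n - i))⁻¹ := by
  obtain ⟨⟨C₁, hC₁, N₁, h₁⟩, ⟨C₂, hC₂, N₂, h₂⟩⟩ := ha
  refine ⟨max C₁ C₂, by positivity, max N₁ N₂, fun n hn i hi => ?_⟩
  have heq : reversedWeight β q (n + 1) i = (rowScale β q n (n - i))⁻¹ := by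
    rw [← reversedWeight_eq_inv_rowScale (Nat.sub_le n i), Nat.sub_sub_self hi]
  have e1 := h₁ (n + 1) (by have := le_max_left N₁ N₂; omega) i (by omega)
  have e2 := h₂ (n + 1) (by have := le_max_right N₁ N₂; omega) i (by omega)
  rw [heq] at e1 e2
  have hz : 0 < (rowScale β q n (n - i))⁻¹ := inv_pos.2 (rowScale_pos _ _ _ _)
  have ha0 : 0 ≤ a (n + 1) i := by
    by_contra hcon
    have := mul_neg_of_pos_of_neg hC₂ (not_le.1 hcon)
    linarith
  exact ⟨e2.trans (by gcongr; exact le_max_right _ _), e1.trans (by gcongr; exact le_max_left _ _)⟩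

/-! ### Necessity of the moment conditions. -/

namespace SublinearExpectationSpace

variable {Ω : Type*} [MeasurableSpace Ω] {S : SublinearExpectationSpace Ω}
  {X : Ω → ℝ} {Xs : ℕ → Ω → ℝ} {a : ℕ → ℕ → ℝ} {p r β q ε : ℝ}

/-- The capacity of the event that a weighted sum in row `n + 1` exceeds `y` in absolute value. -/
noncomputable def exceedCap (S : SublinearExpectationSpace Ω) (a : ℕ → ℕ → ℝ) (Xs : ℕ → Ω → ℝ)
    (n : ℕ) (y : ℝ) : ℝ≥0∞ :=
  S.cap {ω | ∃ k ≤ n + 1, y < |∑ i ∈ Finset.range k, a (n + 1) i * Xs i ω|}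

theorem exceed_measurableSet (hXs : ∀ n, Xs n ∈ S.H) (n : ℕ) (y : ℝ) :
    MeasurableSet {ω | ∃ k ≤ n + 1, y < |∑ i ∈ Finset.range k, a (n + 1) i * Xs i ω|} := by
  have hXm : ∀ i, Measurable (Xs i) := fun i => S.measurable_of_mem _ (hXs i)
  have : {ω | ∃ k ≤ n + 1, y < |∑ i ∈ Finset.range k, a (n + 1) i * Xs i ω|} =
      ⋃ k ∈ Finset.Iic (n + 1), {ω | y < |∑ i ∈ Finset.range k, a (n + 1) i * Xs i ω|} := by
    ext ω; simp
  rw [this]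
  exact Finset.measurableSet_biUnion _ fun k _ => measurableSet_lt measurable_const
    (Finset.measurable_sum _ fun i _ => (hXm i).const_mul _).abs

theorem cap_lt_excess (hp : 0 < p) (hε : 0 < ε) {x : ℝ} (hx : 0 ≤ x) (n : ℕ) :
    S.cap {ω | x < excess a Xs p ε (n + 1) ω} = S.exceedCap a Xs n ((ε + x) ^ (1 / p)) := by
  rw [exceedCap]
  congr 1
  ext ω
  exact lt_excess_iff hp hε hx n ω

theorem lintegral_cap_excess (hp : 0 < p) (hε : 0 < ε) (n : ℕ) :
    ∫⁻ x in Ioi (0 : ℝ), S.cap {ω | x < excess a Xs p ε (n + 1) ω} =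
      ∫⁻ x in Ioi ε, S.exceedCap a Xs n (x ^ (1 / p)) := by
  have hcv := lintegral_Ioi_comp_of_deriv_pos (φ := fun u => ε + u) (φ' := fun _ => 1) (m := 0)
    (by fun_prop) (fun u _ => by simpa using (hasDerivAt_id u).const_add ε)
    (fun _ _ => one_pos) (Filter.tendsto_atTop_add_const_left _ ε Filter.tendsto_id)
    (fun x => S.exceedCap a Xs n (x ^ (1 / p)))
  rw [add_zero] at hcv
  rw [hcv]
  refine setLIntegral_congr_fun measurableSet_Ioi fun x hx => ?_
  rw [cap_lt_excess hp hε (le_of_lt hx), ENNReal.ofReal_one, one_mul]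

theorem choquet_excess_toENNReal (hp : 0 < p) (hε : 0 < ε) (n : ℕ) :
    (S.choquet (excess a Xs p ε (n + 1))).toENNReal =
      ∫⁻ x in Ioi ε, S.exceedCap a Xs n (x ^ (1 / p)) := by
  rw [choquet_eq_of_nonneg fun ω => excess_nonneg _ ω, EReal.toENNReal_coe,
    lintegral_cap_excess hp hε]

theorem E_excess_le (hXs : ∀ n, Xs n ∈ S.H) (hp : 0 < p) (hε : 0 < ε) (n : ℕ) :
    (S.E (excess a Xs p ε (n + 1))).toENNReal ≤
      (S.choquet (excess a Xs p ε (n + 1))).toENNReal := by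
  rw [choquet_eq_of_nonneg fun ω => excess_nonneg _ ω, EReal.toENNReal_coe]
  exact E_le_lintegral_cap (excess_mem hXs hp hε n) fun ω => excess_nonneg _ ω

theorem ChoquetMomentConv.expectation (hXs : ∀ n, Xs n ∈ S.H) (hp : 0 < p)
    (h : S.ChoquetMomentConv a Xs p r) : S.ExpectationMomentConv a Xs p r := fun ε hε =>
  lt_of_le_of_lt (ENNReal.tsum_le_tsum fun n => mul_le_mul_right (E_excess_le hXs hp hε n) _)
    (h ε hε)

theorem ExpectationMomentConv.tsum_exceedCap_lt_top (hXs : ∀ n, Xs n ∈ S.H) (hp : 0 < p)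
    (h : S.ExpectationMomentConv a Xs p r) {y : ℝ} (hy : 0 < y) :
    ∑' n : ℕ, ENNReal.ofReal (((n + 1 : ℕ) : ℝ) ^ (r - 2)) * S.exceedCap a Xs n y < ⊤ := by
  -- With 2ε = y^p, the event that the excess over ε is itself larger than ε is the event that the
  -- maximum exceeds y; Markov's inequality applies to it.
  set ε := y ^ p / 2 with hε
  have hε0 : 0 < ε := by positivity
  have hyε : (ε + ε) ^ (1 / p) = y := by
    rw [hε, add_halves, ← Real.rpow_mul hy.le, mul_one_div_cancel hp.ne', Real.rpow_one]
  refine ENNReal.lt_top_of_mul_lt_top_right (a := ENNReal.ofReal ε) (by simpa using hε0)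
    (lt_of_le_of_lt ?_ (h ε hε0))
  rw [← ENNReal.tsum_mul_left]
  refine ENNReal.tsum_le_tsum fun n => ?_
  rw [mul_left_comm, ← hyε, ← cap_lt_excess hp hε0 hε0.le]
  gcongr
  exact ofReal_mul_cap_le_E (excess_mem hXs hp hε0 n) (fun ω => excess_nonneg _ ω) hε0.le

/-- A summand is a difference of consecutive partial sums, so if it exceeds 2y, one of them exceeds
y. The converse union bound for independent events does the rest. -/
theorem min_one_rowSum_le_exceedCap (hX : X ∈ S.H) (hXs : ∀ n, Xs n ∈ S.H)
    (hindep : S.IndepSeq Xs) (hident : ∀ n, S.IdentDistr (Xs n) X) {C : ℝ} (hC : 0 < C) {n : ℕ}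
    (hw : ∀ i ≤ n, (rowScale β q n (n - i))⁻¹ ≤ C * a (n + 1) i) {y : ℝ} (hy : 0 < y) :
    min 1 (rowSum β q (fun u => S.tailCap X (2 * C * y * u)) n) ≤ 2 * S.exceedCap a Xs n y := by
  have hXm : ∀ i, Measurable (Xs i) := fun i => S.measurable_of_mem _ (hXs i)
  set B : ℕ → Set ℝ := fun i => {x | 2 * y < |a (n + 1) i * x|} with hB
  have hBm : ∀ i, MeasurableSet (B i) := fun i =>
    measurableSet_lt measurable_const (measurable_const_mul _).abs
  refine le_trans (min_le_min_left 1 ?_) ((min_one_sum_cap_le hXs hindep hBm (n + 1)).trans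
    (mul_le_mul_right (cap_mono (setOf_exists_mem_measurableSet hXm hBm _)
      (exceed_measurableSet hXs n y) ?_) 2))
  · rw [rowSum, ← Finset.sum_range_reflect]
    refine Finset.sum_le_sum fun i hi => ?_
    have hin : i ≤ n := Nat.lt_succ_iff.1 (Finset.mem_range.1 hi)
    rw [show n + 1 - 1 - i = n - i by omega, ← tailCap_eq_of_identDistr (hXs i) hX (hident i)]
    refine cap_mono (measurableSet_lt measurable_const (hXm i).abs) (hXm i (hBm i)) fun ω hω => ?_
    have hz := rowScale_pos β q n (n - i)
    have h1 : 2 * C * y * rowScale β q n (n - i) < |Xs i ω| := hω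
    have h2 := hw i hin
    have ha : 0 < a (n + 1) i := by
      have h3 : 0 < C * a (n + 1) i := (inv_pos.2 hz).trans_le h2
      exact pos_of_mul_pos_right h3 hC.le
    change 2 * y < |a (n + 1) i * Xs i ω|
    rw [abs_mul, abs_of_pos ha]
    have h4 : 1 ≤ C * a (n + 1) i * rowScale β q n (n - i) := by
      rwa [inv_le_iff_one_le_mul₀ hz] at h2
    calc 2 * y ≤ 2 * y * (C * a (n + 1) i * rowScale β q n (n - i)) :=
          le_mul_of_one_le_right (by positivity) h4
      _ = a (n + 1) i * (2 * C * y * rowScale β q n (n - i)) := by ring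
      _ < _ := by gcongr
  · rintro ω ⟨i, hi, hωi⟩
    have h1 : 2 * y < |a (n + 1) i * Xs i ω| := hωi
    by_contra hcon
    have h2 : ∀ k ≤ n + 1, |∑ i ∈ Finset.range k, a (n + 1) i * Xs i ω| ≤ y := fun k hk => by
      by_contra h
      exact hcon ⟨k, hk, not_le.1 h⟩
    have h3 : a (n + 1) i * Xs i ω = ∑ i ∈ Finset.range (i + 1), a (n + 1) i * Xs i ω -
        ∑ i ∈ Finset.range i, a (n + 1) i * Xs i ω := by
      rw [Finset.sum_range_succ]; ring
    rw [h3] at h1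
    have h4 := abs_sub (∑ i ∈ Finset.range (i + 1), a (n + 1) i * Xs i ω)
      (∑ i ∈ Finset.range i, a (n + 1) i * Xs i ω)
    have h5 := h2 (i + 1) (by omega)
    have h6 := h2 i (by omega)
    linarith

/-- If the maximal weighted sums converge completely, then the row sums are eventually less than
one. -/
theorem exists_forall_rowSum_lt_one_of_exceedCap (hX : X ∈ S.H) (hXs : ∀ n, Xs n ∈ S.H)
    (hindep : S.IndepSeq Xs) (hident : ∀ n, S.IdentDistr (Xs n) X) (hr : 1 < r)
    (hqβ : 0 < q + β) {C : ℝ} (hC : 0 < C) {N : ℕ}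
    (hw : ∀ n, N ≤ n → ∀ i ≤ n, (rowScale β q n (n - i))⁻¹ ≤ C * a (n + 1) i)
    (h : ∀ y : ℝ, 0 < y →
      ∑' n : ℕ, ENNReal.ofReal (((n + 1 : ℕ) : ℝ) ^ (r - 2)) * S.exceedCap a Xs n y < ⊤)
    {c : ℝ} (hc : 0 < c) :
    ∃ N₁, N ≤ N₁ ∧ ∀ n, N₁ ≤ n → rowSum β q (fun u => S.tailCap X (c * u)) n < 1 := by
  refine exists_forall_rowSum_lt_one hr hqβ (tailCap_antitone hX) hc ?_
  set y := c / 2 ^ (q + β) / (2 * C) with hy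
  have hy0 : 0 < y := by positivity
  have hyc : c / 2 ^ (q + β) = 2 * C * y := by rw [hy]; field_simp
  refine lt_of_le_of_lt ?_ (ENNReal.mul_lt_top (a := 2) (by simp) (h y hy0))
  rw [← ENNReal.tsum_mul_left]
  refine le_trans (ENNReal.tsum_le_tsum fun n => ?_) (ENNReal.tsum_add_le_tsum _ N)
  rw [mul_left_comm, hyc]
  gcongr
  exact min_one_rowSum_le_exceedCap hX hXs hindep hident hC (hw (n + N) (by omega)) hy0

theorem rowSeries_lt_top_of_exceedCap (hX : X ∈ S.H) (hXs : ∀ n, Xs n ∈ S.H)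
    (hindep : S.IndepSeq Xs) (hident : ∀ n, S.IdentDistr (Xs n) X) (hr : 1 < r)
    (hqβ : 0 < q + β) {C : ℝ} (hC : 0 < C) {N : ℕ}
    (hw : ∀ n, N ≤ n → ∀ i ≤ n, (rowScale β q n (n - i))⁻¹ ≤ C * a (n + 1) i)
    (h : ∀ y : ℝ, 0 < y →
      ∑' n : ℕ, ENNReal.ofReal (((n + 1 : ℕ) : ℝ) ^ (r - 2)) * S.exceedCap a Xs n y < ⊤)
    {c : ℝ} (hc : 0 < c) : rowSeries r β q (fun u => S.tailCap X (c * u)) < ⊤ := by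
  obtain ⟨N₁, hN₁, hlt⟩ :=
    exists_forall_rowSum_lt_one_of_exceedCap hX hXs hindep hident hr hqβ hC hw h hc
  refine ENNReal.tsum_lt_top_of_tsum_add_lt_top N₁ (fun n => ENNReal.mul_lt_top
    ENNReal.ofReal_lt_top (rowSum_lt_top (fun x => tailCap_le_one hX _) n)) ?_
  set y := c / (2 * C) with hy
  have hy0 : 0 < y := by positivity
  have hyc : c = 2 * C * y := by rw [hy]; field_simp
  refine lt_of_le_of_lt ?_ (ENNReal.mul_lt_top (a := 2) (by simp) (h y hy0))
  rw [← ENNReal.tsum_mul_left]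
  refine le_trans (ENNReal.tsum_le_tsum fun n => ?_) (ENNReal.tsum_add_le_tsum _ N₁)
  rw [mul_left_comm]
  gcongr
  rw [← min_eq_right (hlt (n + N₁) (by omega)).le]
  simp only [hyc]
  exact min_one_rowSum_le_exceedCap hX hXs hindep hident hC (hw (n + N₁) (by omega)) hy0

/-- The comparison is applied at every level x > 1. Row sums are below 1 there because they are
below 1 at x = 1 and decrease in x, so one starting row serves all levels. -/
theorem lintegral_rowSeries_lt_top_of_choquet (hX : X ∈ S.H) (hXs : ∀ n, Xs n ∈ S.H)
    (hindep : S.IndepSeq Xs) (hident : ∀ n, S.IdentDistr (Xs n) X) (hr : 1 < r) (hp : 0 < p)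
    (hqβ : 0 < q + β) {C : ℝ} (hC : 0 < C) {N : ℕ}
    (hw : ∀ n, N ≤ n → ∀ i ≤ n, (rowScale β q n (n - i))⁻¹ ≤ C * a (n + 1) i)
    (h : S.ChoquetMomentConv a Xs p r) :
    tailMoment (S.tailCap X) p 0 < ⊤ ∧
      ∫⁻ x in Ioi (1 : ℝ),
        rowSeries r β q (fun u => S.tailCap X (2 * C * x ^ (1 / p) * u)) < ⊤ := by
  have hG := tailCap_antitone hX
  have hG1 := tailCap_le_one hX
  have hexc := fun y hy => (h.expectation hXs hp).tsum_exceedCap_lt_top hXs hp (y := y) hy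
  have hc : 0 < 2 * C := by positivity
  obtain ⟨N₁, hN₁, hlt⟩ :=
    exists_forall_rowSum_lt_one_of_exceedCap hX hXs hindep hident hr hqβ hC hw hexc hc
  have h1 := h 1 one_pos
  simp only [choquet_excess_toENNReal hp one_pos] at h1
  have htail : ∑' n : ℕ, ENNReal.ofReal (((n + N₁ + 1 : ℕ) : ℝ) ^ (r - 2)) *
      ∫⁻ x in Ioi (1 : ℝ),
        rowSum β q (fun u => S.tailCap X (2 * C * x ^ (1 / p) * u)) (n + N₁) < ⊤ := by
    refine lt_of_le_of_lt ?_ (ENNReal.mul_lt_top (a := 2) (by simp) h1)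
    rw [← ENNReal.tsum_mul_left]
    refine le_trans (ENNReal.tsum_le_tsum fun n => ?_) (ENNReal.tsum_add_le_tsum _ N₁)
    rw [mul_left_comm]
    refine mul_le_mul_right ?_ _
    rw [← lintegral_const_mul' _ _ (by simp)]
    refine setLIntegral_mono' measurableSet_Ioi fun x hx => ?_
    have hx1 : (1 : ℝ) < x := hx
    have hx0 : 0 < x := by linarith
    have hxp : 1 ≤ x ^ (1 / p) := Real.one_le_rpow hx1.le (by positivity)
    have hle : rowSum β q (fun u => S.tailCap X (2 * C * x ^ (1 / p) * u)) (n + N₁) ≤ 1 := by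
      refine le_trans (Finset.sum_le_sum fun j _ => hG ?_) (hlt (n + N₁) (by omega)).le
      exact mul_le_mul_of_nonneg_right (le_mul_of_one_le_right hc.le hxp) (rowScale_pos _ _ _ _).le
    rw [← min_eq_right hle]
    exact min_one_rowSum_le_exceedCap hX hXs hindep hident hC (hw (n + N₁) (by omega))
      (by positivity)
  -- One summand of one row already gives the p-th moment, which in turn makes the finitely many
  -- initial rows integrable.
  have hp0 : tailMoment (S.tailCap X) p 0 < ⊤ := by
    have h2 := lt_top_iff_ne_top.2 (ENNReal.ne_top_of_tsum_ne_top htail.ne 0)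
    have h3 := ENNReal.lt_top_of_mul_lt_top_right
      (ENNReal.ofReal_pos.2 (by positivity : (0 : ℝ) < ((0 + N₁ + 1 : ℕ) : ℝ) ^ (r - 2))).ne' h2
    rw [← lintegral_comp_rpow_lt_top_iff hG hG1 hp (c := 2 * C * rowScale β q (0 + N₁) 0)
      (mul_pos hc (rowScale_pos _ _ _ _)) one_pos]
    refine lt_of_le_of_lt (lintegral_mono fun x => ?_) h3
    exact le_trans (le_of_eq (congrArg (S.tailCap X) (by ring))) (Finset.single_le_sum
      (f := fun j => S.tailCap X (2 * C * x ^ (1 / p) * rowScale β q (0 + N₁) j))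
      (fun _ _ => zero_le) (Finset.mem_range.2 (Nat.succ_pos (0 + N₁))))
  refine ⟨hp0, ?_⟩
  rw [lintegral_rowSeries hG]
  refine ENNReal.tsum_lt_top_of_tsum_add_lt_top N₁ (fun n => ENNReal.mul_lt_top
    ENNReal.ofReal_lt_top ?_) htail
  unfold rowSum
  have hGm := hG.measurable
  rw [lintegral_finsetSum _ fun j _ => by fun_prop]
  refine ENNReal.sum_lt_top.2 fun j _ => ?_
  have h4 := (lintegral_comp_rpow_lt_top_iff hG hG1 hp (c := 2 * C * rowScale β q n j)
    (mul_pos hc (rowScale_pos _ _ _ _)) one_pos).2 hp0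
  exact lt_of_eq_of_lt (congrArg (lintegral _) (funext fun x =>
    congrArg (S.tailCap X) (by ring))) h4

theorem tailMoment_lt_top_of_expectation (hX : X ∈ S.H) (hXs : ∀ n, Xs n ∈ S.H)
    (hindep : S.IndepSeq Xs) (hident : ∀ n, S.IdentDistr (Xs n) X) (hr : 1 < r) (hp : 0 < p)
    (hqβ : 0 < q + β) (ha : ArrayApprox a (reversedWeight β q)) {s : ℝ} {l : ℕ}
    (hlow : ∃ B : ℝ, 0 < B ∧ ∃ C : ℝ, ∀ G : ℝ → ℝ≥0∞, Antitone G →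
      tailMoment (fun u => G (B * u)) s l ≤ ENNReal.ofReal C * rowSeries r β q G)
    (h : S.ExpectationMomentConv a Xs p r) : tailMoment (S.tailCap X) s l < ⊤ := by
  obtain ⟨C, hC, N, hw⟩ := ha.exists_rowScale_bounds
  obtain ⟨B, hB, D, hlow⟩ := hlow
  have h1 := rowSeries_lt_top_of_exceedCap hX hXs hindep hident hr hqβ hC
    (fun n hn i hi => (hw n hn i hi).1) (fun y hy => h.tsum_exceedCap_lt_top hXs hp hy)
    (inv_pos.2 hB)
  have h2 := hlow (fun u => S.tailCap X (B⁻¹ * u)) fun x y hxy =>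
    tailCap_antitone hX (mul_le_mul_of_nonneg_left hxy (inv_pos.2 hB).le)
  simp only [inv_mul_cancel_left₀ hB.ne'] at h2
  exact h2.trans_lt (ENNReal.mul_lt_top ENNReal.ofReal_lt_top h1)

/-- For p > s a single row suffices, for p < s a fixed level suffices, and only p = s needs the full
integral over levels, which supplies the additional logarithm. -/
theorem tailMomentCond_of_choquet (hX : X ∈ S.H) (hXs : ∀ n, Xs n ∈ S.H)
    (hindep : S.IndepSeq Xs) (hident : ∀ n, S.IdentDistr (Xs n) X) (hr : 1 < r) (hp : 0 < p)
    (hqβ : 0 < q + β) (ha : ArrayApprox a (reversedWeight β q)) {s : ℝ} {l : ℕ}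
    (hlow : ∃ B : ℝ, 0 < B ∧ ∃ C : ℝ, ∀ G : ℝ → ℝ≥0∞, Antitone G →
      tailMoment (fun u => G (B * u)) s l ≤ ENNReal.ofReal C * rowSeries r β q G)
    (h : S.ChoquetMomentConv a Xs p r) : TailMomentCond (S.tailCap X) p s l := by
  obtain ⟨C, hC, N, hw⟩ := ha.exists_rowScale_bounds
  have h1 := lintegral_rowSeries_lt_top_of_choquet hX hXs hindep hident hr hp hqβ hC
    (fun n hn i hi => (hw n hn i hi).1) h
  refine ⟨fun _ => h1.1, fun hps => ?_, fun _ => tailMoment_lt_top_of_expectation hX hXs hindep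
    hident hr hp hqβ ha hlow (h.expectation hXs hp)⟩
  subst hps
  obtain ⟨B, hB, D, hlow⟩ := hlow
  exact tailMoment_succ_lt_top_of_rowSeries hB hlow (tailCap_antitone hX) (tailCap_le_one hX) hp
    (by positivity) one_pos h1.2

end SublinearExpectationSpace

/-! ### Sufficiency of the moment conditions. -/

theorem sum_inv_rowScale_rpow_le {β q v : ℝ} (hv : 0 < v) (hqv : 1 < q * v) (hqβ : 0 < q + β) :
    ∃ C η : ℝ, 0 < C ∧ 0 < η ∧ ∀ n : ℕ,
      ∑ j ∈ Finset.range (n + 1), ((rowScale β q n j)⁻¹) ^ v ≤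
        C * ((n + 1 : ℕ) : ℝ) ^ (-η) := by
  -- The exponent βv of j may be -1 or less; raising it to b > -1 keeps the power-sum bound
  -- available. Still b + 1 < (q + β)v, by qv > 1 for the first entry and q + β > 0 for the second,
  -- so the decay survives.
  set b := max (β * v) (-1 + (q + β) * v / 2) with hb
  have hqβv : 0 < (q + β) * v := by positivity
  have hb1 : -1 < b := lt_max_of_lt_right (by linarith)
  have hb2 : b < (q + β) * v - 1 := max_lt (by rw [add_mul]; linarith) (by linarith [add_mul q β v])
  refine ⟨(min 1 (b + 1))⁻¹, (q + β) * v - b - 1, inv_pos.2 (lt_min one_pos (by linarith)),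
    by linarith, fun n => ?_⟩
  have hn : (0 : ℝ) < ((n + 1 : ℕ) : ℝ) := by positivity
  have hterm : ∀ j : ℕ, ((rowScale β q n j)⁻¹) ^ v ≤
      ((n + 1 : ℕ) : ℝ) ^ (-((q + β) * v)) * ((j + 1 : ℕ) : ℝ) ^ b := fun j => by
    have hj : (1 : ℝ) ≤ ((j + 1 : ℕ) : ℝ) := by exact_mod_cast Nat.succ_pos j
    have hj0 : (0 : ℝ) < ((j + 1 : ℕ) : ℝ) := by linarith
    rw [rowScale, mul_inv, ← Real.rpow_neg hn.le, ← Real.rpow_neg hj0.le, neg_neg,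
      Real.mul_rpow (by positivity) (by positivity), ← Real.rpow_mul hn.le,
      ← Real.rpow_mul hj0.le, neg_mul]
    exact mul_le_mul_of_nonneg_left (Real.rpow_le_rpow_of_exponent_le hj (le_max_left _ _))
      (by positivity)
  calc ∑ j ∈ Finset.range (n + 1), ((rowScale β q n j)⁻¹) ^ v
      ≤ ((n + 1 : ℕ) : ℝ) ^ (-((q + β) * v)) *
          ∑ j ∈ Finset.range (n + 1), ((j + 1 : ℕ) : ℝ) ^ b := by
        rw [Finset.mul_sum]
        exact Finset.sum_le_sum fun j _ => hterm j
    _ ≤ ((n + 1 : ℕ) : ℝ) ^ (-((q + β) * v)) *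
          ((min 1 (b + 1))⁻¹ * ((n + 1 : ℕ) : ℝ) ^ (b + 1)) := by
        gcongr
        exact sum_range_rpow_le hb1 (n + 1)
    _ = _ := by
        rw [mul_left_comm, ← Real.rpow_add hn]
        congr 2
        ring

theorem tsum_mul_lintegral_rpow_lt_top {r p v η t ε A D : ℝ} (hA : 0 ≤ A) (hD : 0 ≤ D)
    (hε : 0 < ε) (h1 : r ≤ η * (t / 2)) (h2 : 1 < v * (t / 2) / p) :
    ∑' n : ℕ, ENNReal.ofReal (((n + 1 : ℕ) : ℝ) ^ (r - 2)) * ∫⁻ x in Ioi ε,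
      ENNReal.ofReal (A * (D * ((n + 1 : ℕ) : ℝ) ^ (-η) * (x ^ (1 / p)) ^ (-v)) ^ (t / 2)) < ⊤ := by
  set I := ∫⁻ x in Ioi ε, ENNReal.ofReal (x ^ (-(v * (t / 2) / p))) with hI
  have hIt : I < ⊤ := by rw [hI, lintegral_Ioi_rpow_neg h2 hε]; exact ENNReal.ofReal_lt_top
  have hsum : ∑' n : ℕ, ENNReal.ofReal (((n + 1 : ℕ) : ℝ) ^ (-2 : ℝ)) < ⊤ :=
    ((summable_nat_add_iff 1).2 (Real.summable_nat_rpow.2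
      (by norm_num : (-2 : ℝ) < -1))).tsum_ofReal_lt_top
  refine lt_of_le_of_lt ?_ (ENNReal.mul_lt_top (ENNReal.mul_lt_top
    (a := ENNReal.ofReal (A * D ^ (t / 2))) ENNReal.ofReal_lt_top hIt) hsum)
  rw [← ENNReal.tsum_mul_left]
  refine ENNReal.tsum_le_tsum fun n => ?_
  have hn1 : (1 : ℝ) ≤ ((n + 1 : ℕ) : ℝ) := by exact_mod_cast Nat.succ_pos n
  have hn : (0 : ℝ) < ((n + 1 : ℕ) : ℝ) := by linarith
  have hint : ∫⁻ x in Ioi ε, ENNReal.ofReal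
      (A * (D * ((n + 1 : ℕ) : ℝ) ^ (-η) * (x ^ (1 / p)) ^ (-v)) ^ (t / 2)) =
      ENNReal.ofReal (A * D ^ (t / 2)) * ENNReal.ofReal (((n + 1 : ℕ) : ℝ) ^ (-η * (t / 2))) * I := by
    rw [hI, ← ENNReal.ofReal_mul (by positivity), ← lintegral_const_mul' _ _ ENNReal.ofReal_ne_top]
    refine setLIntegral_congr_fun measurableSet_Ioi fun x hx => ?_
    have hx0 : 0 < x := hε.trans hx
    change ENNReal.ofReal _ = _ * ENNReal.ofReal _
    rw [← ENNReal.ofReal_mul (by positivity), Real.mul_rpow (by positivity) (by positivity),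
      Real.mul_rpow hD (by positivity), ← Real.rpow_mul hn.le, ← Real.rpow_mul hx0.le,
      ← Real.rpow_mul hx0.le, show 1 / p * -v * (t / 2) = -(v * (t / 2) / p) by ring]
    congr 1
    ring
  rw [hint]
  have hle : ENNReal.ofReal (((n + 1 : ℕ) : ℝ) ^ (r - 2)) *
      ENNReal.ofReal (((n + 1 : ℕ) : ℝ) ^ (-η * (t / 2))) ≤
        ENNReal.ofReal (((n + 1 : ℕ) : ℝ) ^ (-2 : ℝ)) := by
    rw [← ENNReal.ofReal_mul (by positivity), ← Real.rpow_add hn]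
    exact ENNReal.ofReal_le_ofReal (Real.rpow_le_rpow_of_exponent_le hn1 (by linarith))
  calc _ = ENNReal.ofReal (A * D ^ (t / 2)) * I * (ENNReal.ofReal (((n + 1 : ℕ) : ℝ) ^ (r - 2)) *
        ENNReal.ofReal (((n + 1 : ℕ) : ℝ) ^ (-η * (t / 2)))) := by ring
    _ ≤ _ := mul_le_mul_right hle _

namespace SublinearExpectationSpace

variable {Ω : Type*} [MeasurableSpace Ω] {S : SublinearExpectationSpace Ω}
  {X : Ω → ℝ} {Xs : ℕ → Ω → ℝ} {a : ℕ → ℕ → ℝ} {p r β q ε : ℝ}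

theorem E_le_of_tailMoment_one_lt_top (hX : X ∈ S.H) (h : tailMoment (S.tailCap X) 1 0 < ⊤) :
    ∃ d : ℝ, S.E (fun ω => |X ω|) ≤ (d : EReal) := by
  have h1 := (lintegral_cap_rpow_lt_top_iff hX one_pos).2 h
  simp only [Real.rpow_one] at h1
  refine ⟨_, E_le_of_lintegral_cap_le (abs_mem hX) (fun ω => abs_nonneg _) ENNReal.toReal_nonneg
    (ENNReal.ofReal_toReal h1.ne).ge⟩

/-- Otherwise 0 = E[X - X] ≤ E[X] + E[-X] would be -∞. -/
theorem E_ne_bot_of_E_neg_ne_top (hX : X ∈ S.H) (h : S.E (fun ω => -X ω) ≠ ⊤) : S.E X ≠ ⊥ := by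
  intro hbot
  have h1 := S.subadditive X hX _ (neg_mem hX) (fun h' => by simp [hbot] at h') (fun h' => h h'.2)
  have h2 : S.E (fun ω => X ω + -X ω) = ((0 : ℝ) : EReal) := by
    simpa using S.const 0
  rw [h2, hbot, EReal.bot_add] at h1
  exact absurd h1 (by simp)

/-- Identical distribution transfers only finite expectations, so finiteness of E[Y] and E[-Y] is
first derived from the first moment. -/
theorem E_const_mul_nonpos_of_identDistr {Y : Ω → ℝ} (hX : X ∈ S.H) (hY : Y ∈ S.H)
    (h : S.IdentDistr Y X) (hm : tailMoment (S.tailCap X) 1 0 < ⊤) (h0 : S.E X = 0)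
    (h0' : S.E (fun ω => -X ω) = 0) (b : ℝ) : S.E (fun ω => b * Y ω) ≤ 0 := by
  rw [← tailCap_eq_of_identDistr hY hX h] at hm
  obtain ⟨d, hd⟩ := E_le_of_tailMoment_one_lt_top hY hm
  have ht : S.E Y ≠ ⊤ :=
    ((E_le_of_le hY (abs_mem hY) fun ω => le_abs_self _).trans_lt
      (hd.trans_lt (EReal.coe_lt_top d))).ne
  have ht' : S.E (fun ω => -Y ω) ≠ ⊤ :=
    ((E_le_of_le (neg_mem hY) (abs_mem hY) fun ω => neg_le_abs _).trans_lt
      (hd.trans_lt (EReal.coe_lt_top d))).ne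
  have hb := E_ne_bot_of_E_neg_ne_top hY ht'
  have hb' := E_ne_bot_of_E_neg_ne_top (neg_mem hY) (by simpa using ht)
  have e1 : S.E Y = 0 := (h id measurable_id hY hX ht hb (by simp [h0]) (by simp [h0])).trans h0
  have e2 : S.E (fun ω => -Y ω) = 0 :=
    (h _ measurable_neg (neg_mem hY) (neg_mem hX) ht' hb' (by simp [h0']) (by simp [h0'])).trans h0'
  rcases le_total 0 b with hb0 | hb0
  · rw [S.pos_homogeneous Y hY b hb0, e1, mul_zero]
  · have h1 := S.pos_homogeneous _ (neg_mem hY) (-b) (by linarith)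
    simp only [neg_mul_neg] at h1
    rw [h1, e2, mul_zero]

/-- A crude bound for the finitely many rows on which nothing is known about the weights: if a
partial sum exceeds y ≥ 0, some summand exceeds y/(n+1). The added 1 avoids dividing by a zero
weight. -/
theorem exceedCap_le_sum_tailCap (hX : X ∈ S.H) (hXs : ∀ n, Xs n ∈ S.H)
    (hident : ∀ n, S.IdentDistr (Xs n) X) (n : ℕ) (y : ℝ) :
    S.exceedCap a Xs n y ≤ ∑ i ∈ Finset.range (n + 1),
      S.tailCap X ((((n + 1 : ℕ) : ℝ) * (|a (n + 1) i| + 1))⁻¹ * y) := by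
  have hXm : ∀ i, Measurable (Xs i) := fun i => S.measurable_of_mem _ (hXs i)
  have hm : ∀ i ∈ Finset.range (n + 1), MeasurableSet
      {ω | (((n + 1 : ℕ) : ℝ) * (|a (n + 1) i| + 1))⁻¹ * y < |Xs i ω|} :=
    fun i _ => measurableSet_lt measurable_const (hXm i).abs
  refine (cap_mono (exceed_measurableSet hXs n y) (Finset.measurableSet_biUnion _ hm) ?_).trans
    ((cap_biUnion_le _ hm).trans (Finset.sum_le_sum fun i _ => ?_))
  · rintro ω ⟨k, hk, hlt⟩
    by_contra hcon
    simp only [mem_iUnion, mem_ofPred_eq, not_exists, not_lt, exists_prop, not_and] at hcon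
    refine absurd hlt (not_lt.2 ?_)
    calc |∑ i ∈ Finset.range k, a (n + 1) i * Xs i ω|
        ≤ ∑ i ∈ Finset.range k, |a (n + 1) i * Xs i ω| := Finset.abs_sum_le_sum_abs _ _
      _ ≤ ∑ i ∈ Finset.range (n + 1), |a (n + 1) i * Xs i ω| :=
          Finset.sum_le_sum_of_subset_of_nonneg (Finset.range_mono hk) fun _ _ _ => abs_nonneg _
      _ ≤ ∑ i ∈ Finset.range (n + 1), y / ((n + 1 : ℕ) : ℝ) := by
          refine Finset.sum_le_sum fun i hi => ?_
          have h1 := hcon i hi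
          rw [abs_mul]
          calc |a (n + 1) i| * |Xs i ω| ≤ (|a (n + 1) i| + 1) * |Xs i ω| := by gcongr; linarith
            _ ≤ (|a (n + 1) i| + 1) * ((((n + 1 : ℕ) : ℝ) * (|a (n + 1) i| + 1))⁻¹ * y) := by
                gcongr
            _ = _ := by field_simp
      _ = y := by
          rw [Finset.sum_const, Finset.card_range, nsmul_eq_mul, mul_div_cancel₀]
          positivity
  · rw [← tailCap_eq_of_identDistr (hXs i) hX (hident i)]
    rfl

theorem lintegral_exceedCap_lt_top (hX : X ∈ S.H) (hXs : ∀ n, Xs n ∈ S.H)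
    (hident : ∀ n, S.IdentDistr (Xs n) X) (hp : 0 < p) (hε : 0 < ε)
    (h : tailMoment (S.tailCap X) p 0 < ⊤) (n : ℕ) :
    ∫⁻ x in Ioi ε, S.exceedCap a Xs n (x ^ (1 / p)) < ⊤ := by
  refine (lintegral_mono fun x => exceedCap_le_sum_tailCap hX hXs hident n _).trans_lt ?_
  have hGm := (tailCap_antitone hX).measurable
  rw [lintegral_finsetSum _ fun j _ => by fun_prop]
  exact ENNReal.sum_lt_top.2 fun i _ => (lintegral_comp_rpow_lt_top_iff (tailCap_antitone hX)
    (tailCap_le_one hX) hp (by positivity) hε).2 h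

/-- The maximal inequality at threshold y/t, so that t times the threshold is y, with D estimated by
the decay of the sums of v-th powers of the inverse scales. -/
theorem exceedCap_le_rowSum_add (hX : X ∈ S.H) (hXs : ∀ n, Xs n ∈ S.H) (hindep : S.IndepSeq Xs)
    (hident : ∀ n, S.IdentDistr (Xs n) X) {v K t C C' η : ℝ} (hv : 0 < v) (hv2 : v ≤ 2)
    (hK : 0 < K)
    (hXK : ∀ i, ∫⁻ x in Ioi (0 : ℝ), S.cap {ω | x < |Xs i ω| ^ v} ≤ ENNReal.ofReal K)
    (hmean : v ≤ 1 ∨ (1 ≤ v ∧ ∀ i, ∀ b : ℝ, S.E (fun ω => b * Xs i ω) ≤ 0))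
    (ht : 0 < t) (hC : 0 < C) (hC' : 0 < C') {n : ℕ}
    (hw : ∀ i ≤ n, |a (n + 1) i| ≤ C * (rowScale β q n (n - i))⁻¹)
    (hsum : ∑ j ∈ Finset.range (n + 1), ((rowScale β q n j)⁻¹) ^ v ≤
      C' * ((n + 1 : ℕ) : ℝ) ^ (-η)) {y : ℝ} (hy : 0 < y) :
    S.exceedCap a Xs n y ≤ rowSum β q (fun u => S.tailCap X ((t * C)⁻¹ * y * u)) n +
      2 * ENNReal.ofReal (Real.exp 3 *
        ((C * t) ^ v * K * C' * ((n + 1 : ℕ) : ℝ) ^ (-η) * y ^ (-v)) ^ (t / 2)) := by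
  have hXm : ∀ i, Measurable (Xs i) := fun i => S.measurable_of_mem _ (hXs i)
  have hc : 0 < y / t := by positivity
  have hn : (0 : ℝ) < ((n + 1 : ℕ) : ℝ) := by positivity
  have h1 := cap_exists_lt_abs_sum_le hXs hindep (n := n + 1) (a := a (n + 1))
    (D := (C * t) ^ v * K * C' * ((n + 1 : ℕ) : ℝ) ^ (-η) * y ^ (-v)) hv hv2 hK.le hXK
    hmean hc (by positivity) ?_ ht.le
  · rw [mul_div_cancel₀ _ ht.ne'] at h1
    refine h1.trans (add_le_add_left ?_ _)
    refine le_trans (Finset.sum_le_sum fun i hi => ?_) (Finset.sum_range_reflect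
      (fun j => S.tailCap X ((t * C)⁻¹ * y * rowScale β q n j)) (n + 1)).le
    have hin : i ≤ n := Nat.lt_succ_iff.1 (Finset.mem_range.1 hi)
    rw [show n + 1 - 1 - i = n - i by omega, ← tailCap_eq_of_identDistr (hXs i) hX (hident i)]
    refine cap_mono (measurableSet_lt measurable_const ((hXm i).const_mul _).abs)
      (measurableSet_lt measurable_const (hXm i).abs) fun ω hω => ?_
    have hz := rowScale_pos β q n (n - i)
    have h2 : y / t < |a (n + 1) i * Xs i ω| := hω
    have h3 : y / t < C * (rowScale β q n (n - i))⁻¹ * |Xs i ω| := by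
      rw [abs_mul] at h2
      exact h2.trans_le (mul_le_mul_of_nonneg_right (hw i hin) (abs_nonneg _))
    change (t * C)⁻¹ * y * rowScale β q n (n - i) < |Xs i ω|
    calc (t * C)⁻¹ * y * rowScale β q n (n - i) = C⁻¹ * rowScale β q n (n - i) * (y / t) := by
          field_simp
      _ < C⁻¹ * rowScale β q n (n - i) * (C * (rowScale β q n (n - i))⁻¹ * |Xs i ω|) := by gcongr
      _ = |Xs i ω| := by field_simp
  · calc ∑ i ∈ Finset.range (n + 1), |a (n + 1) i / (y / t)| ^ v * K
        ≤ ∑ i ∈ Finset.range (n + 1),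
            (C * t) ^ v * K * y ^ (-v) * ((rowScale β q n (n + 1 - 1 - i))⁻¹) ^ v := by
          refine Finset.sum_le_sum fun i hi => ?_
          have hin : i ≤ n := Nat.lt_succ_iff.1 (Finset.mem_range.1 hi)
          have hz := rowScale_pos β q n (n - i)
          rw [show n + 1 - 1 - i = n - i by omega]
          have h2 : |a (n + 1) i / (y / t)| ≤ C * t * y⁻¹ * (rowScale β q n (n - i))⁻¹ := by
            rw [abs_div, abs_of_pos hc, div_le_iff₀ hc]
            refine (hw i hin).trans_eq ?_
            field_simp
          calc |a (n + 1) i / (y / t)| ^ v * K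
              ≤ (C * t * y⁻¹ * (rowScale β q n (n - i))⁻¹) ^ v * K := by gcongr
            _ = _ := by
              rw [Real.mul_rpow (by positivity) (by positivity),
                Real.mul_rpow (by positivity) (by positivity), Real.inv_rpow hy.le,
                Real.rpow_neg hy.le]
              ring
      _ = (C * t) ^ v * K * y ^ (-v) *
            ∑ j ∈ Finset.range (n + 1), ((rowScale β q n j)⁻¹) ^ v := by
          rw [← Finset.mul_sum,
            Finset.sum_range_reflect (fun j => ((rowScale β q n j)⁻¹) ^ v) (n + 1)]
      _ ≤ (C * t) ^ v * K * y ^ (-v) * (C' * ((n + 1 : ℕ) : ℝ) ^ (-η)) := by gcongr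
      _ = _ := by ring

/-- Complete moment convergence from the maximal inequality with moments of order `v`. -/
theorem choquetMomentConv_of_moment (hX : X ∈ S.H) (hXs : ∀ n, Xs n ∈ S.H)
    (hindep : S.IndepSeq Xs) (hident : ∀ n, S.IdentDistr (Xs n) X) (hr : 1 < r) (hp : 0 < p)
    (hqβ : 0 < q + β) (ha : ArrayApprox a (reversedWeight β q)) {v : ℝ} (hv : 0 < v) (hv2 : v ≤ 2)
    (hqv : 1 < q * v) (hXv : tailMoment (S.tailCap X) v 0 < ⊤)
    (hmean : v ≤ 1 ∨ (1 ≤ v ∧ ∀ i, ∀ b : ℝ, S.E (fun ω => b * Xs i ω) ≤ 0))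
    (hXp : tailMoment (S.tailCap X) p 0 < ⊤)
    (hseries : ∀ c ε : ℝ, 0 < c → 0 < ε →
      ∫⁻ x in Ioi ε, rowSeries r β q (fun u => S.tailCap X (c * x ^ (1 / p) * u)) < ⊤) :
    S.ChoquetMomentConv a Xs p r := by
  intro ε hε
  obtain ⟨C, hC, N, hw⟩ := ha.exists_rowScale_bounds
  obtain ⟨C', η, hC', hη, hsum⟩ := sum_inv_rowScale_rpow_le hv hqv hqβ
  set I := ∫⁻ x in Ioi (0 : ℝ), S.cap {ω | x < |X ω| ^ v} with hI
  have hIt : I < ⊤ := (lintegral_cap_rpow_lt_top_iff hX hv).2 hXv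
  set K := I.toReal + 1 with hK
  have hK0 : 0 < K := by positivity
  have hXK : ∀ i, ∫⁻ x in Ioi (0 : ℝ), S.cap {ω | x < |Xs i ω| ^ v} ≤ ENNReal.ofReal K := fun i => by
    rw [lintegral_cap_rpow_eq hv, tailCap_eq_of_identDistr (hXs i) hX (hident i),
      ← lintegral_cap_rpow_eq hv, ← hI, ← ENNReal.ofReal_toReal hIt.ne]
    exact ENNReal.ofReal_le_ofReal (by linarith)
  -- The first term gives r ≤ η t/2, for summability in n; the second gives v t/(2p) > 1, for
  -- integrability in x.
  set t := 2 * (r / η + 2 * p / v) with ht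
  have ht0 : 0 < t := by positivity
  have ht1 : r ≤ η * (t / 2) := by
    have : η * (t / 2) = r + η * (2 * p / v) := by rw [ht]; field_simp
    rw [this]
    have : 0 < η * (2 * p / v) := by positivity
    linarith
  have ht2 : 1 < v * (t / 2) / p := by
    have : v * (t / 2) / p = v * (r / η) / p + 2 := by rw [ht]; field_simp
    rw [this]
    have : 0 < v * (r / η) / p := by positivity
    linarith
  simp only [choquet_excess_toENNReal hp hε]
  refine ENNReal.tsum_lt_top_of_tsum_add_lt_top N (fun n => ENNReal.mul_lt_top
    ENNReal.ofReal_lt_top (lintegral_exceedCap_lt_top hX hXs hident hp hε hXp n)) ?_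
  have h1 := hseries (t * C)⁻¹ ε (by positivity) hε
  rw [lintegral_rowSeries (tailCap_antitone hX)] at h1
  have h2 := tsum_mul_lintegral_rpow_lt_top (A := 2 * Real.exp 3) (D := (C * t) ^ v * K * C')
    (by positivity) (by positivity) hε ht1 ht2
  refine lt_of_le_of_lt ?_ (ENNReal.add_lt_top.2 ⟨h1, h2⟩)
  rw [← ENNReal.tsum_add]
  refine le_trans (ENNReal.tsum_le_tsum fun n => ?_) (ENNReal.tsum_add_le_tsum _ N)
  rw [← mul_add, ← lintegral_add_left (rowSum_measurable (tailCap_antitone hX) _ _ _ _ _)]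
  refine mul_le_mul_right (setLIntegral_mono' measurableSet_Ioi fun x hx => ?_) _
  have hx0 : 0 < x := hε.trans hx
  refine (exceedCap_le_rowSum_add hX hXs hindep hident hv hv2 hK0 hXK hmean ht0 hC hC' ?_
    (hsum (n + N)) (Real.rpow_pos_of_pos hx0 (1 / p))).trans_eq ?_
  · intro i hi
    have h3 := hw (n + N) (by omega) i hi
    have h4 : 0 < C * a (n + N + 1) i := (inv_pos.2 (rowScale_pos _ _ _ _)).trans_le h3.1
    rw [abs_of_pos (pos_of_mul_pos_right h4 hC.le)]
    exact h3.2
  · rw [mul_assoc 2 (Real.exp 3), ENNReal.ofReal_mul zero_le_two, ENNReal.ofReal_ofNat]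

/-- The choice of v with qv > 1. For q ≤ 1 one has max(p, s) ≥ 1 and zero means, and v = min(max(p,
s), 2) works as q > 1/2. For q > 1 the order v = min(max(p, s), 1) works without centring. -/
theorem choquetMomentConv_of_tailMomentCond (hX : X ∈ S.H) (hXs : ∀ n, Xs n ∈ S.H)
    (hindep : S.IndepSeq Xs) (hident : ∀ n, S.IdentDistr (Xs n) X) (hr : 1 < r) (hp : 0 < p)
    (hq : 1 / 2 < q) (hqβ : 0 < q + β) (ha : ArrayApprox a (reversedWeight β q))
    (hmean : q ≤ 1 → S.E X = 0 ∧ -S.E (fun ω => -X ω) = 0) {s C : ℝ} {l : ℕ} (hs : r / q ≤ s)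
    (hcount : ∀ u : ℝ, 1 ≤ u →
      latticeCount r β q u ≤ ENNReal.ofReal (C * (u ^ s * (1 + Real.log u) ^ l)))
    (h : TailMomentCond (S.tailCap X) p s l) : S.ChoquetMomentConv a Xs p r := by
  have hq0 : 0 < q := by linarith
  have hmax := h.tailMoment_max_lt_top
  have hmono : ∀ w ≤ max p s, tailMoment (S.tailCap X) w 0 < ⊤ := fun w hw =>
    (tailMoment_mono hw le_rfl).trans_lt hmax
  have hqm : 1 < q * max p s := by
    have h1 : r / q ≤ max p s := hs.trans (le_max_right _ _)
    rw [div_le_iff₀ hq0] at h1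
    linarith
  have hm0 : 0 < max p s := lt_max_of_lt_left hp
  have hseries := fun (c ε : ℝ) (hc : 0 < c) (hε : 0 < ε) => lintegral_rowSeries_lt_top hq0.le
    hqβ.le hcount (tailCap_antitone hX) (tailCap_le_one hX) hp hc hε h
  have hXp := hmono p (le_max_left _ _)
  rcases le_or_gt q 1 with hq1 | hq1
  · have hm1 : 1 ≤ max p s := by
      by_contra hcon
      rw [not_le] at hcon
      nlinarith
    refine choquetMomentConv_of_moment hX hXs hindep hident hr hp hqβ ha (v := min (max p s) 2)
      (lt_min hm0 two_pos) (min_le_right _ _) ?_ (hmono _ (min_le_left _ _))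
      (Or.inr ⟨le_min hm1 one_le_two, fun i b => ?_⟩) hXp hseries
    · rw [mul_min_of_nonneg _ _ hq0.le]
      exact lt_min hqm (by linarith)
    · obtain ⟨h0, h0'⟩ := hmean hq1
      exact E_const_mul_nonpos_of_identDistr hX (hXs i) (hident i) (hmono 1 hm1) h0
        (EReal.neg_eq_zero_iff.1 h0') b
  · refine choquetMomentConv_of_moment hX hXs hindep hident hr hp hqβ ha (v := min (max p s) 1)
      (lt_min hm0 one_pos) ((min_le_right _ _).trans one_le_two) ?_ (hmono _ (min_le_left _ _))
      (Or.inl (min_le_right _ _)) hXp hseries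
    rw [mul_min_of_nonneg _ _ hq0.le]
    exact lt_min hqm (by linarith)

/-- The equivalences for an abstract moment condition, given matching upper and lower bounds for the
lattice point counts. -/
theorem tailMomentCond_iff_choquetMomentConv (hX : X ∈ S.H) (hXs : ∀ n, Xs n ∈ S.H)
    (hindep : S.IndepSeq Xs) (hident : ∀ n, S.IdentDistr (Xs n) X) (hr : 1 < r) (hp : 0 < p)
    (hq : 1 / 2 < q) (hqβ : 0 < q + β) (ha : ArrayApprox a (reversedWeight β q))
    (hmean : q ≤ 1 → S.E X = 0 ∧ -S.E (fun ω => -X ω) = 0) {s C : ℝ} {l : ℕ} (hs : r / q ≤ s)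
    (hcount : ∀ u : ℝ, 1 ≤ u →
      latticeCount r β q u ≤ ENNReal.ofReal (C * (u ^ s * (1 + Real.log u) ^ l)))
    (hlow : ∃ B : ℝ, 0 < B ∧ ∃ C : ℝ, ∀ G : ℝ → ℝ≥0∞, Antitone G →
      tailMoment (fun u => G (B * u)) s l ≤ ENNReal.ofReal C * rowSeries r β q G) :
    (TailMomentCond (S.tailCap X) p s l ↔ S.ChoquetMomentConv a Xs p r) ∧
    (TailMomentCond (S.tailCap X) p s l → S.ExpectationMomentConv a Xs p r) ∧
    (p < s → S.ExpectationMomentConv a Xs p r → TailMomentCond (S.tailCap X) p s l) := by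
  have h1 := choquetMomentConv_of_tailMomentCond (a := a) hX hXs hindep hident hr hp hq hqβ ha
    hmean hs hcount
  refine ⟨⟨h1, tailMomentCond_of_choquet hX hXs hindep hident hr hp hqβ ha hlow⟩,
    fun h => (h1 h).expectation hXs hp, fun hps h => ⟨fun h' => absurd hps h'.not_gt,
      fun h' => absurd hps h'.not_lt, fun _ => tailMoment_lt_top_of_expectation hX hXs hindep
        hident hr hp hqβ ha hlow h⟩⟩

end SublinearExpectationSpace

/-! ### The three regimes of β. -/

theorem mainTheorem5 {Ω : Type*} [MeasurableSpace Ω] (S : SublinearExpectationSpace Ω)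
    (X : Ω → ℝ) (Xs : ℕ → Ω → ℝ) (hX : X ∈ S.H) (hXs : ∀ n, Xs n ∈ S.H)
    (hindep : S.IndepSeq Xs) (hident : ∀ n, S.IdentDistr (Xs n) X)
    (p q r β : ℝ) (hp : 0 < p) (hr : 1 < r) (hq : 1 / 2 < q) (hβ : -q < β)
    (hmean : q ≤ 1 → S.E X = 0 ∧ -S.E (fun ω => -X ω) = 0)
    (a : ℕ → ℕ → ℝ) (ha : ArrayApprox a (reversedWeight β q)) :
    (-q / r < β →
      (S.MomentCond X p (r / q) ↔ S.ChoquetMomentConv a Xs p r) ∧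
      (S.MomentCond X p (r / q) → S.ExpectationMomentConv a Xs p r) ∧
      (p < r / q → S.ExpectationMomentConv a Xs p r → S.MomentCond X p (r / q))) ∧
    (β = -q / r →
      (S.LogMomentCond X p (r / q) ↔ S.ChoquetMomentConv a Xs p r) ∧
      (S.LogMomentCond X p (r / q) → S.ExpectationMomentConv a Xs p r) ∧
      (p < r / q → S.ExpectationMomentConv a Xs p r → S.LogMomentCond X p (r / q))) ∧
    (β < -q / r →
      (S.MomentCond X p ((r - 1) / (q + β)) ↔ S.ChoquetMomentConv a Xs p r) ∧
      (S.MomentCond X p ((r - 1) / (q + β)) → S.ExpectationMomentConv a Xs p r) ∧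
      (p < (r - 1) / (q + β) →
        S.ExpectationMomentConv a Xs p r → S.MomentCond X p ((r - 1) / (q + β)))) := by
  have hq0 : 0 < q := by linarith
  have hr0 : 0 < r := by linarith
  have hr1 : 0 < r - 1 := by linarith
  have hqβ : 0 < q + β := by linarith
  have hs : 0 < r / q := by positivity
  refine ⟨fun h => ?_, fun h => ?_, fun h => ?_⟩
  · obtain ⟨C, -, hC⟩ := latticeCount_le_of_gt hr hq0 h
    rw [SublinearExpectationSpace.momentCond_iff hX hp hs]
    exact SublinearExpectationSpace.tailMomentCond_iff_choquetMomentConv hX hXs hindep hident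
      hr hp hq hqβ ha hmean le_rfl
      (fun u hu => by simpa using hC u hu) (tailMoment_le_rowSeries_of_gt hq0)
  · obtain ⟨C, -, hC⟩ := latticeCount_le_of_eq hr hq0 h
    rw [SublinearExpectationSpace.logMomentCond_iff hX hp hs]
    exact SublinearExpectationSpace.tailMomentCond_iff_choquetMomentConv hX hXs hindep hident
      hr hp hq hqβ ha hmean le_rfl
      (fun u hu => by simpa using hC u hu) (tailMoment_le_rowSeries_of_eq hr hq0 h)
  · obtain ⟨C, -, hC⟩ := latticeCount_le_of_lt hr hq0 hqβ h
    rw [SublinearExpectationSpace.momentCond_iff hX hp (by positivity)]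
    refine SublinearExpectationSpace.tailMomentCond_iff_choquetMomentConv hX hXs hindep hident
      hr hp hq hqβ ha hmean ?_
      (fun u hu => by simpa using hC u hu) (tailMoment_le_rowSeries_of_lt hqβ)
    -- The inequality r/q ≤ (r-1)/(q+β) amounts to β ≤ -q/r.
    rw [lt_div_iff₀ hr0] at h
    rw [div_le_div_iff₀ hq0 hqβ]
    linarith
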